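/- **Setting.** Let $m\ge 0$ and $r,s,\nu,\mu\ge 1$ be integers, let $V_0\in\mathbb R^m$ have positive entries, let $A_1,\dots,A_r,B_1,\dots,B_s$ be $m\times m$ matrices with non-negative entries, let $M_1,\dots,M_\nu,N_1,\dots,N_\mu$ be arbitrary real $m\times m$ matrices, and let $W_0$ be a symmetric positive definite $m\times m$ matrix. For a process $(z_t)_{t\in\mathbb Z}$ in $\mathbb R^m$ put $\mathcal I_t=\sigma(z_u:u\le t)$. For a vector $v$ write $\vec v=(v_1^2,\dots,v_m^2)'$; for a square matrix $S$ let $\mathrm{Vecd}(S)$ be its diagonal, $\mathrm{diag}(S)$ the diagonal matrix with the same diagonal, and $\mathrm{vech}(S)$ its lower triangular part, a vector of length $m^*=m(m+1)/2$. Square roots of positive definite matrices are the positive definite ones. In the (Engle) DCC-GARCH model, $D_t$ is diagonal with positive diagonal, $Q_t$ is positive definite, and for all $t\in\mathbb Z$, almost surely, $$\mathrm{Vecd}(D_t)=V_0+\sum_{i=1}^rA_i\mathrm{Vecd}(D_{t-i})+\sum_{j=1}^sB_j\vec z_{t-j},\qquad Q_t=W_0+\sum_{k=1}^\nu M_kQ_{t-k}M_k'+\sum_{l=1}^\mu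 N_l\varepsilon_{t-l}\varepsilon_{t-l}'N_l',$$ $$R_t=\mathrm{diag}(Q_t)^{-1/2}Q_t\,\mathrm{diag}(Q_t)^{-1/2},\qquad E[z_t\mid\mathcal I_{t-1}]=0,\qquad \mathrm{Var}(z_t\mid\mathcal I_{t-1})=H_t=D_t^{1/2}R_tD_t^{1/2},$$ where $\varepsilon_t=D_t^{-1/2}z_t$. The innovations are $\eta_t=R_t^{-1/2}\varepsilon_t$. The state vector $X_t\in\mathbb R^d$, $d=(r+s)m+(\nu+\mu)m^*$, consists of $\mathrm{Vecd}(D_{t-i})$ $(0\le i<r)$, $\vec z_{t-j}$ $(0\le j<s)$, $\mathrm{vech}(Q_{t-k})$ $(0\le k<\nu)$ and $\mathrm{vech}(\varepsilon_{t-l}\varepsilon_{t-l}')$ $(0\le l<\mu)$. Let $\mathcal X\subset\mathbb R^d$ be the set of vectors whose first part is positive, whose second part is non-negative, whose third part consists of half-vectorized positive definite matrices, and whose fourth part consists of half-vectorized matrices of the form $ee'$, $e\in\mathbb R^m$. Given $X_{t-1}=x\in\mathcal X$, the matrices $Q_t$ and $R_t=R(x)$ are determined by the equations above. Let $T(\varepsilon)$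 be the $d\times d$ matrix, in $4\times4$ block form according to the four parts of $X_t$, with: $T_{11}$ the block companion matrix with first block row $A_1,\dots,A_r$ (identities on the block subdiagonal, zeros elsewhere); $T_{12}$ with first block row $B_1,\dots,B_s$ and zeros below; $T_{21}$ with first block row $\Delta A_1,\dots,\Delta A_r$ and zeros below, and $T_{22}$ the block companion matrix with first block row $\Delta B_1,\dots,\Delta B_s$, where $\Delta$ is the diagonal matrix with diagonal $\vec\varepsilon$; $T_{33}$ the block companion matrix with first block row $\tilde M_1,\dots,\tilde M_\nu$; $T_{34}$ with first block row $\tilde N_1,\dots,\tilde N_\mu$ and zeros below, where $\tilde M$ is the matrix such that $\mathrm{vech}(MSM')=\tilde M\,\mathrm{vech}(S)$ for all symmetric $S$; $T_{44}$ the block companion matrix with first block row zero; and all other blocks zero. With $T_t=T(\varepsilon_t)$ one has $X_t=T_tX_{t-1}+\zeta_t$, where $\zeta_t$ depends on $\varepsilon_t$ only. **Assumptions.** Let $p\ge1$ be an integer. * **A0.** The innovations are Markov with respect to $(\mathcal I_t)$: there is a Markov kernel $\kappa$, not depending on $t$, such that the conditional law of $\eta_t$ given $\mathcal I_{t-1}$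 is $\kappa(X_{t-1},\cdot)$. For every $x\in\mathcal X$ the law $\kappa(x,\cdot)$ has mean $0$ and covariance matrix $I_m$. Write $E[\,\cdot\mid X_{t-1}=x]$ for expectations in which $\eta_t$ has law $\kappa(x,\cdot)$ and $\varepsilon_t=R(x)^{1/2}\eta_t$. * **E1.** $E[\|\eta_t\|^{2p}\mid X_{t-1}=x]<\infty$ for every $x\in\mathcal X$; the entrywise supremum $T^*=\sup_{x\in\mathcal X}E\big[|T_t^{\otimes p}|\;\big|\;X_{t-1}=x\big]$ is finite, where $\otimes p$ is the $p$-fold Kronecker power and $|\cdot|$ the entrywise absolute value; and its spectral radius satisfies $\rho(T^*)<1$. * **E2.** For every $x\in\mathcal X$, $\kappa(x,\cdot)$ has a density $f(\cdot\mid x)$ with respect to Lebesgue measure; $x\mapsto f(\eta\mid x)$ is continuous on $\mathcal X$ for every $\eta\in\mathbb R^m$; there is an integrable function $H$ with $f(\eta\mid x)\le H(\eta)$ for all $\eta\in\mathbb R^m$ and $x\in\mathcal X$; and there is a function $\bar h$, bounded on bounded subsets of $[0,\infty)$, with $\lim_{v\to+\infty}\bar h(v)/v^\gamma=0$ for every $\gamma>0$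 and $E[\|\eta_t\|^{2p}\mid X_{t-1}=x]\le\bar h(\|x\|)$ for every $x\in\mathcal X$. **Theorem.** Given the parameters and a kernel $\kappa$ as above that satisfy these assumptions, the DCC-GARCH model has a strictly stationary solution: on some probability space there is a process $(z_t,D_t,R_t)_{t\in\mathbb Z}$, together with positive definite matrices $(Q_t)_{t\in\mathbb Z}$, that satisfies all the equations of the model, in which the conditional law of $\eta_t$ given $\mathcal I_{t-1}$ is $\kappa(X_{t-1},\cdot)$ for every $t$, and such that $(z_t,D_t,R_t,Q_t)_{t\in\mathbb Z}$ is strictly stationary. This solution is measurable with respect to the $\sigma$-fields induced by the observations: $D_t$, $R_t$ and $Q_t$ are $\mathcal I_{t-1}$-measurable for every $t$ (and $z_t$ is $\mathcal I_t$-measurable). Moreover $E\|z_t\|^{2p}<\infty$ for every $t$. -/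

import Mathlib

open MeasureTheory ProbabilityTheory Filter Topology Matrix

noncomputable section

/-- Matrices carry the product σ-algebra of their entries. -/
instance instMeasurableSpaceMatrixDCC {a b : Type*} : MeasurableSpace (Matrix a b ℝ) :=
  inferInstanceAs (MeasurableSpace (a → b → ℝ))

namespace DCC

/-! ### Half-vectorization -/

/-- Index set of `vech`: pairs `(i, j)` with `j ≤ i`; it has `m (m + 1) / 2` elements. -/
abbrev VechIdx (m : ℕ) : Type := {q : Fin m × Fin m // q.2 ≤ q.1}

/-- The lower triangular part of a square matrix, as a vector. -/
def vech {m : ℕ} (S : Matrix (Fin m) (Fin m) ℝ) : VechIdx m → ℝ := fun q => S q.1.1 q.1.2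

/-- The symmetric matrix whose lower triangular part is the given vector. -/
def unvech {m : ℕ} (v : VechIdx m → ℝ) : Matrix (Fin m) (Fin m) ℝ :=
  Matrix.of fun i j => if h : j ≤ i then v ⟨(i, j), h⟩ else v ⟨(j, i), (not_le.mp h).le⟩

/-- The matrix `M̃` with `vech (M S Mᵀ) = M̃ (vech S)` for every symmetric `S`
(see `vech_mul_mul_transpose`). -/
def vechConj {m : ℕ} (M : Matrix (Fin m) (Fin m) ℝ) : Matrix (VechIdx m) (VechIdx m) ℝ :=
  Matrix.of fun u v =>
    if v.1.1 = v.1.2 then M u.1.1 v.1.1 * M u.1.2 v.1.1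
    else M u.1.1 v.1.1 * M u.1.2 v.1.2 + M u.1.1 v.1.2 * M u.1.2 v.1.1

/-- `unvech` inverts `vech` on symmetric matrices. -/
theorem unvech_vech {m : ℕ} (S : Matrix (Fin m) (Fin m) ℝ) (hS : S.IsSymm) :
    unvech (vech S) = S := by
  ext i j
  by_cases h : j ≤ i
  · simp [unvech, vech, h]
  · simpa [unvech, vech, h] using hS.apply i j

/-- The defining property of `vechConj`. -/
theorem vech_mul_mul_transpose {m : ℕ} (M S : Matrix (Fin m) (Fin m) ℝ) (hS : S.IsSymm) :
    vech (M * S * Mᵀ) = vechConj M *ᵥ vech S := by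
  classical
  funext u
  have e1 : vech (M * S * Mᵀ) u
      = ∑ x : Fin m × Fin m, M u.1.1 x.1 * S x.1 x.2 * M u.1.2 x.2 := by
    simp only [vech, Matrix.mul_apply, Matrix.transpose_apply, Finset.sum_mul]
    rw [Finset.sum_comm, ← Finset.univ_product_univ, Finset.sum_product]
  have e2 : (vechConj M *ᵥ vech S) u = ∑ x ∈ Finset.univ.filter (fun q : Fin m × Fin m => q.2 ≤ q.1),
      (if x.1 = x.2 then M u.1.1 x.1 * M u.1.2 x.1
        else M u.1.1 x.1 * M u.1.2 x.2 + M u.1.1 x.2 * M u.1.2 x.1) * S x.1 x.2 := by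
    simp only [Matrix.mulVec, dotProduct, vechConj, vech, Matrix.of_apply]
    exact (Finset.sum_subtype (Finset.univ.filter fun q : Fin m × Fin m => q.2 ≤ q.1)
      (by simp) (fun x : Fin m × Fin m => (if x.1 = x.2 then M u.1.1 x.1 * M u.1.2 x.1
        else M u.1.1 x.1 * M u.1.2 x.2 + M u.1.1 x.2 * M u.1.2 x.1) * S x.1 x.2)).symm
  have e3 : ∑ x ∈ Finset.univ.filter (fun q : Fin m × Fin m => q.1 < q.2),
        M u.1.1 x.1 * S x.1 x.2 * M u.1.2 x.2
      = ∑ x ∈ Finset.univ.filter (fun q : Fin m × Fin m => q.2 < q.1),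
        M u.1.1 x.2 * S x.1 x.2 * M u.1.2 x.1 := by
    refine Finset.sum_nbij' Prod.swap Prod.swap ?_ ?_ ?_ ?_ ?_ <;> simp
    intro a b _
    rw [hS.apply a b]
    simp
  rw [e1, e2, ← Finset.sum_filter_add_sum_filter_not Finset.univ
    (fun q : Fin m × Fin m => q.2 ≤ q.1)]
  simp only [not_le]
  rw [e3, Finset.sum_filter, Finset.sum_filter, Finset.sum_filter, ← Finset.sum_add_distrib]
  refine Finset.sum_congr rfl fun x _ => ?_
  rcases lt_trichotomy x.1 x.2 with h | h | h
  · simp [not_le.mpr h, not_lt.mpr h.le]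
  · simp [h]; ring
  · simp [h, h.le, h.ne']; ring

/-! ### Parameters, state vectors and the linear recursion -/

/-- Parameters of a DCC-GARCH model of dimension `m` with `r` lags of the volatilities, `s` lags of
the squared observations, `k` lags of `Q` and `l` lags of the standardized residuals.
The coefficients with index `i` multiply the values at lag `i + 1`. -/
structure Params (m r s k l : ℕ) where
  V₀ : Fin m → ℝ
  A : Fin r → Matrix (Fin m) (Fin m) ℝ
  B : Fin s → Matrix (Fin m) (Fin m) ℝ
  W₀ : Matrix (Fin m) (Fin m) ℝ
  M : Fin k → Matrix (Fin m) (Fin m) ℝ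
  N : Fin l → Matrix (Fin m) (Fin m) ℝ
  V₀_pos : ∀ a, 0 < V₀ a
  A_nonneg : ∀ i a b, 0 ≤ A i a b
  B_nonneg : ∀ j a b, 0 ≤ B j a b
  W₀_posDef : W₀.PosDef

/-- Coordinates of the state vector: `r` lags of `Vecd(D)`, `s` lags of the squared observations,
`k` lags of `vech(Q)` and `l` lags of `vech(ε ε')`. -/
abbrev Idx (m r s k l : ℕ) : Type :=
  ((Fin r × Fin m) ⊕ (Fin s × Fin m)) ⊕ ((Fin k × VechIdx m) ⊕ (Fin l × VechIdx m))

/-- The state space `ℝ^d`. -/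
abbrev State (m r s k l : ℕ) : Type := Idx m r s k l → ℝ

/-- Block matrix with first block row `C 0, C 1, …` and zeros below. -/
def firstRow {ι : Type} (a : ℕ) {b : ℕ} (C : Fin b → Matrix ι ι ℝ) :
    Matrix (Fin a × ι) (Fin b × ι) ℝ :=
  Matrix.of fun u v => if u.1.val = 0 then C v.1 u.2 v.2 else 0

/-- Block companion matrix: first block row `C 0, C 1, …`, identities on the block subdiagonal. -/
def companion {ι : Type} [DecidableEq ι] {a : ℕ} (C : Fin a → Matrix ι ι ℝ) :
    Matrix (Fin a × ι) (Fin a × ι) ℝ :=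
  Matrix.of fun u v =>
    if u.1.val = 0 then C v.1 u.2 v.2
    else if u.1.val = v.1.val + 1 ∧ u.2 = v.2 then 1 else 0

/-- The matrix `T_t` of the autoregressive form `X_t = T_t X_{t-1} + ζ_t`, as a function of the
standardized residual `ε_t`. -/
def transMat {m r s k l : ℕ} (θ : Params m r s k l) (ε : Fin m → ℝ) :
    Matrix (Idx m r s k l) (Idx m r s k l) ℝ :=
  Matrix.fromBlocks
    (Matrix.fromBlocks
      (companion θ.A) (firstRow r θ.B)
      (firstRow s fun i => Matrix.diagonal (fun a => ε a ^ 2) * θ.A i)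
      (companion fun j => Matrix.diagonal (fun a => ε a ^ 2) * θ.B j))
    0 0
    (Matrix.fromBlocks
      (companion fun i => vechConj (θ.M i)) (firstRow k fun j => vechConj (θ.N j))
      0 (companion fun _ => 0))

/-- `p`-fold Kronecker power, with rows and columns indexed by `p`-tuples. -/
def kronPow {ι : Type} (p : ℕ) (T : Matrix ι ι ℝ) : Matrix (Fin p → ι) (Fin p → ι) ℝ :=
  Matrix.of fun I J => ∏ c, T (I c) (J c)

/-! ### Correlations and square roots -/

/-- `diag(Q)^{-1/2} Q diag(Q)^{-1/2}`. -/
def corr {m : ℕ} (Q : Matrix (Fin m) (Fin m) ℝ) : Matrix (Fin m) (Fin m) ℝ :=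
  Matrix.diagonal (fun a => (√(Q a a))⁻¹) * Q * Matrix.diagonal (fun a => (√(Q a a))⁻¹)

open scoped MatrixOrder in
/-- The positive semidefinite square root of a positive semidefinite matrix; it is positive definite
if the matrix is. -/
def msqrt {m : ℕ} (S : Matrix (Fin m) (Fin m) ℝ) : Matrix (Fin m) (Fin m) ℝ := CFC.sqrt S

/-- `Q_t` as a function of `X_{t-1}`. -/
def nextQ {m r s k l : ℕ} (θ : Params m r s k l) (x : State m r s k l) :
    Matrix (Fin m) (Fin m) ℝ :=
  θ.W₀ + ∑ i, θ.M i * unvech (fun q => x (.inr (.inl (i, q)))) * (θ.M i)ᵀ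
    + ∑ j, θ.N j * unvech (fun q => x (.inr (.inr (j, q)))) * (θ.N j)ᵀ

/-- `R_t` as a function of `X_{t-1}`. -/
def nextR {m r s k l : ℕ} (θ : Params m r s k l) (x : State m r s k l) :
    Matrix (Fin m) (Fin m) ℝ := corr (nextQ θ x)

/-- The possible values of the state vector: positive volatilities, nonnegative squares, positive
definite `Q`'s, and matrices of the form `ε ε'`. -/
def stateSpace (m r s k l : ℕ) : Set (State m r s k l) :=
  {x | (∀ i a, 0 < x (.inl (.inl (i, a)))) ∧
    (∀ j a, 0 ≤ x (.inl (.inr (j, a)))) ∧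
    (∀ i, (unvech fun q => x (.inr (.inl (i, q)))).PosDef) ∧
    (∀ j, ∃ e : Fin m → ℝ, ∀ q : VechIdx m, x (.inr (.inr (j, q))) = e q.1.1 * e q.1.2)}

/-! ### Assumptions on the innovations

`κ x` is the conditional law of `η_t` given `X_{t-1} = x`. Norms are sup norms; since all norms on
a finite-dimensional space are equivalent, none of the conditions below depends on this. -/

/-- Conditionally on the state, the innovations are centred with identity covariance matrix. -/
def IsStandardized {m r s k l : ℕ} (κ : Kernel (State m r s k l) (Fin m → ℝ)) : Prop :=
  ∀ x ∈ stateSpace m r s k l,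
    (∀ a, Integrable (fun e => e a) (κ x) ∧ ∫ e, e a ∂(κ x) = 0) ∧
    (∀ a b, Integrable (fun e => e a * e b) (κ x) ∧
      ∫ e, e a * e b ∂(κ x) = (1 : Matrix (Fin m) (Fin m) ℝ) a b)

/-- The matrix `E[|T_t^{⊗p}| | X_{t-1} = x]`, where `T_t` depends on `ε_t = R_t^{1/2} η_t`. -/
def condAbsKron {m r s k l : ℕ} (θ : Params m r s k l)
    (κ : Kernel (State m r s k l) (Fin m → ℝ)) (p : ℕ) (x : State m r s k l) :
    Matrix (Fin p → Idx m r s k l) (Fin p → Idx m r s k l) ℝ :=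
  Matrix.of fun I J => ∫ e, |kronPow p (transMat θ (msqrt (nextR θ x) *ᵥ e)) I J| ∂(κ x)

/-- The spectral radius: the largest modulus of a complex eigenvalue. -/
def specRadius {ι : Type} [Fintype ι] [DecidableEq ι] (T : Matrix ι ι ℝ) : ENNReal :=
  spectralRadius ℂ (T.map (algebraMap ℝ ℂ))

/-- The matrix `T*`, an entrywise supremum over the state space. -/
def Tstar {m r s k l : ℕ} (θ : Params m r s k l)
    (κ : Kernel (State m r s k l) (Fin m → ℝ)) (p : ℕ) :
    Matrix (Fin p → Idx m r s k l) (Fin p → Idx m r s k l) ℝ :=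
  Matrix.of fun I J => ⨆ x : stateSpace m r s k l, condAbsKron θ κ p x.1 I J

/-- Finite conditional `2p`-th moments of the innovations, finiteness of `T*`, and `ρ(T*) < 1`. -/
structure AssumptionE1 {m r s k l : ℕ} (θ : Params m r s k l)
    (κ : Kernel (State m r s k l) (Fin m → ℝ)) (p : ℕ) : Prop where
  moment : ∀ x ∈ stateSpace m r s k l, ∫⁻ e, ‖e‖ₑ ^ (2 * p) ∂(κ x) < ⊤
  bdd : ∀ I J, BddAbove (Set.range fun x : stateSpace m r s k l => condAbsKron θ κ p x.1 I J)
  spectral : specRadius (Tstar θ κ p) < 1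

/-- Conditional densities that are continuous in the state and dominated by an integrable function,
and conditional `2p`-th moments growing more slowly than every power of the norm of the state. -/
structure AssumptionE2 {m r s k l : ℕ} (κ : Kernel (State m r s k l) (Fin m → ℝ)) (p : ℕ) :
    Prop where
  density : ∃ f : State m r s k l → (Fin m → ℝ) → ℝ,
    (∀ x ∈ stateSpace m r s k l, Measurable (f x) ∧ (∀ e, 0 ≤ f x e) ∧
      κ x = volume.withDensity fun e => ENNReal.ofReal (f x e)) ∧
    (∀ e, ContinuousOn (fun x => f x e) (stateSpace m r s k l)) ∧
    ∃ H : (Fin m → ℝ) → ℝ, Integrable H volume ∧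
      ∀ x ∈ stateSpace m r s k l, ∀ e, f x e ≤ H e
  growth : ∃ h : ℝ → ℝ,
    (∀ x ∈ stateSpace m r s k l, ∫⁻ e, ‖e‖ₑ ^ (2 * p) ∂(κ x) ≤ ENNReal.ofReal (h ‖x‖)) ∧
    (∀ v : ℝ, BddAbove (h '' Set.Icc 0 v)) ∧
    ∀ γ : ℝ, 0 < γ → Tendsto (fun v : ℝ => h v / v ^ γ) atTop (𝓝 0)

/-! ### Solutions -/

/-- `𝓘_t = σ(z_u : u ≤ t)`, the information contained in the observations up to time `t`. -/
abbrev obsSigma {Ω : Type} {m : ℕ} (z : ℤ → Ω → Fin m → ℝ) (t : ℤ) : MeasurableSpace Ω :=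
  ⨆ u : ℤ, ⨆ _ : u ≤ t, MeasurableSpace.comap (z u) inferInstance

/-- The standardized residuals `ε_t = D_t^{-1/2} z_t`. -/
def resid {Ω : Type} {m : ℕ} (z : ℤ → Ω → Fin m → ℝ) (D : ℤ → Ω → Matrix (Fin m) (Fin m) ℝ)
    (t : ℤ) (ω : Ω) : Fin m → ℝ := fun a => (√(D t ω a a))⁻¹ * z t ω a

/-- The innovations `η_t = R_t^{-1/2} ε_t`. -/
def innov {Ω : Type} {m : ℕ} (z : ℤ → Ω → Fin m → ℝ) (D R : ℤ → Ω → Matrix (Fin m) (Fin m) ℝ)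
    (t : ℤ) (ω : Ω) : Fin m → ℝ := (msqrt (R t ω))⁻¹ *ᵥ resid z D t ω

/-- The state vector `X_t`. -/
def stateAt {Ω : Type} {m : ℕ} (r s k l : ℕ) (z : ℤ → Ω → Fin m → ℝ)
    (D Q : ℤ → Ω → Matrix (Fin m) (Fin m) ℝ) (t : ℤ) (ω : Ω) : State m r s k l :=
  Sum.elim
    (Sum.elim (fun u => D (t - (u.1.val : ℤ)) ω u.2 u.2)
      (fun u => z (t - (u.1.val : ℤ)) ω u.2 ^ 2))
    (Sum.elim (fun u => vech (Q (t - (u.1.val : ℤ)) ω) u.2)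
      (fun u => vech (Matrix.vecMulVec (resid z D (t - (u.1.val : ℤ)) ω)
        (resid z D (t - (u.1.val : ℤ)) ω)) u.2))

/-- `H_t = D_t^{1/2} R_t D_t^{1/2}`, for diagonal `D_t`. -/
def condCov {m : ℕ} (D R : Matrix (Fin m) (Fin m) ℝ) : Matrix (Fin m) (Fin m) ℝ :=
  Matrix.diagonal (fun a => √(D a a)) * R * Matrix.diagonal (fun a => √(D a a))

/-- `(z_t, D_t, R_t)`, together with `(Q_t)`, solves the DCC model with parameters `θ` in which `κ`
is the conditional law of the innovations given the state. -/
structure IsSolution {Ω : Type} [MeasurableSpace Ω] {m r s k l : ℕ} (θ : Params m r s k l)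
    (κ : Kernel (State m r s k l) (Fin m → ℝ)) (P : Measure Ω) (z : ℤ → Ω → Fin m → ℝ)
    (D R Q : ℤ → Ω → Matrix (Fin m) (Fin m) ℝ) : Prop where
  z_meas : ∀ t, Measurable (z t)
  D_meas : ∀ t, Measurable (D t)
  R_meas : ∀ t, Measurable (R t)
  Q_meas : ∀ t, Measurable (Q t)
  D_diag : ∀ᵐ ω ∂P, ∀ t, (D t ω).IsDiag ∧ ∀ a, 0 < D t ω a a
  D_eq : ∀ᵐ ω ∂P, ∀ t, (D t ω).diag = θ.V₀
    + ∑ i : Fin r, θ.A i *ᵥ (D (t - ((i.val : ℤ) + 1)) ω).diag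
    + ∑ j : Fin s, θ.B j *ᵥ fun a => z (t - ((j.val : ℤ) + 1)) ω a ^ 2
  Q_posDef : ∀ᵐ ω ∂P, ∀ t, (Q t ω).PosDef
  Q_eq : ∀ᵐ ω ∂P, ∀ t, Q t ω = θ.W₀
    + ∑ i : Fin k, θ.M i * Q (t - ((i.val : ℤ) + 1)) ω * (θ.M i)ᵀ
    + ∑ j : Fin l, θ.N j
        * Matrix.vecMulVec (resid z D (t - ((j.val : ℤ) + 1)) ω)
            (resid z D (t - ((j.val : ℤ) + 1)) ω)
        * (θ.N j)ᵀ
  R_eq : ∀ᵐ ω ∂P, ∀ t, R t ω = corr (Q t ω)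
  /-- Given the past observations, `η_t` has the law `κ X_{t-1}`. -/
  innov_law : ∀ t, ∀ S : Set (Fin m → ℝ), MeasurableSet S →
    P⟦innov z D R t ⁻¹' S | obsSigma z (t - 1)⟧
      =ᵐ[P] fun ω => (κ (stateAt r s k l z D Q (t - 1) ω)).real S
  /-- The observations have conditional mean zero. -/
  cond_mean : ∀ t a, Integrable (fun ω => z t ω a) P ∧
    P[fun ω => z t ω a | obsSigma z (t - 1)] =ᵐ[P] 0
  /-- The conditional covariance matrix of the observations is `H_t = D_t^{1/2} R_t D_t^{1/2}`. -/
  cond_cov : ∀ t a b, Integrable (fun ω => z t ω a * z t ω b) P ∧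
    P[fun ω => z t ω a * z t ω b | obsSigma z (t - 1)]
      =ᵐ[P] fun ω => condCov (D t ω) (R t ω) a b

/-- Strict stationarity: the law of the whole path is invariant under every time shift. -/
def StrictlyStationary {Ω E : Type} [MeasurableSpace Ω] [MeasurableSpace E] (P : Measure Ω)
    (Y : ℤ → Ω → E) : Prop :=
  (∀ t, Measurable (Y t)) ∧
    ∀ h : ℤ, P.map (fun ω (t : ℤ) => Y (t + h) ω) = P.map (fun ω (t : ℤ) => Y t ω)

end DCC

end

/-! The model is a Markov chain in disguise. Given `X_{t-1} = x`, draw `η` from `κ x`, put `ε =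
R(x)^{1/2} η`, and the next state is the affine image `T(ε) x + ζ(ε)` (`step_eq`). A stationary
solution is a stationary two-sided version of this chain, provided that the volatilities and the
matrices `Q_t` can be read off from past observations. The state only records squares and outer
products, which lose the sign of `z_t`, so the chain used is the pair (state, innovation). It lives
on `core`, a closed subset of the state space that the recursion never leaves; closedness makes it
Polish and bounded closed subsets compact.

Existence is a Krylov-Bogoliubov argument carried out directly on two-sided paths
(`StationaryChain.exists_stationary`). Shifted path laws of a one-sided chain are averaged; a
Lyapunov function with compact sublevel sets gives tightness, Prokhorov's theorem gives a limit
point, averaging makes the limit shift invariant, and the Feller property lets the transition law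
survive weak convergence. The Feller property comes from the dominated densities in E2
(`coreKernel_feller`).

The Lyapunov function is a weighted sum of the absolute monomials of degree `p` in the state. Since
`ρ(T*) < 1`, the row vector `w = Σ_n 1' (T*)^n` converges and satisfies `w T* = w - 1`
(`exists_subinvariant_weight`). Hence one step of the linear part lowers the weighted sum by the sum
of all monomials, a fixed proportion of it. The term `ζ` only contributes degree `p - 1` in the
state, times a conditional moment that E2 makes negligible against one further power. This is
`exists_drift`; it also bounds the `p`-th moments of the stationary state, hence the `2p`-th moments
of `z_t`.

For measurability, the `D` and `Q` blocks of `T` do not depend on `ε`. Their `p`-th Kronecker powers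
are dominated by sub-blocks of `T*`, so the `p`-th powers of the entries of their iterates are
summable (`summable_block_pow`). Together with the moment bound this makes the influence of the
remote past vanish almost surely, and both recursions can be solved backwards: `D_t` from past
squares (`volOf_solPast`), then the past residuals, then `Q_t` from those (`vechQOf_solPast`). The
solution is defined by these backward series, so it is measurable for the observations everywhere
and not only up to null sets. Conditional laws given the observations follow from the Markov
property by `condExp_chain`. -/

noncomputable section

/-! ### Stationary two-sided Markov processes from a Lyapunov function -/

namespace StationaryChain

open scoped NNReal ENNReal BoundedContinuousFunction
open Preorder

/-! ### One-sided chains, their shifted paths and Cesàro averages. -/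

section Trajectory

variable {E : Type*} [MeasurableSpace E]

/-- A homogeneous transition kernel, seen as depending on the whole past. -/
def histKernel (K : Kernel E E) (n : ℕ) : Kernel (Π _ : Finset.Iic n, E) E :=
  K.comap (fun x => x ⟨n, Finset.mem_Iic.2 le_rfl⟩) (measurable_pi_apply _)

instance (K : Kernel E E) [IsMarkovKernel K] (n : ℕ) : IsMarkovKernel (histKernel K n) := by
  unfold histKernel; infer_instance

/-- The law of the homogeneous Markov chain started at a point. -/
def chainLaw (K : Kernel E E) [IsMarkovKernel K] (x₀ : E) : Measure (ℕ → E) :=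
  Kernel.traj (X := fun _ => E) (histKernel K) 0 (fun _ => x₀)

variable (K : Kernel E E) [IsMarkovKernel K] (x₀ : E)

instance : IsProbabilityMeasure (chainLaw K x₀) := by
  unfold chainLaw; infer_instance

theorem chainLaw_map_succ (n : ℕ) :
    (chainLaw K x₀).map (fun y => (frestrictLe (π := fun _ => E) n y, y (n + 1)))
      = ((chainLaw K x₀).map (frestrictLe (π := fun _ => E) n)) ⊗ₘ histKernel K n := by
  unfold chainLaw
  rw [Kernel.traj_map_frestrictLe_apply, Kernel.partialTraj_compProd_eq_map_traj (Nat.zero_le n)]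

/-- The path seen from time `j`, extended to negative times by its initial value. -/
def viewFrom (j : ℕ) (y : ℕ → E) : ℤ → E := fun t => y (t + j).toNat

theorem measurable_viewFrom (j : ℕ) : Measurable (viewFrom (E := E) j) :=
  measurable_pi_lambda _ fun _ => measurable_pi_apply _

/-- The past up to time `0`. -/
def past (ω : ℤ → E) : ℕ → E := fun n => ω (-n)

theorem measurable_past : Measurable (past (E := E)) :=
  measurable_pi_lambda _ fun _ => measurable_pi_apply _

/-- The transition kernel as a function of the past. -/
def pastKernel : Kernel (ℕ → E) E := K.comap (fun q => q 0) (measurable_pi_apply _)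

instance : IsMarkovKernel (pastKernel K) := by unfold pastKernel; infer_instance

/-- Only the transition from time 0 to time 1 is considered: it is a genuine step of the chain for
every `j`, whereas transitions before time `-j` concern the frozen part of the path. Shift
invariance of the limit later carries this one transition to all times. -/
theorem viewFrom_markov (j : ℕ) :
    ((chainLaw K x₀).map (viewFrom j)).map (fun ω => (past ω, ω 1))
      = (((chainLaw K x₀).map (viewFrom j)).map past) ⊗ₘ pastKernel K := by
  -- The past seen from time `j` is a function of the first `j + 1` coordinates; the truncated
  -- subtraction repeats the initial value when `n > j`, which matches the frozen part of
  -- `viewFrom`.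
  let ρ : (Π _ : Finset.Iic j, E) → (ℕ → E) := fun x n => x ⟨j - n, Finset.mem_Iic.2 (by lia)⟩
  have hρ : Measurable ρ := measurable_pi_lambda _ fun _ => measurable_pi_apply _
  have e1 : past ∘ viewFrom (E := E) j = ρ ∘ frestrictLe (π := fun _ => E) j := by
    funext y n
    simp only [past, viewFrom, Function.comp, ρ, frestrictLe_apply]
    congr 1; lia
  have e2 : (fun ω => (past ω, ω 1)) ∘ viewFrom (E := E) j
      = Prod.map ρ id ∘ fun y => (frestrictLe (π := fun _ => E) j y, y (j + 1)) := by
    funext y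
    have := congrFun e1 y
    simp only [Function.comp, Prod.map, id] at this ⊢
    rw [this]
    congr 1
    simp only [viewFrom]
    congr 1; lia
  rw [Measure.map_map (by have := measurable_past (E := E); fun_prop) (measurable_viewFrom j),
    Measure.map_map measurable_past (measurable_viewFrom j), e1, e2,
    ← Measure.map_map (by fun_prop) (by fun_prop), chainLaw_map_succ,
    ← Measure.map_map hρ (by fun_prop)]
  have e3 : histKernel K j = (pastKernel K).comap ρ hρ := by
    ext x : 1
    simp [histKernel, pastKernel, Kernel.comap_apply, ρ]
  have : IsProbabilityMeasure ((chainLaw K x₀).map (frestrictLe (π := fun _ => E) j)) :=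
    Measure.isProbabilityMeasure_map (by fun_prop)
  ext s hs
  rw [Measure.map_apply (by fun_prop) hs, Measure.compProd_apply hs,
    Measure.compProd_apply ((by fun_prop : Measurable (Prod.map ρ id)) hs),
    lintegral_map (Kernel.measurable_kernel_prodMk_left hs) hρ, e3]
  rfl

/-- The hypothesis on `B` says that the interval `[0, B]` is preserved by `b ↦ δ b + C`, so the
drift inequality propagates the bound by induction over time. -/
theorem lintegral_chainLaw_le {V : E → ℝ≥0∞} (hVm : Measurable V) {δ C B : ℝ≥0∞}
    (hV : ∀ e, ∫⁻ e', V e' ∂(K e) ≤ δ * V e + C) (h0 : V x₀ ≤ B) (hB : δ * B + C ≤ B) (n : ℕ) :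
    ∫⁻ y, V (y n) ∂(chainLaw K x₀) ≤ B := by
  induction n with
  | zero =>
    have : (chainLaw K x₀).map (frestrictLe (π := fun _ => E) 0) = Measure.dirac (fun _ => x₀) := by
      unfold chainLaw
      rw [Kernel.traj_map_frestrictLe_apply, Kernel.partialTraj_self, Kernel.id_apply]
    have h2 : ∫⁻ y, V (y 0) ∂(chainLaw K x₀)
        = ∫⁻ x, V (x ⟨0, Finset.mem_Iic.2 le_rfl⟩)
            ∂((chainLaw K x₀).map (frestrictLe (π := fun _ => E) 0)) := by
      rw [lintegral_map (by fun_prop) (by fun_prop)]; rfl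
    rw [h2, this, lintegral_dirac' _ (by fun_prop)]
    exact h0
  | succ n ih =>
    have h2 : ∫⁻ y, V (y (n + 1)) ∂(chainLaw K x₀)
        = ∫⁻ q, V q.2 ∂((chainLaw K x₀).map
            (fun y => (frestrictLe (π := fun _ => E) n y, y (n + 1)))) := by
      rw [lintegral_map (by fun_prop) (by fun_prop)]
    have h3 : Measurable fun x => ∫⁻ e', V e' ∂(histKernel K n x) := hVm.lintegral_kernel
    rw [h2, chainLaw_map_succ, Measure.lintegral_compProd (by fun_prop), lintegral_map h3
      (by fun_prop)]
    calc _ ≤ ∫⁻ y, δ * V (y n) + C ∂(chainLaw K x₀) := lintegral_mono fun y => hV _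
      _ = δ * ∫⁻ y, V (y n) ∂(chainLaw K x₀) + C := by
          rw [lintegral_add_right _ measurable_const, lintegral_const_mul _ (by fun_prop)]; simp
      _ ≤ δ * B + C := by gcongr
      _ ≤ B := hB

/-- Cesàro averages of the laws of the shifted paths. -/
def cesaro (n : ℕ) : Measure (ℤ → E) :=
  ((n + 1 : ℕ) : ℝ≥0∞)⁻¹ • ∑ j ∈ Finset.range (n + 1), (chainLaw K x₀).map (viewFrom j)

instance (j : ℕ) : IsProbabilityMeasure ((chainLaw K x₀).map (viewFrom j)) :=
  Measure.isProbabilityMeasure_map (measurable_viewFrom j).aemeasurable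

theorem cesaro_le {n : ℕ} {s : Set (ℤ → E)} {b : ℝ≥0∞}
    (h : ∀ j, (chainLaw K x₀).map (viewFrom j) s ≤ b) : cesaro K x₀ n s ≤ b := by
  rw [cesaro, Measure.smul_apply, Measure.finsetSum_apply, smul_eq_mul]
  calc _ ≤ ((n + 1 : ℕ) : ℝ≥0∞)⁻¹ * ∑ j ∈ Finset.range (n + 1), b := by gcongr; exact h _
    _ = b := by
      rw [Finset.sum_const, Finset.card_range, nsmul_eq_mul, ← mul_assoc,
        ENNReal.inv_mul_cancel (by simp) (by simp), one_mul]

instance (n : ℕ) : IsProbabilityMeasure (cesaro K x₀ n) where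
  measure_univ := by
    rw [cesaro, Measure.smul_apply, Measure.finsetSum_apply, smul_eq_mul]
    simp only [measure_univ, Finset.sum_const, Finset.card_range, nsmul_eq_mul, mul_one]
    exact ENNReal.inv_mul_cancel (by simp) (by simp)

theorem integral_cesaro {n : ℕ} {f : (ℤ → E) → ℝ}
    (hf : ∀ j, Integrable f ((chainLaw K x₀).map (viewFrom j))) :
    ∫ ω, f ω ∂(cesaro K x₀ n)
      = ((n + 1 : ℕ) : ℝ)⁻¹ * ∑ j ∈ Finset.range (n + 1),
          ∫ ω, f ω ∂((chainLaw K x₀).map (viewFrom j)) := by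
  rw [cesaro, integral_smul_measure, integral_finsetSum_measure fun j _ => hf j]
  rw [ENNReal.toReal_inv, ENNReal.toReal_natCast, smul_eq_mul]

/-- The time shift. -/
def shift (ω : ℤ → E) : ℤ → E := fun t => ω (t + 1)

theorem measurable_shift : Measurable (shift (E := E)) :=
  measurable_pi_lambda _ fun _ => measurable_pi_apply _

omit [MeasurableSpace E] in
theorem shift_comp_viewFrom (j : ℕ) : shift ∘ viewFrom (E := E) j = viewFrom (j + 1) := by
  funext y t
  simp only [shift, viewFrom, Function.comp]
  congr 2; push_cast; ring

theorem map_add_eq_of_map_shift {μ : Measure (ℤ → E)} (h : μ.map shift = μ) (a : ℤ) :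
    μ.map (fun ω t => ω (t + a)) = μ := by
  have hm : ∀ a : ℤ, Measurable (fun (ω : ℤ → E) (t : ℤ) => ω (t + a)) := fun a =>
    measurable_pi_lambda _ fun _ => measurable_pi_apply _
  have hn : ∀ n : ℕ, μ.map (fun ω t => ω (t + (n : ℤ))) = μ := by
    intro n
    induction n with
    | zero => simp
    | succ n ih =>
      conv_rhs => rw [← h, ← ih]
      rw [Measure.map_map measurable_shift (hm _)]
      congr 1
      funext ω t
      simp only [shift, Function.comp]
      congr 1; push_cast; ring
  obtain ⟨n, rfl | rfl⟩ := a.eq_nat_or_neg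
  · exact hn n
  · conv_lhs => rw [← hn n]
    rw [Measure.map_map (hm _) (hm _)]
    have : ((fun (ω : ℤ → E) (t : ℤ) => ω (t + -(n : ℤ))) ∘ fun (ω : ℤ → E) (t : ℤ) => ω (t + (n : ℤ)))
        = id := by
      funext ω t; simp [Function.comp]
    rw [this, Measure.map_id]

/-- Shifting a view from time `j` gives the view from time `j + 1`, so the difference of the two
averages telescopes to two boundary terms. This asymptotic invariance becomes exact in the limit. -/
theorem integral_cesaro_comp_shift_sub {f : (ℤ → E) → ℝ} (hf : Measurable f) {b : ℝ}
    (hb : ∀ ω, |f ω| ≤ b) (n : ℕ) :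
    |∫ ω, f (shift ω) ∂(cesaro K x₀ n) - ∫ ω, f ω ∂(cesaro K x₀ n)|
      ≤ 2 * b * ((n + 1 : ℕ) : ℝ)⁻¹ := by
  have hi : ∀ (μ : Measure (ℤ → E)) [IsProbabilityMeasure μ], Integrable f μ := fun μ _ =>
    Integrable.of_bound hf.aestronglyMeasurable b (ae_of_all _ fun ω => hb ω)
  have hi' : ∀ (μ : Measure (ℤ → E)) [IsProbabilityMeasure μ],
      Integrable (fun ω => f (shift ω)) μ := fun μ _ =>
    Integrable.of_bound (hf.comp measurable_shift).aestronglyMeasurable b (ae_of_all _ fun ω => hb _)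
  rw [integral_cesaro K x₀ fun j => hi _, integral_cesaro K x₀ fun j => hi' _]
  have hs : ∀ j, ∫ ω, f (shift ω) ∂((chainLaw K x₀).map (viewFrom j))
      = ∫ ω, f ω ∂((chainLaw K x₀).map (viewFrom (j + 1))) := by
    intro j
    rw [← shift_comp_viewFrom, ← Measure.map_map measurable_shift (measurable_viewFrom j),
      integral_map measurable_shift.aemeasurable hf.aestronglyMeasurable]
  simp only [hs]
  rw [← mul_sub, ← Finset.sum_sub_distrib,
    Finset.sum_range_sub (fun j => ∫ ω, f ω ∂((chainLaw K x₀).map (viewFrom j))), abs_mul,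
    abs_of_nonneg (by positivity), mul_comm]
  gcongr
  have hle : ∀ j, |∫ ω, f ω ∂((chainLaw K x₀).map (viewFrom j))| ≤ b := by
    intro j
    have := norm_integral_le_of_norm_le_const (μ := (chainLaw K x₀).map (viewFrom j))
      (f := f) (ae_of_all _ fun ω => hb ω)
    simpa using this
  have h1 := abs_sub (∫ ω, f ω ∂((chainLaw K x₀).map (viewFrom (n + 1))))
    (∫ ω, f ω ∂((chainLaw K x₀).map (viewFrom 0)))
  linarith [hle (n + 1), hle 0]

/-- The one-step transition identity is linear in the path law, so it passes from the individual
views to their average. -/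
theorem cesaro_markov {F : (ℕ → E) × E → ℝ} (hF : Measurable F) {b : ℝ} (hb : ∀ q, |F q| ≤ b)
    (n : ℕ) :
    ∫ ω, F (past ω, ω 1) ∂(cesaro K x₀ n)
      = ∫ ω, ∫ e, F (past ω, e) ∂(K (ω 0)) ∂(cesaro K x₀ n) := by
  have hmap : Measurable fun ω : ℤ → E => (past ω, ω 1) :=
    measurable_past.prodMk (measurable_pi_apply _)
  have hint : StronglyMeasurable fun q : ℕ → E => ∫ e, F (q, e) ∂(pastKernel K q) :=
    StronglyMeasurable.integral_kernel_prod_right' hF.stronglyMeasurable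
  have hle : ∀ q : ℕ → E, |∫ e, F (q, e) ∂(pastKernel K q)| ≤ b := by
    intro q
    have := norm_integral_le_of_norm_le_const (μ := pastKernel K q)
      (f := fun e => F (q, e)) (ae_of_all _ fun ω => hb _)
    simpa using this
  have e0 : (fun ω : ℤ → E => ∫ e, F (past ω, e) ∂(K (ω 0)))
      = fun ω => (fun q : ℕ → E => ∫ e, F (q, e) ∂(pastKernel K q)) (past ω) := by
    funext ω; simp [pastKernel, past]
  rw [e0, integral_cesaro K x₀ (f := fun ω => F (past ω, ω 1)) fun j => Integrable.of_bound
      (hF.comp hmap).aestronglyMeasurable b (ae_of_all _ fun ω => hb _),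
    integral_cesaro K x₀ (f := fun ω => (fun q : ℕ → E => ∫ e, F (q, e) ∂(pastKernel K q)) (past ω))
      fun j => Integrable.of_bound (hint.comp_measurable measurable_past).aestronglyMeasurable b
        (ae_of_all _ fun ω => hle _)]
  congr 1
  refine Finset.sum_congr rfl fun j _ => ?_
  have : IsProbabilityMeasure (((chainLaw K x₀).map (viewFrom j)).map past) :=
    Measure.isProbabilityMeasure_map measurable_past.aemeasurable
  rw [← integral_map (φ := fun ω : ℤ → E => (past ω, ω 1)) hmap.aemeasurable
      hF.aestronglyMeasurable, viewFrom_markov, Measure.integral_compProd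
      (Integrable.of_bound hF.aestronglyMeasurable b (ae_of_all _ fun ω => hb _)),
    integral_map measurable_past.aemeasurable hint.aestronglyMeasurable]

end Trajectory

/-! ### Tightness and passage to the limit. -/

section Limit

variable {E : Type*} [TopologicalSpace E] [PolishSpace E] [MeasurableSpace E] [BorelSpace E]
  (K : Kernel E E) [IsMarkovKernel K] (x₀ : E)

-- A product of compact sublevel sets is compact by Tychonoff's theorem. The uniform bound on `∫ V`
-- and Markov's inequality control the escape from each coordinate, and a summable error budget over
-- `ℤ` controls the union.
omit [PolishSpace E] in
theorem isTightMeasureSet_cesaro {V : E → ℝ≥0} (hVc : Continuous V)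
    (hVk : ∀ c, IsCompact {e | V e ≤ c}) {B : ℝ≥0}
    (hB : ∀ n, ∫⁻ y, V (y n) ∂(chainLaw K x₀) ≤ B) :
    IsTightMeasureSet (Set.range (cesaro K x₀)) := by
  rw [isTightMeasureSet_iff_exists_isCompact_measure_compl_le]
  intro ε hε
  obtain ⟨δ, hδ, hδε⟩ := ENNReal.exists_pos_sum_of_countable hε.ne' ℤ
  refine ⟨Set.univ.pi fun t => {e | V e ≤ B / δ t}, isCompact_univ_pi fun t => hVk _, ?_⟩
  rintro _ ⟨n, rfl⟩
  refine cesaro_le K x₀ fun j => ?_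
  have hsub : (Set.univ.pi fun t => {e | V e ≤ B / δ t})ᶜ ⊆ ⋃ t : ℤ, {ω | B / δ t < V (ω t)} := by
    intro ω hω
    simpa [Set.mem_pi] using hω
  refine (measure_mono hsub).trans ((measure_iUnion_le _).trans (le_trans ?_ hδε.le))
  refine ENNReal.tsum_le_tsum fun t => ?_
  have hm : MeasurableSet {ω : ℤ → E | B / δ t < V (ω t)} :=
    measurableSet_lt measurable_const (hVc.measurable.comp (measurable_pi_apply t))
  rw [Measure.map_apply (measurable_viewFrom j) hm]
  -- For `B = 0` the threshold `B / δ t` is zero and Markov's inequality cannot be divided by it;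
  -- then `V` vanishes almost surely.
  by_cases hB0 : B = 0
  · have h0 : ∫⁻ y, V (y (t + j).toNat) ∂(chainLaw K x₀) = 0 := by
      simpa [hB0] using hB (t + j).toNat
    have hVm := hVc.measurable
    rw [lintegral_eq_zero_iff (by fun_prop)] at h0
    refine le_of_eq_of_le (measure_mono_null ?_ (ae_iff.1 h0)) zero_le
    intro y hy
    have hy' : B / δ t < V (y (t + j).toNat) := hy
    simp only [hB0, zero_div] at hy'
    simpa using hy'.ne'
  · have hd : (0 : ℝ≥0) < B / δ t := div_pos (pos_iff_ne_zero.2 hB0) (hδ t)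
    have hmk := mul_meas_ge_le_lintegral₀ (μ := chainLaw K x₀)
      (f := fun y => (V (y (t + j).toNat) : ℝ≥0∞))
      (hVc.measurable.comp (measurable_pi_apply _)).coe_nnreal_ennreal.aemeasurable ((B / δ t : ℝ≥0) : ℝ≥0∞)
    have h1 : ((B / δ t : ℝ≥0) : ℝ≥0∞) * chainLaw K x₀ (viewFrom j ⁻¹' {ω | B / δ t < V (ω t)})
        ≤ B := by
      refine le_trans (mul_le_mul_right (measure_mono ?_) _) (hmk.trans (hB _))
      intro y hy
      have hy' : B / δ t < V (y (t + j).toNat) := hy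
      simpa using hy'.le
    have h2 : ((B / δ t : ℝ≥0) : ℝ≥0∞) * δ t = B := by
      rw [← ENNReal.coe_mul, div_mul_cancel₀ _ (hδ t).ne']
    rw [← h2] at h1
    exact (ENNReal.mul_le_mul_iff_right (by exact_mod_cast hd.ne') ENNReal.coe_ne_top).1 h1

/-- A Feller kernel with a Lyapunov function has a two-sided strictly stationary Markov process. -/
theorem exists_stationary {V : E → ℝ≥0} (hVc : Continuous V) (hVk : ∀ c, IsCompact {e | V e ≤ c})
    {δ C B : ℝ≥0} (hV : ∀ e, ∫⁻ e', V e' ∂(K e) ≤ δ * V e + C) (h0 : V x₀ ≤ B)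
    (hB : δ * B + C ≤ B)
    (hFeller : ∀ F : (ℕ → E) × E →ᵇ ℝ, Continuous fun q : ℕ → E => ∫ e, F (q, e) ∂(K (q 0))) :
    ∃ μ : Measure (ℤ → E), IsProbabilityMeasure μ ∧
      (∀ a : ℤ, μ.map (fun ω t => ω (t + a)) = μ) ∧
      μ.map (fun ω => (past ω, ω 1)) = (μ.map past) ⊗ₘ pastKernel K ∧
      ∀ t, ∫⁻ ω, V (ω t) ∂μ ≤ B := by
  have hVm : Measurable V := hVc.measurable
  have hmom : ∀ n, ∫⁻ y, V (y n) ∂(chainLaw K x₀) ≤ B :=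
    lintegral_chainLaw_le K x₀ (V := fun e => (V e : ℝ≥0∞)) (by fun_prop) hV
      (by exact_mod_cast h0) (by exact_mod_cast hB)
  let Q : ℕ → ProbabilityMeasure (ℤ → E) := fun n => ⟨cesaro K x₀ n, inferInstance⟩
  have htight : IsTightMeasureSet
      {((μ : ProbabilityMeasure (ℤ → E)) : Measure (ℤ → E)) | μ ∈ Set.range Q} := by
    refine (isTightMeasureSet_cesaro K x₀ hVc hVk hmom).subset ?_
    rintro _ ⟨_, ⟨n, rfl⟩, rfl⟩
    exact ⟨n, rfl⟩
  have hcomp := isCompact_closure_of_isTightMeasureSet htight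
  -- An ultrafilter finer than `atTop` turns compactness of the closure into convergence, with no
  -- subsequence to extract.
  let U : Ultrafilter ℕ := Ultrafilter.of atTop
  have hU : (U : Filter ℕ) ≤ atTop := Ultrafilter.of_le _
  obtain ⟨μ, -, hμ⟩ := hcomp.ultrafilter_le_nhds (U.map Q) (by
    rw [Ultrafilter.coe_map, le_principal_iff]
    exact mem_map.2 (Filter.univ_mem' fun n => subset_closure ⟨n, rfl⟩))
  have hlim : Tendsto Q (U : Filter ℕ) (𝓝 μ) := hμ
  rw [ProbabilityMeasure.tendsto_iff_forall_integral_tendsto] at hlim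
  have hcs : Continuous (shift (E := E)) := continuous_pi fun t => continuous_apply _
  have hcp : Continuous (past (E := E)) := continuous_pi fun t => continuous_apply _
  have hcp1 : Continuous fun ω : ℤ → E => (past ω, ω 1) := hcp.prodMk (continuous_apply _)
  let := TopologicalSpace.upgradeIsCompletelyMetrizable (ℤ → E)
  let := TopologicalSpace.upgradeIsCompletelyMetrizable ((ℕ → E) × E)
  have hshift : (μ : Measure (ℤ → E)).map shift = μ := by
    have : IsProbabilityMeasure ((μ : Measure (ℤ → E)).map shift) :=
      Measure.isProbabilityMeasure_map measurable_shift.aemeasurable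
    refine ext_of_forall_integral_eq_of_IsFiniteMeasure fun f => ?_
    rw [integral_map measurable_shift.aemeasurable f.continuous.aestronglyMeasurable]
    have h1 := hlim (f.compContinuous ⟨shift, hcs⟩)
    have h2 := hlim f
    have h3 : Tendsto (fun n => ∫ ω, f (shift ω) ∂(cesaro K x₀ n) - ∫ ω, f ω ∂(cesaro K x₀ n))
        (U : Filter ℕ) (𝓝 0) := by
      refine (squeeze_zero_norm (fun n => integral_cesaro_comp_shift_sub K x₀
        f.continuous.measurable (fun ω => f.norm_coe_le_norm ω) n) ?_).mono_left hU
      have := (tendsto_inv_atTop_nhds_zero_nat (𝕜 := ℝ)).comp (tendsto_add_atTop_nat 1)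
      simpa using this.const_mul (2 * ‖f‖)
    exact sub_eq_zero.1 (tendsto_nhds_unique (h1.sub h2) h3)
  refine ⟨μ, inferInstance, map_add_eq_of_map_shift hshift, ?_, fun t => ?_⟩
  · have : IsProbabilityMeasure ((μ : Measure (ℤ → E)).map fun ω => (past ω, ω 1)) :=
      Measure.isProbabilityMeasure_map hcp1.measurable.aemeasurable
    have : IsProbabilityMeasure ((μ : Measure (ℤ → E)).map past) :=
      Measure.isProbabilityMeasure_map measurable_past.aemeasurable
    refine ext_of_forall_integral_eq_of_IsFiniteMeasure fun F => ?_
    have hFb : ∀ q, |F q| ≤ ‖F‖ := fun q => F.norm_coe_le_norm q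
    have hcont : Continuous fun q : ℕ → E => ∫ e, F (q, e) ∂(pastKernel K q) := hFeller F
    have hle : ∀ q : ℕ → E, ‖∫ e, F (q, e) ∂(K (q 0))‖ ≤ ‖F‖ := by
      intro q
      have := norm_integral_le_of_norm_le_const (μ := K (q 0))
        (f := fun e => F (q, e)) (ae_of_all _ fun ω => hFb _)
      simpa using this
    rw [integral_map hcp1.measurable.aemeasurable F.continuous.aestronglyMeasurable,
      Measure.integral_compProd (Integrable.of_bound F.continuous.aestronglyMeasurable ‖F‖
        (ae_of_all _ fun ω => hFb _)),
      integral_map measurable_past.aemeasurable hcont.aestronglyMeasurable]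
    -- This is where the Feller hypothesis enters: the conditional integral is itself a bounded
    -- continuous test function of the path, so both sides of `cesaro_markov` converge.
    let G : (ℤ → E) →ᵇ ℝ := BoundedContinuousFunction.ofNormedAddCommGroup
      (fun ω => ∫ e, F (past ω, e) ∂(K (past ω 0))) ((hFeller F).comp hcp) ‖F‖ fun ω => hle _
    have h1 := hlim (F.compContinuous ⟨_, hcp1⟩)
    have h2 := hlim G
    refine tendsto_nhds_unique h1 (h2.congr fun n => ?_)
    exact (cesaro_markov K x₀ F.continuous.measurable hFb n).symm
  · have hVt : Measurable fun ω : ℤ → E => V (ω t) := hVm.comp (measurable_pi_apply t)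
    -- Weak convergence says nothing directly about the unbounded `V`; its truncations are bounded
    -- and continuous, and monotone convergence recovers `V`.
    have htrunc : ∀ N : ℕ, ∫⁻ ω, ((min (V (ω t)) N : ℝ≥0) : ℝ≥0∞) ∂(μ : Measure (ℤ → E)) ≤ B := by
      intro N
      let g : (ℤ → E) →ᵇ ℝ≥0 := BoundedContinuousFunction.mkOfBound
        ⟨fun ω => min (V (ω t)) N, by fun_prop⟩ N (by
          intro x y
          rw [NNReal.dist_eq, abs_sub_le_iff]
          have h1 : ((min (V (x t)) N : ℝ≥0) : ℝ) ≤ N := by exact_mod_cast min_le_right _ _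
          have h2 : ((min (V (y t)) N : ℝ≥0) : ℝ) ≤ N := by exact_mod_cast min_le_right _ _
          constructor <;> simp only [ContinuousMap.coe_mk] <;>
            linarith [NNReal.coe_nonneg (min (V (x t)) N), NNReal.coe_nonneg (min (V (y t)) N)])
      have hl := (ProbabilityMeasure.tendsto_iff_forall_lintegral_tendsto.1 hμ) g
      refine le_of_tendsto' (x := (U : Filter ℕ)) hl fun n => ?_
      change ∫⁻ ω, ((min (V (ω t)) N : ℝ≥0) : ℝ≥0∞) ∂(cesaro K x₀ n) ≤ B
      rw [cesaro, lintegral_smul_measure, lintegral_finsetSum_measure]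
      calc _ ≤ ((n + 1 : ℕ) : ℝ≥0∞)⁻¹ * ∑ j ∈ Finset.range (n + 1), (B : ℝ≥0∞) := by
            rw [smul_eq_mul]
            gcongr with j
            rw [lintegral_map (by fun_prop) (measurable_viewFrom j)]
            refine le_trans (lintegral_mono fun y => ?_) (hmom (t + j).toNat)
            exact ENNReal.coe_le_coe.2 (min_le_left _ _)
        _ = B := by
          rw [Finset.sum_const, Finset.card_range, nsmul_eq_mul, ← mul_assoc,
            ENNReal.inv_mul_cancel (by simp) (by simp), one_mul]
    have hsup : ∀ ω : ℤ → E, (V (ω t) : ℝ≥0∞) = ⨆ N : ℕ, ((min (V (ω t)) N : ℝ≥0) : ℝ≥0∞) := by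
      intro ω
      refine le_antisymm ?_ (iSup_le fun N => by exact_mod_cast min_le_left _ _)
      obtain ⟨N, hN⟩ := exists_nat_ge (V (ω t))
      refine le_iSup_of_le N ?_
      rw [min_eq_left hN]
    simp only [hsup]
    rw [lintegral_iSup (fun N => by fun_prop)
      (fun N M h ω => by
        have : (N : ℝ≥0) ≤ M := by exact_mod_cast h
        simp only [ENNReal.coe_le_coe]
        gcongr)]
    exact iSup_le htrunc

end Limit

end StationaryChain

end

noncomputable section

/-! ### Square roots and correlation matrices -/

namespace DCC

section Sqrt

variable {m : ℕ}

open scoped MatrixOrder in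
theorem msqrt_mul_msqrt {S : Matrix (Fin m) (Fin m) ℝ} (hS : S.PosSemidef) :
    msqrt S * msqrt S = S :=
  CFC.sqrt_mul_sqrt_self S hS.nonneg

open scoped MatrixOrder in
theorem posSemidef_msqrt (S : Matrix (Fin m) (Fin m) ℝ) : (msqrt S).PosSemidef :=
  (CFC.sqrt_nonneg S).posSemidef

theorem transpose_msqrt (S : Matrix (Fin m) (Fin m) ℝ) : (msqrt S)ᵀ = msqrt S := by
  simpa using (posSemidef_msqrt S).1.eq

open scoped MatrixOrder Matrix.Norms.L2Operator in
theorem continuousOn_msqrt : ContinuousOn (msqrt (m := m)) {S | S.PosSemidef} := by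
  have h := CFC.continuousOn_sqrt (A := Matrix (Fin m) (Fin m) ℝ)
  simp only [Matrix.nonneg_iff_posSemidef] at h
  exact h

theorem isUnit_msqrt {S : Matrix (Fin m) (Fin m) ℝ} (hS : S.PosDef) : IsUnit (msqrt S) := by
  have h := hS.isUnit
  rw [← msqrt_mul_msqrt hS.posSemidef] at h
  exact isUnit_of_mul_isUnit_left h

theorem msqrt_sq_sum {S : Matrix (Fin m) (Fin m) ℝ} (hS : S.PosSemidef) (a b : Fin m) :
    ∑ c, msqrt S a c * msqrt S b c = S a b := by
  conv_rhs => rw [← msqrt_mul_msqrt hS]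
  rw [Matrix.mul_apply]
  refine Finset.sum_congr rfl fun c _ => ?_
  rw [← Matrix.transpose_apply (msqrt S) c b, transpose_msqrt]

/-- Row `a` of the symmetric square root has squared Euclidean length `S a a = 1`. This bounds
square roots of correlation matrices uniformly over the state space. -/
theorem abs_msqrt_le_one {S : Matrix (Fin m) (Fin m) ℝ} (hS : S.PosSemidef)
    (hd : ∀ a, S a a = 1) (a b : Fin m) : |msqrt S a b| ≤ 1 := by
  rw [← sq_le_one_iff_abs_le_one, ← hd a, ← msqrt_sq_sum hS a a, sq]
  exact Finset.single_le_sum (f := fun c => msqrt S a c * msqrt S a c)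
    (fun c _ => mul_self_nonneg _) (Finset.mem_univ b)

theorem isClosed_posSemidef : IsClosed {S : Matrix (Fin m) (Fin m) ℝ | S.PosSemidef} := by
  have : {S : Matrix (Fin m) (Fin m) ℝ | S.PosSemidef}
      = {S | Sᵀ = S} ∩ ⋂ x : Fin m → ℝ, {S | 0 ≤ x ⬝ᵥ (S *ᵥ x)} := by
    ext S
    simp [Matrix.posSemidef_iff_dotProduct_mulVec, Matrix.IsHermitian]
  rw [this]
  refine IsClosed.inter (isClosed_eq (by fun_prop) continuous_id)
    (isClosed_iInter fun x => isClosed_le continuous_const ?_)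
  fun_prop

theorem corr_apply (Q : Matrix (Fin m) (Fin m) ℝ) (a b : Fin m) :
    corr Q a b = (√(Q a a))⁻¹ * Q a b * (√(Q b b))⁻¹ := by
  simp [corr, Matrix.diagonal_mul, Matrix.mul_diagonal]

theorem corr_posDef {Q : Matrix (Fin m) (Fin m) ℝ} (hQ : Q.PosDef) : (corr Q).PosDef := by
  have hd : ∀ a, 0 < (√(Q a a))⁻¹ := fun a => inv_pos.2 (Real.sqrt_pos.2 hQ.diag_pos)
  have hU : IsUnit (Matrix.diagonal fun a => (√(Q a a))⁻¹) := by
    rw [Matrix.isUnit_iff_isUnit_det, Matrix.det_diagonal]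
    exact (Finset.prod_pos fun a _ => hd a).ne'.isUnit
  have h := hQ.conjTranspose_mul_mul_same (B := Matrix.diagonal fun a => (√(Q a a))⁻¹)
    (Matrix.mulVec_injective_of_isUnit hU)
  simpa [corr] using h

theorem corr_diag {Q : Matrix (Fin m) (Fin m) ℝ} (hQ : Q.PosDef) (a : Fin m) :
    corr Q a a = 1 := by
  have h : 0 < Q a a := hQ.diag_pos
  rw [corr_apply]
  have h2 := Real.mul_self_sqrt h.le
  have h3 := (Real.sqrt_pos.2 h).ne'
  field_simp
  rw [sq, h2]

theorem unvech_symm (v : VechIdx m → ℝ) : (unvech v)ᵀ = unvech v := by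
  ext i j
  rcases lt_trichotomy i j with h | h | h
  · simp [unvech, h.le, not_le.2 h]
  · subst h; rfl
  · simp [unvech, h.le, not_le.2 h]

theorem vech_unvech (v : VechIdx m → ℝ) : vech (unvech v) = v := by
  funext q
  simp [vech, unvech, q.2]

theorem continuous_unvech : Continuous (unvech (m := m)) := by
  refine continuous_matrix fun i j => ?_
  by_cases h : j ≤ i
  · simp only [unvech, Matrix.of_apply, h, dite_true]; fun_prop
  · simp only [unvech, Matrix.of_apply, h, dite_false]; fun_prop

theorem unvech_eq_vecMulVec {v : VechIdx m → ℝ} {e : Fin m → ℝ}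
    (h : ∀ q : VechIdx m, v q = e q.1.1 * e q.1.2) : unvech v = Matrix.vecMulVec e e := by
  have : v = vech (Matrix.vecMulVec e e) := by
    funext q; simp [vech, Matrix.vecMulVec_apply, h]
  rw [this, unvech_vech]
  ext i j; simp [Matrix.vecMulVec_apply, mul_comm]

/-- Replaces an existential over `e` by polynomial equalities and inequalities (vanishing `2 × 2`
minors, non-negative diagonal), which are visibly closed conditions. -/
theorem exists_outer_iff (v : VechIdx m → ℝ) :
    (∃ e : Fin m → ℝ, ∀ q : VechIdx m, v q = e q.1.1 * e q.1.2) ↔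
      (∀ i, 0 ≤ unvech v i i) ∧
        ∀ i j k l, unvech v i j * unvech v k l = unvech v i l * unvech v k j := by
  constructor
  · rintro ⟨e, he⟩
    rw [unvech_eq_vecMulVec he]
    refine ⟨fun i => ?_, fun i j k l => ?_⟩
    · simp only [Matrix.vecMulVec_apply]; exact mul_self_nonneg _
    · simp only [Matrix.vecMulVec_apply]; ring
  · rintro ⟨h0, h1⟩
    have hs : ∀ i j, unvech v j i = unvech v i j := fun i j => by
      conv_rhs => rw [← unvech_symm]
      rfl
    have hv : ∀ q : VechIdx m, v q = unvech v q.1.1 q.1.2 := fun q => by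
      conv_lhs => rw [← vech_unvech v]
      rfl
    by_cases hz : ∀ i, unvech v i i = 0
    · refine ⟨0, fun q => ?_⟩
      have := h1 q.1.1 q.1.2 q.1.2 q.1.1
      rw [hz, hz, hs, mul_zero] at this
      rw [hv, ← hs]
      simpa using this
    · push Not at hz
      obtain ⟨k, hk⟩ := hz
      have hk : 0 < unvech v k k := lt_of_le_of_ne (h0 k) hk.symm
      -- Row `k` of `e e'` is `e k` times `e`, and `e k` is the square root of the pivot up to sign.
      refine ⟨fun i => unvech v k i / √(unvech v k k), fun q => ?_⟩
      have hh := Real.mul_self_sqrt hk.le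
      rw [hv, div_mul_div_comm, hh, eq_div_iff hk.ne', h1 _ _ k k, hs]

end Sqrt

/-! ### Nonnegative matrices with spectral radius less than one -/

section Spectral

variable {ι : Type} [Fintype ι] [DecidableEq ι]

-- Gelfand's formula: for `ρ` strictly between the spectral radius and 1, the norms of the powers
-- are eventually below `ρ ^ n`, and summability passes to entries.
open scoped Matrix.Norms.Operator ENNReal NNReal in
theorem summable_pow_of_specRadius_lt_one {T : Matrix ι ι ℝ} (hT : specRadius T < 1) (i j : ι) :
    Summable fun n : ℕ => (T ^ n) i j := by
  set A : Matrix ι ι ℂ := T.map (algebraMap ℝ ℂ) with hA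
  obtain ⟨ρ, h1, h2⟩ := exists_between hT
  have hlim := spectrum.pow_nnnorm_pow_one_div_tendsto_nhds_spectralRadius A
  have hev := hlim.eventually_lt_const h1
  have hsum : Summable fun n : ℕ => A ^ n := by
    lift ρ to ℝ≥0 using (h2.trans ENNReal.one_lt_top).ne
    have hρ : ρ < 1 := by exact_mod_cast h2
    refine Summable.of_norm_bounded_eventually_nat (summable_geometric_of_lt_one ρ.2 hρ) ?_
    filter_upwards [hev, eventually_gt_atTop 0] with n hn hn0
    have hn' : ((‖A ^ n‖₊ : ℝ≥0∞) ^ (1 / n : ℝ)) ^ (n : ℝ) ≤ (ρ : ℝ≥0∞) ^ (n : ℝ) :=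
      ENNReal.rpow_le_rpow hn.le (by positivity)
    rw [← ENNReal.rpow_mul, one_div, inv_mul_cancel₀ (by positivity), ENNReal.rpow_one,
      ENNReal.rpow_natCast] at hn'
    have : ‖A ^ n‖₊ ≤ ρ ^ n := by exact_mod_cast hn'
    exact_mod_cast this
  have hij : Summable fun n : ℕ => (A ^ n) i j := Pi.summable.1 (Pi.summable.1 hsum i) j
  have hre : ∀ n, ((T ^ n) i j : ℂ) = (A ^ n) i j := by
    intro n
    have := Matrix.map_pow T (algebraMap ℝ ℂ) n
    rw [hA, ← this]; rfl
  simp only [← hre] at hij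
  exact_mod_cast Complex.summable_ofReal.1 hij

/-- Take `w` to be the column sums of `Σ_n T^n`. Multiplying by `T` on the right drops the term `n =
0`, which is the constant 1 in each column. -/
theorem exists_subinvariant_weight {T : Matrix ι ι ℝ} (h0 : ∀ i j, 0 ≤ T i j)
    (hT : ∀ i j, Summable fun n : ℕ => (T ^ n) i j) :
    ∃ w : ι → ℝ, (∀ i, 1 ≤ w i) ∧ ∀ j, ∑ i, w i * T i j = w j - 1 := by
  have hp : ∀ n i j, 0 ≤ (T ^ n) i j := by
    intro n
    induction n with
    | zero => intro i j; simp only [pow_zero, Matrix.one_apply]; split_ifs <;> norm_num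
    | succ n ih =>
      intro i j
      rw [pow_succ, Matrix.mul_apply]
      exact Finset.sum_nonneg fun k _ => mul_nonneg (ih _ _) (h0 _ _)
  have hs : ∀ j, Summable fun n => ∑ i, (T ^ n) i j := fun j => summable_sum fun i _ => hT i j
  have hstep : ∀ j, ∑' n, ∑ i, (T ^ n) i j = 1 + ∑' n, ∑ i, (T ^ (n + 1)) i j := by
    intro j
    rw [(hs j).tsum_eq_zero_add]
    simp [Matrix.one_apply]
  refine ⟨fun j => ∑' n, ∑ i, (T ^ n) i j, fun j => ?_, fun j => ?_⟩
  · beta_reduce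
    rw [hstep]
    exact le_add_of_nonneg_right (tsum_nonneg fun n => Finset.sum_nonneg fun i _ => hp _ _ _)
  · beta_reduce
    rw [hstep j, add_sub_cancel_left]
    simp only [← tsum_mul_right]
    rw [← Summable.tsum_finsetSum fun i _ => (hs i).mul_right _]
    refine tsum_congr fun n => ?_
    simp only [Finset.sum_mul, pow_succ, Matrix.mul_apply]
    exact Finset.sum_comm

omit [DecidableEq ι] in
theorem kronPow_mul (p : ℕ) (A B : Matrix ι ι ℝ) :
    kronPow p (A * B) = kronPow p A * kronPow p B := by
  ext I J
  simp only [kronPow, Matrix.of_apply, Matrix.mul_apply, ← Finset.prod_mul_distrib]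
  rw [Finset.prod_univ_sum]
  simp [Fintype.piFinset_univ]

omit [Fintype ι] in
theorem kronPow_one (p : ℕ) : kronPow p (1 : Matrix ι ι ℝ) = 1 := by
  ext I J
  simp only [kronPow, Matrix.of_apply, Matrix.one_apply, Finset.prod_ite_zero, Finset.prod_const_one,
    funext_iff, Finset.mem_univ, true_imp_iff]

/-- Induction using multiplicativity of Kronecker powers. The intermediate indices that lie in the
image of `f` form only part of the sum defining the power of `T`, and the discarded terms are
non-negative. -/
theorem abs_kronPow_pow_le {κ : Type} [Fintype κ] [DecidableEq κ] {p : ℕ} {S : Matrix κ κ ℝ}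
    {T : Matrix (Fin p → ι) (Fin p → ι) ℝ} (h0 : ∀ i j, 0 ≤ T i j) {f : κ → ι}
    (hf : Function.Injective f)
    (hST : ∀ I J, |kronPow p S I J| ≤ T (f ∘ I) (f ∘ J)) (n : ℕ) (I J : Fin p → κ) :
    |kronPow p (S ^ n) I J| ≤ (T ^ n) (f ∘ I) (f ∘ J) := by
  have hp : ∀ n i j, 0 ≤ (T ^ n) i j := by
    intro n
    induction n with
    | zero => intro i j; simp only [pow_zero, Matrix.one_apply]; split_ifs <;> norm_num
    | succ n ih =>
      intro i j
      rw [pow_succ, Matrix.mul_apply]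
      exact Finset.sum_nonneg fun k _ => mul_nonneg (ih _ _) (h0 _ _)
  have hinj : Function.Injective fun I : Fin p → κ => f ∘ I := hf.comp_left
  induction n generalizing I J with
  | zero =>
    rw [pow_zero, pow_zero, kronPow_one, Matrix.one_apply, Matrix.one_apply]
    by_cases h : I = J
    · simp [h]
    · simp [h]; split_ifs <;> norm_num
  | succ n ih =>
    rw [pow_succ, pow_succ, kronPow_mul, Matrix.mul_apply, Matrix.mul_apply]
    calc |∑ L, kronPow p (S ^ n) I L * kronPow p S L J|
        ≤ ∑ L, |kronPow p (S ^ n) I L * kronPow p S L J| := Finset.abs_sum_le_sum_abs _ _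
      _ ≤ ∑ L : Fin p → κ, (T ^ n) (f ∘ I) (f ∘ L) * T (f ∘ L) (f ∘ J) := by
          refine Finset.sum_le_sum fun L _ => ?_
          rw [abs_mul]
          exact mul_le_mul (ih _ _) (hST _ _) (abs_nonneg _) (hp _ _ _)
      _ = ∑ L ∈ Finset.univ.map ⟨_, hinj⟩, (T ^ n) (f ∘ I) L * T L (f ∘ J) := by
          rw [Finset.sum_map]; rfl
      _ ≤ _ := Finset.sum_le_sum_of_subset_of_nonneg (Finset.subset_univ _)
          fun L _ _ => mul_nonneg (hp _ _ _) (h0 _ _)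

/-- The `p`-th power of an entry of `S ^ n` is the entry of its Kronecker power at two constant
tuples. -/
theorem summable_abs_pow_entry {κ : Type} [Fintype κ] [DecidableEq κ] {p : ℕ} {S : Matrix κ κ ℝ}
    {T : Matrix (Fin p → ι) (Fin p → ι) ℝ} (h0 : ∀ i j, 0 ≤ T i j)
    (hT : ∀ i j, Summable fun n : ℕ => (T ^ n) i j) {f : κ → ι} (hf : Function.Injective f)
    (hST : ∀ I J, |kronPow p S I J| ≤ T (f ∘ I) (f ∘ J)) (i j : κ) :
    Summable fun n : ℕ => |(S ^ n) i j| ^ p := by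
  refine Summable.of_nonneg_of_le (fun n => by positivity) (fun n => ?_)
    (hT (f ∘ fun _ => i) (f ∘ fun _ => j))
  have h := abs_kronPow_pow_le h0 hf hST n (fun _ => i) fun _ => j
  simpa [kronPow, abs_pow] using h

end Spectral

/-- Every term of the expansion of the difference contains at least one factor `b c`, bounded by `α`
instead of `α u`; so the difference is smaller by one order in `u`. In the induction, the new factor
contributes either `a c` times the old difference or `b c` times the full product. -/
theorem mul_prod_add_sub_le {ι : Type} (s : Finset ι) {a b : ι → ℝ} {α u : ℝ} (hα : 1 ≤ α)
    (hu : 1 ≤ u) (ha : ∀ c, 0 ≤ a c) (hb : ∀ c, 0 ≤ b c) (hau : ∀ c, a c ≤ α * u)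
    (hbu : ∀ c, b c ≤ α) :
    u * (∏ c ∈ s, (a c + b c) - ∏ c ∈ s, a c) ≤ (2 * α * u) ^ s.card := by
  classical
  have hbound : ∀ t : Finset ι, ∏ c ∈ t, (a c + b c) ≤ (2 * α * u) ^ t.card := by
    intro t
    rw [← Finset.prod_const]
    refine Finset.prod_le_prod (fun c _ => add_nonneg (ha c) (hb c)) fun c _ => ?_
    nlinarith [hau c, hbu c]
  induction s using Finset.induction_on with
  | empty => simp
  | insert c s hc ih =>
    rw [Finset.prod_insert hc, Finset.prod_insert hc, Finset.card_insert_of_notMem hc, pow_succ]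
    have h1 := hbound s
    have h0 : 0 ≤ ∏ c ∈ s, (a c + b c) := Finset.prod_nonneg fun c _ => add_nonneg (ha c) (hb c)
    have hdiff : 0 ≤ ∏ c ∈ s, (a c + b c) - ∏ c ∈ s, a c :=
      sub_nonneg.2 (Finset.prod_le_prod (fun c _ => ha c) fun c _ => le_add_of_nonneg_right (hb c))
    have e1 : a c * (u * (∏ c ∈ s, (a c + b c) - ∏ c ∈ s, a c)) ≤ α * u * (2 * α * u) ^ s.card :=
      mul_le_mul (hau c) ih (mul_nonneg (by linarith) hdiff) (by positivity)
    have e2 : b c * u * ∏ c ∈ s, (a c + b c) ≤ α * u * (2 * α * u) ^ s.card :=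
      mul_le_mul (by nlinarith [hbu c]) h1 h0 (by positivity)
    nlinarith

end DCC

end

noncomputable section

namespace DCC

/-! ### One step of the recursion -/

section ShiftIn

variable {n : ℕ} {ι : Type}

/-- Insert a new value at lag zero and increase the other lags by one. -/
def shiftIn (v : ι → ℝ) (y : Fin n × ι → ℝ) : Fin n × ι → ℝ := fun u =>
  if u.1.val = 0 then v u.2 else y (⟨u.1.val - 1, (Nat.sub_le _ _).trans_lt u.1.2⟩, u.2)

theorem shiftIn_zero (hn : 0 < n) (v : ι → ℝ) (y : Fin n × ι → ℝ) (a : ι) :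
    shiftIn v y (⟨0, hn⟩, a) = v a := by simp [shiftIn]

theorem shiftIn_add (v v' : ι → ℝ) (y y' : Fin n × ι → ℝ) :
    shiftIn v y + shiftIn v' y' = shiftIn (v + v') (y + y') := by
  funext u
  by_cases h : u.1.val = 0 <;> simp [shiftIn, h]

theorem forall_shiftIn {q : (ι → ℝ) → Prop} {v : ι → ℝ} {y : Fin n × ι → ℝ} (hv : q v)
    (hy : ∀ i, q fun a => y (i, a)) (i : Fin n) : q fun a => shiftIn v y (i, a) := by
  by_cases h : i.val = 0
  · simpa [shiftIn, h] using hv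
  · simpa [shiftIn, h] using hy ⟨i.val - 1, (Nat.sub_le _ _).trans_lt i.2⟩

variable [Fintype ι]

theorem firstRow_mulVec (a : ℕ) (C : Fin n → Matrix ι ι ℝ) (y : Fin n × ι → ℝ) :
    firstRow a C *ᵥ y = shiftIn (∑ i, C i *ᵥ fun b => y (i, b)) 0 := by
  funext u
  by_cases h : u.1.val = 0
  · simp [shiftIn, h, firstRow, Matrix.mulVec, dotProduct, Fintype.sum_prod_type]
  · simp [shiftIn, h, firstRow, Matrix.mulVec, dotProduct]

variable [DecidableEq ι]

theorem companion_mulVec (C : Fin n → Matrix ι ι ℝ) (y : Fin n × ι → ℝ) :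
    companion C *ᵥ y = shiftIn (∑ i, C i *ᵥ fun b => y (i, b)) y := by
  funext u
  by_cases h : u.1.val = 0
  · simp [shiftIn, h, companion, Matrix.mulVec, dotProduct, Fintype.sum_prod_type]
  · simp only [shiftIn, h, companion, Matrix.mulVec, dotProduct, Matrix.of_apply, if_false, ite_mul,
      one_mul, zero_mul]
    rw [Finset.sum_eq_single (⟨u.1.val - 1, (Nat.sub_le _ _).trans_lt u.1.2⟩, u.2)]
    · have : u.1.val = u.1.val - 1 + 1 := by lia
      simp [← this]
    · rintro ⟨b, c⟩ - hb
      refine if_neg ?_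
      rintro ⟨h1, h2⟩
      exact hb (by ext <;> simp_all)
    · simp

end ShiftIn

variable {m r s k l : ℕ} (θ : Params m r s k l)

/-- `Vecd(D_t)` as a function of `X_{t-1}`. -/
def nextD (x : State m r s k l) : Fin m → ℝ :=
  θ.V₀ + ∑ i, θ.A i *ᵥ (fun a => x (.inl (.inl (i, a))))
    + ∑ j, θ.B j *ᵥ (fun a => x (.inl (.inr (j, a))))

/-- `X_t` as a function of `X_{t-1}` and `ε_t`. -/
def step (x : State m r s k l) (ε : Fin m → ℝ) : State m r s k l :=
  Sum.elim
    (Sum.elim (shiftIn (nextD θ x) fun u => x (.inl (.inl u)))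
      (shiftIn (fun a => nextD θ x a * ε a ^ 2) fun u => x (.inl (.inr u))))
    (Sum.elim (shiftIn (vech (nextQ θ x)) fun u => x (.inr (.inl u)))
      (shiftIn (vech (Matrix.vecMulVec ε ε)) fun u => x (.inr (.inr u))))

/-- The inhomogeneous term of the autoregression. -/
def zeta (ε : Fin m → ℝ) : State m r s k l :=
  Sum.elim
    (Sum.elim (shiftIn θ.V₀ 0) (shiftIn (fun a => θ.V₀ a * ε a ^ 2) 0))
    (Sum.elim (shiftIn (vech θ.W₀) 0) (shiftIn (vech (Matrix.vecMulVec ε ε)) 0))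

theorem vech_add (S S' : Matrix (Fin m) (Fin m) ℝ) : vech (S + S') = vech S + vech S' := rfl

theorem vech_sum {ι : Type} (t : Finset ι) (S : ι → Matrix (Fin m) (Fin m) ℝ) :
    vech (∑ i ∈ t, S i) = ∑ i ∈ t, vech (S i) := by
  funext q; simp [vech, Matrix.sum_apply]

theorem vech_conj_unvech (M : Matrix (Fin m) (Fin m) ℝ) (v : VechIdx m → ℝ) :
    vech (M * unvech v * Mᵀ) = vechConj M *ᵥ v := by
  rw [vech_mul_mul_transpose _ _ (unvech_symm v), vech_unvech]

theorem vech_nextQ (x : State m r s k l) :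
    vech (nextQ θ x) = vech θ.W₀ + ∑ i, vechConj (θ.M i) *ᵥ (fun q => x (.inr (.inl (i, q))))
      + ∑ j, vechConj (θ.N j) *ᵥ (fun q => x (.inr (.inr (j, q)))) := by
  simp only [nextQ, vech_add, vech_sum, vech_conj_unvech]

theorem unvech_vech_nextQ (x : State m r s k l) : unvech (vech (nextQ θ x)) = nextQ θ x := by
  refine unvech_vech _ ?_
  unfold nextQ
  refine ((?_ : θ.W₀.IsSymm).add ?_).add ?_
  · simpa [Matrix.IsHermitian, Matrix.IsSymm] using θ.W₀_posDef.1
  · simp [Matrix.IsSymm, Matrix.transpose_sum, Matrix.transpose_mul, unvech_symm, Matrix.mul_assoc]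
  · simp [Matrix.IsSymm, Matrix.transpose_sum, Matrix.transpose_mul, unvech_symm, Matrix.mul_assoc]

/-- The factor `Δ` in the second block row arises because the new squares are `D_t` times the
squared residuals, with the volatility recursion substituted for `D_t`. -/
theorem step_eq (x : State m r s k l) (ε : Fin m → ℝ) :
    step θ x ε = transMat θ ε *ᵥ x + zeta θ ε := by
  have hx : x = Sum.elim (Sum.elim (fun u => x (.inl (.inl u))) fun u => x (.inl (.inr u)))
      (Sum.elim (fun u => x (.inr (.inl u))) fun u => x (.inr (.inr u))) := by
    funext u; rcases u with (u | u) | (u | u) <;> rfl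
  conv_rhs => rw [hx]
  simp only [transMat, zeta, Matrix.fromBlocks_mulVec, Sum.elim_comp_inl, Sum.elim_comp_inr,
    Matrix.zero_mulVec, add_zero, zero_add, companion_mulVec, firstRow_mulVec, step,
    ← Sum.elim_add_add, shiftIn_add, vech_nextQ, nextD]
  congr 3
  · abel
  · funext a
    simp only [Pi.add_apply, Finset.sum_apply, ← Matrix.mulVec_mulVec, Matrix.mulVec_diagonal,
      ← Finset.mul_sum]
    ring
  · abel
  · simp

theorem nextQ_sub_posSemidef {x : State m r s k l}
    (hM : ∀ i, (unvech fun q => x (.inr (.inl (i, q)))).PosSemidef)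
    (hN : ∀ j, ∃ e : Fin m → ℝ, ∀ q : VechIdx m, x (.inr (.inr (j, q))) = e q.1.1 * e q.1.2) :
    (nextQ θ x - θ.W₀).PosSemidef := by
  have : nextQ θ x - θ.W₀ = ∑ i, θ.M i * unvech (fun q => x (.inr (.inl (i, q)))) * (θ.M i)ᵀ
    + ∑ j, θ.N j * unvech (fun q => x (.inr (.inr (j, q)))) * (θ.N j)ᵀ := by
    unfold nextQ; abel
  rw [this]
  refine Matrix.PosSemidef.add (Matrix.posSemidef_sum _ fun i _ => ?_)
    (Matrix.posSemidef_sum _ fun j _ => ?_)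
  · simpa using (hM i).mul_mul_conjTranspose_same (θ.M i)
  · obtain ⟨e, he⟩ := hN j
    rw [unvech_eq_vecMulVec he]
    have h := Matrix.posSemidef_vecMulVec_self_star e
    simpa using h.mul_mul_conjTranspose_same (θ.N j)

theorem nextQ_posDef {x : State m r s k l} (hx : x ∈ stateSpace m r s k l) :
    (nextQ θ x).PosDef := by
  have h := θ.W₀_posDef.add_posSemidef
    (nextQ_sub_posSemidef θ (fun i => (hx.2.2.1 i).posSemidef) hx.2.2.2)
  simpa using h

theorem nextR_posDef {x : State m r s k l} (hx : x ∈ stateSpace m r s k l) :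
    (nextR θ x).PosDef := corr_posDef (nextQ_posDef θ hx)

/-- A closed absorbing subset of the state space. -/
def core : Set (State m r s k l) :=
  {x | (∀ i a, θ.V₀ a ≤ x (.inl (.inl (i, a)))) ∧
    (∀ j a, 0 ≤ x (.inl (.inr (j, a)))) ∧
    (∀ i, ((unvech fun q => x (.inr (.inl (i, q)))) - θ.W₀).PosSemidef) ∧
    (∀ j, ∃ e : Fin m → ℝ, ∀ q : VechIdx m, x (.inr (.inr (j, q))) = e q.1.1 * e q.1.2)}

theorem core_subset : core θ ⊆ stateSpace m r s k l := by
  rintro x ⟨h1, h2, h3, h4⟩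
  refine ⟨fun i a => (θ.V₀_pos a).trans_le (h1 i a), h2, fun i => ?_, h4⟩
  simpa using θ.W₀_posDef.add_posSemidef (h3 i)

/-- The bounds by the intercepts `V₀` and `W₀` replace strict positivity, and `exists_outer_iff`
replaces the existential; what remains are closed conditions. -/
theorem isClosed_core : IsClosed (core θ) := by
  simp only [core, exists_outer_iff (m := m)]
  have hc : ∀ (g : State m r s k l → VechIdx m → ℝ), Continuous g → ∀ i j,
      Continuous fun x => unvech (g x) i j := fun g hg i j =>
    (continuous_unvech.comp hg).matrix_elem i j
  refine IsClosed.and ?_ (IsClosed.and ?_ (IsClosed.and ?_ ?_))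
  · simp only [Set.ofPred_forall]
    exact isClosed_iInter fun i => isClosed_iInter fun a =>
      isClosed_le continuous_const (continuous_apply _)
  · simp only [Set.ofPred_forall]
    exact isClosed_iInter fun i => isClosed_iInter fun a =>
      isClosed_le continuous_const (continuous_apply _)
  · simp only [Set.ofPred_forall]
    refine isClosed_iInter fun i => isClosed_posSemidef.preimage ?_
    exact (continuous_unvech.comp (by fun_prop)).sub continuous_const
  · simp only [Set.ofPred_forall, Set.ofPred_and]
    refine isClosed_iInter fun i => IsClosed.inter (isClosed_iInter fun a => ?_)
      (isClosed_iInter fun a => isClosed_iInter fun b => isClosed_iInter fun c =>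
        isClosed_iInter fun d => ?_)
    · exact isClosed_le continuous_const (hc (fun x q => x (.inr (.inr (i, q)))) (by fun_prop) _ _)
    · have h := hc (fun x q => x (.inr (.inr (i, q)))) (by fun_prop)
      exact isClosed_eq ((h _ _).mul (h _ _)) ((h _ _).mul (h _ _))

theorem mulVec_nonneg {ι : Type} [Fintype ι] {M : Matrix ι ι ℝ} (hM : ∀ a b, 0 ≤ M a b)
    {v : ι → ℝ} (hv : ∀ b, 0 ≤ v b) (a : ι) : 0 ≤ (M *ᵥ v) a :=
  Finset.sum_nonneg fun b _ => mul_nonneg (hM a b) (hv b)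

theorem le_nextD {x : State m r s k l} (hx : x ∈ core θ) (a : Fin m) : θ.V₀ a ≤ nextD θ x a := by
  have h1 : 0 ≤ ∑ i, (θ.A i *ᵥ (fun a => x (.inl (.inl (i, a))))) a :=
    Finset.sum_nonneg fun i _ => mulVec_nonneg (θ.A_nonneg i) (fun b =>
      ((θ.V₀_pos b).le.trans (hx.1 i b))) a
  have h2 : 0 ≤ ∑ j, (θ.B j *ᵥ (fun a => x (.inl (.inr (j, a))))) a :=
    Finset.sum_nonneg fun i _ => mulVec_nonneg (θ.B_nonneg i) (hx.2.1 i) a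
  simp only [nextD, Pi.add_apply, Finset.sum_apply]
  linarith

theorem nextD_pos {x : State m r s k l} (hx : x ∈ core θ) (a : Fin m) : 0 < nextD θ x a :=
  (θ.V₀_pos a).trans_le (le_nextD θ hx a)

/-- Non-negativity of `A` and `B`, and positivity of congruences, keep each new value above its
intercept; the older lags are merely moved. -/
theorem step_mem_core {x : State m r s k l} (hx : x ∈ core θ) (ε : Fin m → ℝ) :
    step θ x ε ∈ core θ := by
  have hS := core_subset θ hx
  obtain ⟨h1, h2, h3, h4⟩ := hx
  refine ⟨?_, ?_, ?_, ?_⟩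
  · exact forall_shiftIn (q := fun v => ∀ a, θ.V₀ a ≤ v a)
      (y := fun u => x (.inl (.inl u)))
      (le_nextD θ ⟨h1, h2, h3, h4⟩) h1
  · exact forall_shiftIn (q := fun v => ∀ a, 0 ≤ v a)
      (y := fun u => x (.inl (.inr u)))
      (fun a => mul_nonneg (nextD_pos θ ⟨h1, h2, h3, h4⟩ a).le (sq_nonneg _)) h2
  · refine forall_shiftIn (q := fun v => (unvech v - θ.W₀).PosSemidef)
      (y := fun u => x (.inr (.inl u))) ?_ h3
    rw [unvech_vech_nextQ]
    exact nextQ_sub_posSemidef θ (fun i => (hS.2.2.1 i).posSemidef) hS.2.2.2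
  · exact forall_shiftIn (q := fun v => ∃ e : Fin m → ℝ, ∀ q : VechIdx m, v q = e q.1.1 * e q.1.2)
      (y := fun u => x (.inr (.inr u)))
      ⟨ε, fun q => rfl⟩ h4

/-- An element of the core, with the intercepts as values. -/
def basePoint : State m r s k l :=
  Sum.elim (Sum.elim (fun u => θ.V₀ u.2) 0) (Sum.elim (fun u => vech θ.W₀ u.2) 0)

theorem basePoint_mem : basePoint θ ∈ core θ := by
  refine ⟨fun i a => le_rfl, fun j a => le_rfl, fun i => ?_, fun j => ⟨0, fun q => ?_⟩⟩
  · have : (unvech fun q => basePoint θ (.inr (.inl (i, q)))) = θ.W₀ := by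
      refine unvech_vech _ ?_
      simpa [Matrix.IsHermitian, Matrix.IsSymm] using θ.W₀_posDef.1
    rw [this, sub_self]
    exact Matrix.PosSemidef.zero
  · simp [basePoint]

/-- `ε_t = R_t^{1/2} η_t` as a function of `X_{t-1}` and `η_t`. -/
def residOf (x : State m r s k l) (e : Fin m → ℝ) : Fin m → ℝ := msqrt (nextR θ x) *ᵥ e

theorem continuous_nextQ : Continuous (nextQ θ) := by
  have h : ∀ (g : State m r s k l → VechIdx m → ℝ), Continuous g →
      Continuous fun x => unvech (g x) := fun g hg => continuous_unvech.comp hg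
  unfold nextQ
  refine (continuous_const.add (continuous_finsetSum _ fun i _ => ?_)).add
    (continuous_finsetSum _ fun i _ => ?_)
  · exact (continuous_const.matrix_mul (h _ (by fun_prop))).matrix_mul continuous_const
  · exact (continuous_const.matrix_mul (h _ (by fun_prop))).matrix_mul continuous_const

theorem continuousOn_corr :
    ContinuousOn (corr (m := m)) {Q | Q.PosDef} := by
  intro Q hQ
  refine ContinuousAt.continuousWithinAt ?_
  refine continuousAt_pi.2 fun a => continuousAt_pi.2 fun b => ?_
  simp only [corr_apply]
  have h : ∀ c d, ContinuousAt (fun S : Matrix (Fin m) (Fin m) ℝ => S c d) Q := fun c d =>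
    (continuous_apply_apply c d).continuousAt
  have hs : ∀ c, ContinuousAt (fun S : Matrix (Fin m) (Fin m) ℝ => (√(S c c))⁻¹) Q := fun c =>
    (Real.continuous_sqrt.continuousAt.comp (h c c)).inv₀
      (Real.sqrt_pos.2 (Matrix.PosDef.diag_pos hQ)).ne'
  exact ((hs a).mul (h a b)).mul (hs b)

theorem measurable_corr : Measurable (corr (m := m)) := by
  refine measurable_pi_lambda _ fun a => measurable_pi_lambda _ fun b => ?_
  simp only [corr_apply]
  have h : ∀ c d, Measurable (fun S : Matrix (Fin m) (Fin m) ℝ => S c d) := fun c d =>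
    (measurable_pi_apply d).comp (measurable_pi_apply c)
  exact ((h a a).sqrt.inv.mul (h a b)).mul (h b b).sqrt.inv

theorem continuous_msqrt_nextR :
    Continuous fun x : core θ => msqrt (nextR θ x.1) := by
  have h1 : Continuous fun x : core θ => nextR θ x.1 :=
    continuousOn_corr.comp_continuous ((continuous_nextQ θ).comp continuous_subtype_val)
      fun x => nextQ_posDef θ (core_subset θ x.2)
  exact continuousOn_msqrt.comp_continuous h1
    fun x => (nextR_posDef θ (core_subset θ x.2)).posSemidef

theorem continuous_residOf :
    Continuous fun y : core θ × (Fin m → ℝ) => residOf θ y.1.1 y.2 :=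
  ((continuous_msqrt_nextR θ).comp continuous_fst).matrix_mulVec continuous_snd

theorem continuous_nextD : Continuous (nextD θ) := by
  unfold nextD
  refine (continuous_const.add (continuous_finsetSum _ fun i _ => ?_)).add
    (continuous_finsetSum _ fun i _ => ?_)
  · exact continuous_const.matrix_mulVec (by fun_prop)
  · exact continuous_const.matrix_mulVec (by fun_prop)

theorem continuous_shiftIn {Y : Type*} {ι : Type} [TopologicalSpace Y] {n : ℕ} {v : Y → ι → ℝ}
    {g : Y → Fin n × ι → ℝ} (hv : Continuous v) (hg : Continuous g) :
    Continuous fun y => shiftIn (v y) (g y) := by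
  refine continuous_pi fun u => ?_
  by_cases h : u.1.val = 0
  · simp only [shiftIn, h, if_true]; fun_prop
  · simp only [shiftIn, h, if_false]; fun_prop

theorem continuous_step :
    Continuous fun y : State m r s k l × (Fin m → ℝ) => step θ y.1 y.2 := by
  have hD := (continuous_nextD θ).comp (continuous_fst (X := State m r s k l) (Y := Fin m → ℝ))
  have hQ : Continuous fun y : State m r s k l × (Fin m → ℝ) => vech (nextQ θ y.1) :=
    continuous_pi fun q => ((continuous_nextQ θ).comp continuous_fst).matrix_elem q.1.1 q.1.2
  have h1 := continuous_shiftIn (n := r) hD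
    (g := fun y u => y.1 (.inl (.inl u))) (by fun_prop)
  have h2 := continuous_shiftIn (n := s) (v := fun y a => nextD θ y.1 a * y.2 a ^ 2)
    (g := fun y : State m r s k l × (Fin m → ℝ) => fun u => y.1 (.inl (.inr u)))
    (continuous_pi fun a => ((continuous_apply a).comp hD).mul
      (((continuous_apply a).comp continuous_snd).pow 2)) (by fun_prop)
  have h3 := continuous_shiftIn (n := k) hQ
    (g := fun y : State m r s k l × (Fin m → ℝ) => fun u => y.1 (.inr (.inl u)))
    (by fun_prop)
  have h4 := continuous_shiftIn (n := l) (v := fun y => vech (Matrix.vecMulVec y.2 y.2))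
    (g := fun y : State m r s k l × (Fin m → ℝ) => fun u => y.1 (.inr (.inr u)))
    (continuous_pi fun q => ((continuous_apply q.1.1).comp continuous_snd).mul
      ((continuous_apply q.1.2).comp continuous_snd)) (by fun_prop)
  refine continuous_pi fun u => ?_
  rcases u with (u | u) | (u | u)
  · exact (continuous_apply u).comp h1
  · exact (continuous_apply u).comp h2
  · exact (continuous_apply u).comp h3
  · exact (continuous_apply u).comp h4

/-- The next state in the core as a function of the state and the innovation. -/
def coreStep (y : core θ × (Fin m → ℝ)) : core θ :=
  ⟨step θ y.1.1 (residOf θ y.1.1 y.2), step_mem_core θ y.1.2 _⟩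

theorem continuous_coreStep : Continuous (coreStep θ) :=
  Continuous.subtype_mk ((continuous_step θ).comp
    ((continuous_subtype_val.comp continuous_fst).prodMk (continuous_residOf θ))) _

/-- The bound does not depend on the state because `R(x)` has unit diagonal. Moments of `ε_t` are
thereby controlled by moments of `η_t` alone. -/
theorem abs_residOf_le {x : State m r s k l} (hx : x ∈ stateSpace m r s k l) (e : Fin m → ℝ)
    (a : Fin m) : |residOf θ x e a| ≤ m * ‖e‖ := by
  have hR := (nextR_posDef θ hx).posSemidef
  calc |∑ b, msqrt (nextR θ x) a b * e b| ≤ ∑ b, |msqrt (nextR θ x) a b * e b| :=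
        Finset.abs_sum_le_sum_abs _ _
    _ ≤ ∑ _b : Fin m, ‖e‖ := by
      refine Finset.sum_le_sum fun b _ => ?_
      rw [abs_mul]
      have h1 := abs_msqrt_le_one hR (fun c => corr_diag (nextQ_posDef θ hx) c) a b
      have h2 : |e b| ≤ ‖e‖ := norm_le_pi_norm e b
      nlinarith [abs_nonneg (e b), norm_nonneg e]
    _ = m * ‖e‖ := by simp

end DCC

end

noncomputable section

namespace DCC

/-! ### The drift condition -/

section Drift

variable {m r s k l : ℕ} (θ : Params m r s k l)

theorem exists_transMat_bound :
    ∃ c : ℝ, 0 ≤ c ∧ ∀ ε i j, |transMat θ ε i j| ≤ c * (1 + ‖ε‖ ^ 2) := by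
  have h : ∀ i j, ∃ c : ℝ, 0 ≤ c ∧ ∀ ε, |transMat θ ε i j| ≤ c * (1 + ‖ε‖ ^ 2) := by
    have hconst : ∀ (T : (Fin m → ℝ) → ℝ) (c : ℝ), (∀ ε, T ε = c) →
        ∃ c : ℝ, 0 ≤ c ∧ ∀ ε, |T ε| ≤ c * (1 + ‖ε‖ ^ 2) := fun T c hT =>
      ⟨|c|, abs_nonneg _, fun ε => by rw [hT]; nlinarith [abs_nonneg c, sq_nonneg ‖ε‖]⟩
    have hsq : ∀ (T : (Fin m → ℝ) → ℝ) (a : Fin m) (c d : ℝ), (∀ ε, T ε = ε a ^ 2 * c + d) →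
        ∃ c : ℝ, 0 ≤ c ∧ ∀ ε, |T ε| ≤ c * (1 + ‖ε‖ ^ 2) := fun T a c d hT =>
      ⟨|c| + |d|, by positivity, fun ε => by
        have h1 : ε a ^ 2 ≤ ‖ε‖ ^ 2 := sq_le_sq.2 (by simpa using norm_le_pi_norm ε a)
        have h2 := abs_add_le (ε a ^ 2 * c) d
        rw [abs_mul, abs_of_nonneg (sq_nonneg (ε a))] at h2
        rw [hT]
        nlinarith [abs_nonneg c, abs_nonneg d, sq_nonneg ‖ε‖,
          mul_le_mul_of_nonneg_right h1 (abs_nonneg c)]⟩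
    rintro ((i | i) | (i | i)) ((j | j) | (j | j))
    · exact hconst _ (companion θ.A i j) fun ε => rfl
    · exact hconst _ (firstRow r θ.B i j) fun ε => rfl
    · exact hconst _ 0 fun ε => rfl
    · exact hconst _ 0 fun ε => rfl
    · refine hsq _ i.2 (firstRow s θ.A i j) 0 fun ε => ?_
      simp [transMat, firstRow, Matrix.diagonal_mul]
    · by_cases hi : i.1.val = 0
      · refine hsq _ i.2 (θ.B j.1 i.2 j.2) 0 fun ε => ?_
        simp [transMat, companion, Matrix.diagonal_mul, hi]
      · refine hconst _ (companion θ.B i j) fun ε => ?_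
        simp [transMat, companion, hi]
    · exact hconst _ 0 fun ε => rfl
    · exact hconst _ 0 fun ε => rfl
    · exact hconst _ 0 fun ε => rfl
    · exact hconst _ 0 fun ε => rfl
    · exact hconst _ (companion (fun i => vechConj (θ.M i)) i j) fun ε => rfl
    · exact hconst _ (firstRow k (fun i => vechConj (θ.N i)) i j) fun ε => rfl
    · exact hconst _ 0 fun ε => rfl
    · exact hconst _ 0 fun ε => rfl
    · exact hconst _ 0 fun ε => rfl
    · exact hconst _ (companion (fun _ => 0) i j) fun ε => rfl
  choose c hc0 hc using h
  refine ⟨∑ i, ∑ j, c i j, Finset.sum_nonneg fun i _ => Finset.sum_nonneg fun j _ => hc0 i j,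
    fun ε i j => (hc i j ε).trans ?_⟩
  gcongr
  exact (Finset.single_le_sum (f := fun j => c i j) (fun j _ => hc0 i j) (Finset.mem_univ j)).trans
    (Finset.single_le_sum (f := fun i => ∑ j, c i j)
      (fun i _ => Finset.sum_nonneg fun j _ => hc0 i j) (Finset.mem_univ i))

theorem abs_shiftIn_zero_le {n : ℕ} {ι : Type} {v : ι → ℝ} {c : ℝ} (hc : 0 ≤ c)
    (u : Fin n × ι) (hv : |v u.2| ≤ c) : |shiftIn v 0 u| ≤ c := by
  by_cases h : u.1.val = 0 <;> simp [shiftIn, h, hv, hc]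

theorem exists_zeta_bound :
    ∃ c : ℝ, 0 ≤ c ∧ ∀ ε i, |zeta θ ε i| ≤ c * (1 + ‖ε‖ ^ 2) := by
  have hV : ∀ a, |θ.V₀ a| ≤ ‖θ.V₀‖ := fun a => norm_le_pi_norm θ.V₀ a
  have hW : ∀ q, |vech θ.W₀ q| ≤ ‖vech θ.W₀‖ := fun q => norm_le_pi_norm (vech θ.W₀) q
  have hε : ∀ (ε : Fin m → ℝ) a, |ε a| ≤ ‖ε‖ := fun ε a => norm_le_pi_norm ε a
  refine ⟨‖θ.V₀‖ + ‖vech θ.W₀‖ + 1, by positivity, fun ε i => ?_⟩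
  have h0 := norm_nonneg θ.V₀
  have h1 := norm_nonneg (vech θ.W₀)
  have h2 := sq_nonneg ‖ε‖
  have hc : 0 ≤ (‖θ.V₀‖ + ‖vech θ.W₀‖ + 1) * (1 + ‖ε‖ ^ 2) := by positivity
  rcases i with (u | u) | (u | u)
  · exact abs_shiftIn_zero_le hc u ((hV _).trans (by nlinarith))
  · refine abs_shiftIn_zero_le (v := fun a => θ.V₀ a * ε a ^ 2) hc u ?_
    rw [abs_mul, abs_pow]
    have : |ε u.2| ^ 2 ≤ ‖ε‖ ^ 2 := by gcongr; exact hε _ _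
    have h3 : |θ.V₀ u.2| * |ε u.2| ^ 2 ≤ ‖θ.V₀‖ * ‖ε‖ ^ 2 := by gcongr; exact hV _
    nlinarith
  · exact abs_shiftIn_zero_le hc u ((hW _).trans (by nlinarith))
  · refine abs_shiftIn_zero_le hc u ?_
    simp only [vech, Matrix.vecMulVec_apply, abs_mul]
    have h3 : |ε u.2.1.1| * |ε u.2.1.2| ≤ ‖ε‖ * ‖ε‖ := by gcongr <;> exact hε _ _
    nlinarith

theorem abs_prod_mulVec_le {ι : Type} [Fintype ι] [DecidableEq ι] {p : ℕ} (T : Matrix ι ι ℝ)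
    (x : ι → ℝ) (I : Fin p → ι) :
    ∏ c, |(T *ᵥ x) (I c)| ≤ ∑ J, |kronPow p T I J| * ∏ c, |x (J c)| := by
  rw [← Finset.abs_prod]
  simp only [Matrix.mulVec, dotProduct]
  rw [Finset.prod_univ_sum]
  refine (Finset.abs_sum_le_sum_abs _ _).trans ?_
  rw [Fintype.piFinset_univ]
  refine Finset.sum_le_sum fun J _ => ?_
  rw [Finset.prod_mul_distrib, abs_mul, Finset.abs_prod _ (fun c => x (J c))]
  rfl

/-- The product of `p` coordinates of `T x` is governed by the Kronecker power of `T`. Including `ζ`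
adds only terms with at least one factor free of `x`, whence the exponent `p - 1`. -/
theorem exists_prod_step_bound (p : ℕ) (hp : 1 ≤ p) :
    ∃ c : ℝ, 0 ≤ c ∧ ∀ x ε (I : Fin p → Idx m r s k l),
      ∏ i, |step θ x ε (I i)| ≤ ∑ J, |kronPow p (transMat θ ε) I J| * ∏ i, |x (J i)|
        + c * (1 + ‖ε‖ ^ 2) ^ p * (1 + ‖x‖) ^ (p - 1) := by
  obtain ⟨c₁, hc₁, hT⟩ := exists_transMat_bound θ
  obtain ⟨c₂, hc₂, hz⟩ := exists_zeta_bound θ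
  set d : ℝ := ((Fintype.card (Idx m r s k l) : ℕ) : ℝ)
  have hd : 0 ≤ d := Nat.cast_nonneg _
  -- Chosen so that `α = c (1 + ‖ε‖²)` is at least 1 and dominates both the row sums of `T` and the
  -- entries of `ζ`.
  set c : ℝ := 1 + d * c₁ + c₂ with hc
  have hc0 : 1 ≤ c := by have := mul_nonneg hd hc₁; linarith
  refine ⟨(2 * c) ^ p, by positivity, fun x ε I => ?_⟩
  set α : ℝ := c * (1 + ‖ε‖ ^ 2)
  have hα : 1 ≤ α := by
    have : 1 ≤ 1 + ‖ε‖ ^ 2 := by nlinarith [sq_nonneg ‖ε‖]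
    exact one_le_mul_of_one_le_of_one_le hc0 this
  set u : ℝ := 1 + ‖x‖
  have hu : 1 ≤ u := by have := norm_nonneg x; simp only [u]; linarith
  have hN : 0 ≤ 1 + ‖ε‖ ^ 2 := by positivity
  have ha : ∀ i, |(transMat θ ε *ᵥ x) i| ≤ α * u := by
    intro i
    calc |∑ j, transMat θ ε i j * x j| ≤ ∑ j, |transMat θ ε i j * x j| :=
          Finset.abs_sum_le_sum_abs _ _
      _ ≤ ∑ _j : Idx m r s k l, (c₁ * (1 + ‖ε‖ ^ 2)) * u := by
          refine Finset.sum_le_sum fun j _ => ?_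
          rw [abs_mul]
          have hx : |x j| ≤ u := (norm_le_pi_norm x j).trans (by simp [u])
          exact mul_le_mul (hT ε i j) hx (abs_nonneg _) (by positivity)
      _ = d * c₁ * (1 + ‖ε‖ ^ 2) * u := by simp [d]; ring
      _ ≤ α * u := by
          simp only [α]
          gcongr
          linarith
  have hb : ∀ i, |zeta θ ε i| ≤ α := fun i => (hz ε i).trans (by
    simp only [α]; gcongr; have := mul_nonneg hd hc₁; linarith)
  have key := mul_prod_add_sub_le Finset.univ (a := fun i => |(transMat θ ε *ᵥ x) (I i)|)
    (b := fun i => |zeta θ ε (I i)|) hα hu (fun _ => abs_nonneg _) (fun _ => abs_nonneg _)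
    (fun i => ha _) (fun i => hb _)
  have h1 : ∏ i, |step θ x ε (I i)|
      ≤ ∏ i, (|(transMat θ ε *ᵥ x) (I i)| + |zeta θ ε (I i)|) := by
    refine Finset.prod_le_prod (fun _ _ => abs_nonneg _) fun i _ => ?_
    rw [step_eq]
    exact abs_add_le _ _
  have h2 := abs_prod_mulVec_le (transMat θ ε) x I
  have h3 : ∏ i, (|(transMat θ ε *ᵥ x) (I i)| + |zeta θ ε (I i)|)
      - ∏ i, |(transMat θ ε *ᵥ x) (I i)| ≤ (2 * α) ^ p * u ^ (p - 1) := by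
    have hu0 : 0 < u := by linarith
    refine le_of_mul_le_mul_left (key.trans (le_of_eq ?_)) hu0
    rw [Finset.card_univ, Fintype.card_fin, mul_pow]
    conv_lhs => rw [← Nat.sub_add_cancel hp, pow_succ u]
    rw [Nat.sub_add_cancel hp]; ring
  have h4 : (2 * c) ^ p * (1 + ‖ε‖ ^ 2) ^ p * u ^ (p - 1) = (2 * α) ^ p * u ^ (p - 1) := by
    simp only [α]; rw [← mul_pow]; ring
  rw [h4]
  linarith

theorem one_add_sq_residOf_pow_le {x : State m r s k l} (hx : x ∈ stateSpace m r s k l) (p : ℕ)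
    (e : Fin m → ℝ) :
    (1 + ‖residOf θ x e‖ ^ 2) ^ p ≤ (2 * (1 + (m : ℝ) ^ 2)) ^ p * (1 + ‖e‖ ^ (2 * p)) := by
  have h1 : ‖residOf θ x e‖ ≤ m * ‖e‖ :=
    (pi_norm_le_iff_of_nonneg (by positivity)).2 fun a => abs_residOf_le θ hx e a
  have h2 : 1 + ‖residOf θ x e‖ ^ 2 ≤ (1 + (m : ℝ) ^ 2) * (1 + ‖e‖ ^ 2) := by
    have : ‖residOf θ x e‖ ^ 2 ≤ (m * ‖e‖) ^ 2 := by gcongr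
    nlinarith [sq_nonneg ‖e‖, sq_nonneg (m : ℝ)]
  have h3 : (1 + ‖e‖ ^ 2) ^ p ≤ 2 ^ p * (1 + ‖e‖ ^ (2 * p)) := by
    have h := add_pow_le (zero_le_one (α := ℝ)) (sq_nonneg ‖e‖) p
    rw [one_pow, ← pow_mul] at h
    refine h.trans ?_
    gcongr
    · norm_num
    · lia
  calc (1 + ‖residOf θ x e‖ ^ 2) ^ p ≤ ((1 + (m : ℝ) ^ 2) * (1 + ‖e‖ ^ 2)) ^ p := by gcongr
    _ = (1 + (m : ℝ) ^ 2) ^ p * (1 + ‖e‖ ^ 2) ^ p := mul_pow _ _ _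
    _ ≤ (1 + (m : ℝ) ^ 2) ^ p * (2 ^ p * (1 + ‖e‖ ^ (2 * p))) := by gcongr
    _ = _ := by rw [mul_pow]; ring

variable {θ} {κ : Kernel (State m r s k l) (Fin m → ℝ)} {p : ℕ}

theorem integrable_norm_pow {x : State m r s k l} (h : ∫⁻ e, ‖e‖ₑ ^ (2 * p) ∂(κ x) < ⊤) :
    Integrable (fun e => ‖e‖ ^ (2 * p)) (κ x) := by
  refine ⟨by fun_prop, ?_⟩
  simpa [HasFiniteIntegral, enorm_pow] using h

theorem integral_norm_pow_le {x : State m r s k l} {h : ℝ}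
    (hx : ∫⁻ e, ‖e‖ₑ ^ (2 * p) ∂(κ x) ≤ ENNReal.ofReal h) :
    ∫ e, ‖e‖ ^ (2 * p) ∂(κ x) ≤ max h 0 := by
  rw [integral_eq_lintegral_of_nonneg_ae (ae_of_all _ fun e => by positivity) (by fun_prop)]
  have : ∀ e : Fin m → ℝ, ENNReal.ofReal (‖e‖ ^ (2 * p)) = ‖e‖ₑ ^ (2 * p) := fun e => by
    rw [ENNReal.ofReal_pow (norm_nonneg _), ofReal_norm]
  simp only [this]
  exact (ENNReal.toReal_mono ENNReal.ofReal_ne_top hx).trans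
    (by rw [ENNReal.toReal_ofReal_eq_iff.2 (le_max_right h 0) |>.symm]; simp [ENNReal.toReal_ofReal'])

theorem continuous_transMat : Continuous fun ε => transMat θ ε := by
  have h1 : ∀ {a b : ℕ} (C : Fin b → Matrix (Fin m) (Fin m) ℝ), Continuous fun ε : Fin m → ℝ =>
      firstRow a fun i => Matrix.diagonal (fun c => ε c ^ 2) * C i := by
    intro a b C
    refine continuous_matrix fun u v => ?_
    simp only [firstRow, Matrix.of_apply, Matrix.diagonal_mul]
    split_ifs <;> fun_prop
  have h2 : ∀ {a : ℕ} (C : Fin a → Matrix (Fin m) (Fin m) ℝ), Continuous fun ε : Fin m → ℝ =>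
      companion fun i => Matrix.diagonal (fun c => ε c ^ 2) * C i := by
    intro a C
    refine continuous_matrix fun u v => ?_
    simp only [companion, Matrix.of_apply, Matrix.diagonal_mul]
    split_ifs <;> fun_prop
  exact (((continuous_const.matrix_fromBlocks continuous_const (h1 _)) (h2 _)).matrix_fromBlocks
    continuous_const continuous_const) continuous_const

theorem continuous_residOf_right (x : State m r s k l) : Continuous (residOf θ x) :=
  continuous_const.matrix_mulVec continuous_id

theorem integrable_abs_kronPow [IsMarkovKernel κ] {x : State m r s k l}
    (hx : x ∈ stateSpace m r s k l)
    (h : ∫⁻ e, ‖e‖ₑ ^ (2 * p) ∂(κ x) < ⊤) (I J : Fin p → Idx m r s k l) :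
    Integrable (fun e => |kronPow p (transMat θ (residOf θ x e)) I J|) (κ x) := by
  obtain ⟨c, hc, hT⟩ := exists_transMat_bound θ
  have hcont : Continuous fun e => |kronPow p (transMat θ (residOf θ x e)) I J| := by
    simp only [kronPow, Matrix.of_apply]
    refine (continuous_finsetProd _ fun i _ => ?_).abs
    exact (continuous_transMat.comp (continuous_residOf_right x)).matrix_elem _ _
  refine Integrable.mono' (((integrable_const 1).add (integrable_norm_pow h)).const_mul
    (c ^ p * (2 * (1 + (m : ℝ) ^ 2)) ^ p)) hcont.aestronglyMeasurable (ae_of_all _ fun e => ?_)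
  rw [Real.norm_eq_abs, abs_abs, kronPow, Matrix.of_apply, Finset.abs_prod]
  calc ∏ i, |transMat θ (residOf θ x e) (I i) (J i)|
      ≤ ∏ _i : Fin p, c * (1 + ‖residOf θ x e‖ ^ 2) :=
        Finset.prod_le_prod (fun _ _ => abs_nonneg _) fun i _ => hT _ _ _
    _ = c ^ p * (1 + ‖residOf θ x e‖ ^ 2) ^ p := by simp [mul_pow]
    _ ≤ c ^ p * ((2 * (1 + (m : ℝ) ^ 2)) ^ p * (1 + ‖e‖ ^ (2 * p))) := by
        gcongr; exact one_add_sq_residOf_pow_le θ hx p e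
    _ = _ := by simp [mul_assoc]

theorem Tstar_nonneg (I J : Fin p → Idx m r s k l) : 0 ≤ Tstar θ κ p I J :=
  Real.iSup_nonneg fun _ => integral_nonneg fun _ => abs_nonneg _

/-- A moment growing more slowly than `v`, times a polynomial of degree `p - 1`, is negligible
against `v ^ p`; values of `v` in a bounded range go into the constant. Only the exponent `γ = 1` is
needed. -/
theorem growth_bound {h : ℝ → ℝ} (hb : ∀ v : ℝ, BddAbove (h '' Set.Icc 0 v))
    (hlim : ∀ γ : ℝ, 0 < γ → Tendsto (fun v : ℝ => h v / v ^ γ) atTop (𝓝 0)) (hp : 1 ≤ p)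
    {c η : ℝ} (hc : 0 ≤ c) (hη : 0 < η) :
    ∃ C : ℝ, 0 ≤ C ∧ ∀ v, 0 ≤ v → c * (1 + max (h v) 0) * (1 + v) ^ (p - 1) ≤ η * v ^ p + C := by
  -- Past `v₀`, the factor `1 + max (h v) 0` is at most `2 η' v` and `1 + v` is at most `2 v`; this
  -- `η'` absorbs the resulting constants.
  set η' : ℝ := η / (c * 2 * 2 ^ (p - 1) + 1) with hη'
  have hη'0 : 0 < η' := by positivity
  have h1 := (hlim 1 one_pos).eventually_lt_const hη'0
  obtain ⟨v₀, hv₀⟩ := eventually_atTop.1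
    (h1.and ((eventually_ge_atTop (1 : ℝ)).and (eventually_ge_atTop (1 / η'))))
  obtain ⟨b, hb⟩ := hb (max v₀ 0)
  refine ⟨c * (1 + max b 0) * (1 + max v₀ 0) ^ (p - 1), by positivity, fun v hv => ?_⟩
  rcases le_total v₀ v with hvv | hvv
  · obtain ⟨g1, g2, g3⟩ := hv₀ v hvv
    rw [Real.rpow_one, div_lt_iff₀ (by linarith)] at g1
    have g4 : 1 ≤ η' * v := by rwa [div_le_iff₀' hη'0] at g3
    have g5 : 1 + max (h v) 0 ≤ 2 * η' * v := by
      have : max (h v) 0 ≤ η' * v := max_le g1.le (by positivity)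
      linarith
    have g6 : (1 + v) ^ (p - 1) ≤ 2 ^ (p - 1) * v ^ (p - 1) := by
      rw [← mul_pow]; gcongr; linarith
    have g7 : v ^ p = v * v ^ (p - 1) := by rw [← pow_succ', Nat.sub_add_cancel hp]
    have g8 : c * 2 * 2 ^ (p - 1) * η' ≤ η := by
      rw [hη', mul_div_assoc', div_le_iff₀ (by positivity)]
      nlinarith [pow_pos (two_pos (α := ℝ)) (p - 1)]
    calc c * (1 + max (h v) 0) * (1 + v) ^ (p - 1)
        ≤ c * (2 * η' * v) * (2 ^ (p - 1) * v ^ (p - 1)) := by gcongr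
      _ = (c * 2 * 2 ^ (p - 1) * η') * v ^ p := by rw [g7]; ring
      _ ≤ η * v ^ p := by gcongr
      _ ≤ _ := le_add_of_nonneg_right (by positivity)
  · have hvm : v ≤ max v₀ 0 := hvv.trans (le_max_left _ _)
    have g1 : h v ≤ b := hb ⟨v, ⟨hv, hvm⟩, rfl⟩
    calc c * (1 + max (h v) 0) * (1 + v) ^ (p - 1)
        ≤ c * (1 + max b 0) * (1 + max v₀ 0) ^ (p - 1) := by gcongr
      _ ≤ _ := le_add_of_nonneg_left (by positivity)

/-- A weighted sum of the absolute values of the monomials of degree `p` in the state. -/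
def lyap (w : (Fin p → Idx m r s k l) → ℝ) (x : State m r s k l) : ℝ :=
  ∑ I, w I * ∏ c, |x (I c)|

theorem abs_pow_le_lyap {w : (Fin p → Idx m r s k l) → ℝ} (hw : ∀ I, 1 ≤ w I)
    (x : State m r s k l) (i : Idx m r s k l) : |x i| ^ p ≤ lyap w x := by
  have h := Finset.single_le_sum (f := fun I : Fin p → Idx m r s k l => w I * ∏ c, |x (I c)|)
    (fun I _ => mul_nonneg (zero_le_one.trans (hw I)) (Finset.prod_nonneg fun _ _ => abs_nonneg _))
    (Finset.mem_univ fun _ => i)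
  simp only [Finset.prod_const, Finset.card_univ, Fintype.card_fin] at h
  refine le_trans ?_ h
  exact le_mul_of_one_le_left (by positivity) (hw _)

theorem lyap_nonneg {w : (Fin p → Idx m r s k l) → ℝ} (hw : ∀ I, 1 ≤ w I)
    (x : State m r s k l) : 0 ≤ lyap w x :=
  Finset.sum_nonneg fun I _ =>
    mul_nonneg (zero_le_one.trans (hw I)) (Finset.prod_nonneg fun _ _ => abs_nonneg _)

theorem norm_pow_le_lyap (hp : 1 ≤ p) {w : (Fin p → Idx m r s k l) → ℝ} (hw : ∀ I, 1 ≤ w I)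
    (x : State m r s k l) : ‖x‖ ^ p ≤ lyap w x := by
  rcases isEmpty_or_nonempty (Idx m r s k l) with h | h
  · have : x = 0 := Subsingleton.elim _ _
    rw [this, norm_zero, zero_pow (by lia)]
    exact lyap_nonneg hw _
  · obtain ⟨i, hi⟩ := Finite.exists_max fun i => |x i|
    have : ‖x‖ ≤ |x i| := (pi_norm_le_iff_of_nonneg (abs_nonneg _)).2 hi
    exact (pow_le_pow_left₀ (norm_nonneg _) this p).trans (abs_pow_le_lyap hw x i)

theorem continuous_lyap (w : (Fin p → Idx m r s k l) → ℝ) : Continuous (lyap w) := by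
  unfold lyap; fun_prop

/-- Averaging the linear part replaces the weights by at most `w T* = w - 1`, a gain of the sum of
all monomials, which is at least `lyap / wm`. Half of this gain pays for the lower-order term and
the other half gives the contraction. The squares of the innovation are included because the
innovation is a component of the chain and must also be tight. -/
theorem exists_drift [IsMarkovKernel κ] (hκ : IsStandardized κ) (hp : 1 ≤ p)
    (hE1 : AssumptionE1 θ κ p) (hE2 : AssumptionE2 κ p) :
    ∃ w : (Fin p → Idx m r s k l) → ℝ, (∀ I, 1 ≤ w I) ∧ ∃ δ C : ℝ, 0 ≤ δ ∧ δ < 1 ∧ 0 ≤ C ∧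
      ∀ x ∈ stateSpace m r s k l,
        ∫⁻ e, ENNReal.ofReal (lyap w (step θ x (residOf θ x e)) + ∑ a, e a ^ 2) ∂(κ x)
          ≤ ENNReal.ofReal (δ * lyap w x + C) := by
  obtain ⟨w, hw1, hw⟩ := exists_subinvariant_weight (T := Tstar θ κ p) Tstar_nonneg
    (summable_pow_of_specRadius_lt_one hE1.spectral)
  obtain ⟨h, hh, hbd, hlim⟩ := hE2.growth
  obtain ⟨c, hc, hstep⟩ := exists_prod_step_bound θ p hp
  have hw0 : ∀ I, 0 ≤ w I := fun I => zero_le_one.trans (hw1 I)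
  -- An upper bound for all weights; the summand 1 keeps it at least 1 even if there are no indices.
  set wm : ℝ := 1 + ∑ I, w I with hwm
  have hS : 0 ≤ ∑ I, w I := Finset.sum_nonneg fun I _ => hw0 I
  have hwm1 : 1 ≤ wm := by linarith
  have hwle : ∀ I, w I ≤ wm := fun I => by
    have := Finset.single_le_sum (f := w) (fun I _ => hw0 I) (Finset.mem_univ I)
    linarith
  set c' : ℝ := (∑ I, w I) * (c * (2 * (1 + (m : ℝ) ^ 2)) ^ p) with hc'
  have hc'0 : 0 ≤ c' := by positivity
  -- The share `1 / (2 wm)` is half of the relative gain `1 / wm` from the linear part.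
  obtain ⟨C, hC, hgrow⟩ := growth_bound hbd hlim hp (c := c') (η := 1 / (2 * wm)) hc'0
    (by positivity)
  refine ⟨w, hw1, 1 - 1 / (2 * wm), C + m, ?_, ?_, by positivity, fun x hx => ?_⟩
  · rw [sub_nonneg, div_le_one (by positivity)]; linarith
  · have : 0 < 1 / (2 * wm) := by positivity
    linarith
  have hmom := integrable_norm_pow (hE1.moment x hx)
  have hkr := fun I J => integrable_abs_kronPow (θ := θ) hx (hE1.moment x hx) I J
  let P : (Fin p → Idx m r s k l) → ℝ := fun J => ∏ i, |x (J i)|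
  have hP : ∀ J, 0 ≤ P J := fun J => Finset.prod_nonneg fun _ _ => abs_nonneg _
  let g₁ : (Fin m → ℝ) → ℝ := fun e =>
    ∑ I, w I * ∑ J, |kronPow p (transMat θ (residOf θ x e)) I J| * P J
  let g₂ : (Fin m → ℝ) → ℝ := fun e => c' * (1 + ‖x‖) ^ (p - 1) * (1 + ‖e‖ ^ (2 * p))
  let g₃ : (Fin m → ℝ) → ℝ := fun e => ∑ a, e a ^ 2
  have hle : ∀ e, lyap w (step θ x (residOf θ x e)) + ∑ a, e a ^ 2 ≤ g₁ e + g₂ e + g₃ e := by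
    intro e
    refine add_le_add ?_ le_rfl
    calc lyap w (step θ x (residOf θ x e))
        ≤ ∑ I, w I * (∑ J, |kronPow p (transMat θ (residOf θ x e)) I J| * P J
          + c * (1 + ‖residOf θ x e‖ ^ 2) ^ p * (1 + ‖x‖) ^ (p - 1)) :=
          Finset.sum_le_sum fun I _ => mul_le_mul_of_nonneg_left (hstep x _ I) (hw0 I)
      _ = g₁ e + (∑ I, w I) * (c * (1 + ‖residOf θ x e‖ ^ 2) ^ p * (1 + ‖x‖) ^ (p - 1)) := by
          simp only [mul_add, Finset.sum_add_distrib, Finset.sum_mul, g₁]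
      _ ≤ g₁ e + (∑ I, w I) * (c * ((2 * (1 + (m : ℝ) ^ 2)) ^ p * (1 + ‖e‖ ^ (2 * p)))
            * (1 + ‖x‖) ^ (p - 1)) := by
          gcongr; exact one_add_sq_residOf_pow_le θ hx p e
      _ = g₁ e + g₂ e := by simp only [g₂, hc']; ring
  have hi₁ : Integrable g₁ (κ x) := integrable_finsetSum _ fun I _ =>
    (integrable_finsetSum _ fun J _ => (hkr I J).mul_const _).const_mul _
  have hi₂ : Integrable g₂ (κ x) := ((integrable_const 1).add hmom).const_mul _
  have hsq : ∀ a, Integrable (fun e => e a ^ 2) (κ x) ∧ ∫ e, e a ^ 2 ∂(κ x) = 1 := by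
    intro a
    have := (hκ x hx).2 a a
    simpa [sq] using this
  have hi₃ : Integrable g₃ (κ x) := integrable_finsetSum _ fun a _ => (hsq a).1
  have hv₁ : ∫ e, g₁ e ∂(κ x) ≤ lyap w x - ∑ J, P J := by
    calc ∫ e, g₁ e ∂(κ x) = ∑ I, w I * ∑ J, condAbsKron θ κ p x I J * P J := by
          rw [integral_finsetSum _ fun I _ =>
            (integrable_finsetSum _ fun J _ => (hkr I J).mul_const _).const_mul _]
          refine Finset.sum_congr rfl fun I _ => ?_
          rw [integral_const_mul, integral_finsetSum _ fun J _ => (hkr I J).mul_const _]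
          congr 1
          refine Finset.sum_congr rfl fun J _ => ?_
          rw [integral_mul_const]
          rfl
      _ ≤ ∑ I, w I * ∑ J, Tstar θ κ p I J * P J := by
          refine Finset.sum_le_sum fun I _ => mul_le_mul_of_nonneg_left
            (Finset.sum_le_sum fun J _ => mul_le_mul_of_nonneg_right ?_ (hP J)) (hw0 I)
          exact le_ciSup (hE1.bdd I J) ⟨x, hx⟩
      _ = ∑ J, (∑ I, w I * Tstar θ κ p I J) * P J := by
          simp only [Finset.mul_sum, Finset.sum_mul, mul_assoc]
          exact Finset.sum_comm
      _ = lyap w x - ∑ J, P J := by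
          simp only [hw, sub_mul, one_mul, Finset.sum_sub_distrib]; rfl
  have hv₂ : ∫ e, g₂ e ∂(κ x) ≤ 1 / (2 * wm) * ‖x‖ ^ p + C := by
    have e1 : ∫ e, g₂ e ∂(κ x)
        = c' * (1 + ‖x‖) ^ (p - 1) * (1 + ∫ e, ‖e‖ ^ (2 * p) ∂(κ x)) := by
      rw [integral_const_mul, integral_add (integrable_const 1) hmom]
      simp
    rw [e1]
    refine le_trans ?_ (hgrow ‖x‖ (norm_nonneg _))
    have := integral_norm_pow_le (hh x hx)
    calc _ ≤ c' * (1 + ‖x‖) ^ (p - 1) * (1 + max (h ‖x‖) 0) := by gcongr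
      _ = _ := by ring
  have hv₃ : ∫ e, g₃ e ∂(κ x) = m := by
    rw [integral_finsetSum _ fun a _ => (hsq a).1]
    simp [(hsq _).2]
  have hPge : lyap w x ≤ wm * ∑ J, P J := by
    rw [Finset.mul_sum]
    exact Finset.sum_le_sum fun J _ => mul_le_mul_of_nonneg_right (hwle J) (hP J)
  have hfinal : ∫ e, g₁ e + g₂ e + g₃ e ∂(κ x) ≤ (1 - 1 / (2 * wm)) * lyap w x + (C + m) := by
    rw [integral_add (f := fun e => g₁ e + g₂ e) (hi₁.add hi₂) hi₃, integral_add hi₁ hi₂, hv₃]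
    have h1 : 1 / (2 * wm) * ‖x‖ ^ p ≤ 1 / (2 * wm) * lyap w x := by
      gcongr; exact norm_pow_le_lyap hp hw1 x
    have h2 : 2 * (1 / (2 * wm) * lyap w x) ≤ ∑ J, P J := by
      have : 2 * (1 / (2 * wm) * lyap w x) = lyap w x / wm := by field_simp
      rw [this, div_le_iff₀ (by positivity)]
      linarith
    nlinarith
  have hnn : ∀ e, 0 ≤ g₁ e + g₂ e + g₃ e := fun e =>
    le_trans (add_nonneg (lyap_nonneg hw1 _) (Finset.sum_nonneg fun _ _ => sq_nonneg _)) (hle e)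
  calc _ ≤ ∫⁻ e, ENNReal.ofReal (g₁ e + g₂ e + g₃ e) ∂(κ x) :=
        lintegral_mono fun e => ENNReal.ofReal_le_ofReal (hle e)
    _ = ENNReal.ofReal (∫ e, g₁ e + g₂ e + g₃ e ∂(κ x)) :=
        (ofReal_integral_eq_lintegral_ofReal ((hi₁.add hi₂).add hi₃) (ae_of_all _ hnn)).symm
    _ ≤ _ := ENNReal.ofReal_le_ofReal hfinal

end Drift

end DCC

end

noncomputable section

namespace DCC

/-! ### The stationary two-sided chain of states and innovations -/

section Chain

variable {m r s k l : ℕ} (θ : Params m r s k l)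

instance : PolishSpace (core θ) := (isClosed_core θ).polishSpace

instance : BorelSpace (ℕ → core θ × (Fin m → ℝ)) := Pi.borelSpace

/-- The transition kernel of the pairs formed by the state and the last innovation. -/
def coreKernel (κ : Kernel (State m r s k l) (Fin m → ℝ)) :
    Kernel (core θ × (Fin m → ℝ)) (core θ × (Fin m → ℝ)) :=
  ((Kernel.id ×ₖ κ.comap Subtype.val measurable_subtype_coe).map
    fun q : core θ × (Fin m → ℝ) => (coreStep θ q, q.2)).comap Prod.fst measurable_fst

variable (κ : Kernel (State m r s k l) (Fin m → ℝ)) [IsMarkovKernel κ]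

theorem measurable_coreStep_prodMk : Measurable fun q : core θ × (Fin m → ℝ) => (coreStep θ q, q.2) :=
  (continuous_coreStep θ).measurable.prodMk measurable_snd

instance : IsMarkovKernel (coreKernel θ κ) := by
  have := Kernel.IsMarkovKernel.map (Kernel.id ×ₖ κ.comap Subtype.val measurable_subtype_coe)
    (measurable_coreStep_prodMk θ)
  unfold coreKernel
  infer_instance

theorem measurable_coreStep_right (x : core θ) :
    Measurable fun e : Fin m → ℝ => (coreStep θ (x, e), e) :=
  (measurable_coreStep_prodMk θ).comp measurable_prodMk_left

theorem coreKernel_apply (y : core θ × (Fin m → ℝ)) :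
    coreKernel θ κ y = (κ y.1.1).map fun e => (coreStep θ (y.1, e), e) := by
  rw [coreKernel, Kernel.comap_apply, Kernel.map_apply _ (measurable_coreStep_prodMk θ),
    Kernel.prod_apply, Kernel.id_apply, Kernel.comap_apply, Measure.dirac_prod,
    Measure.map_map (measurable_coreStep_prodMk θ) measurable_prodMk_left]
  rfl

variable {θ κ} {p : ℕ}

/-- With densities, the conditional integral is an integral over a fixed Lebesgue space whose
integrand is continuous in the path for each `e`; dominated convergence applies with bound `H ‖F‖`.
The test function may depend on the whole past at no extra cost. -/
theorem coreKernel_feller (hE2 : AssumptionE2 κ p)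
    (F : BoundedContinuousFunction ((ℕ → core θ × (Fin m → ℝ)) × (core θ × (Fin m → ℝ))) ℝ) :
    Continuous fun q : ℕ → core θ × (Fin m → ℝ) => ∫ y, F (q, y) ∂(coreKernel θ κ (q 0)) := by
  obtain ⟨f, hf, hfc, H, hH, hfH⟩ := hE2.density
  have e1 : (fun q : ℕ → core θ × (Fin m → ℝ) => ∫ y, F (q, y) ∂(coreKernel θ κ (q 0)))
      = fun q => ∫ e, f (q 0).1.1 e * F (q, (coreStep θ ((q 0).1, e), e)) := by
    funext q
    obtain ⟨h1, h2, h3⟩ := hf (q 0).1.1 (core_subset θ (q 0).1.2)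
    have hF : Measurable fun y => F (q, y) := F.continuous.measurable.comp measurable_prodMk_left
    rw [coreKernel_apply, integral_map (measurable_coreStep_right θ _).aemeasurable
      hF.aestronglyMeasurable, h3,
      integral_withDensity_eq_integral_toReal_smul (by fun_prop) (ae_of_all _ fun e => by simp)]
    simp only [ENNReal.toReal_ofReal (h2 _), smul_eq_mul]
  rw [e1]
  refine continuous_of_dominated (bound := fun e => H e * ‖F‖) (fun q => ?_) (fun q => ?_)
    (hH.mul_const _) (ae_of_all _ fun e => ?_)
  · refine (hf (q 0).1.1 (core_subset θ (q 0).1.2)).1.aestronglyMeasurable.mul ?_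
    refine (F.continuous.measurable.comp ?_).aestronglyMeasurable
    exact measurable_const.prodMk (measurable_coreStep_right θ _)
  · obtain ⟨h1, h2, h3⟩ := hf (q 0).1.1 (core_subset θ (q 0).1.2)
    refine ae_of_all _ fun e => ?_
    rw [norm_mul, Real.norm_eq_abs, abs_of_nonneg (h2 e)]
    exact mul_le_mul (hfH _ (core_subset θ (q 0).1.2) e) (F.norm_coe_le_norm _) (norm_nonneg _)
      ((h2 e).trans (hfH _ (core_subset θ (q 0).1.2) e))
  · have hq : Continuous fun q : ℕ → core θ × (Fin m → ℝ) => (q 0).1 :=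
      continuous_fst.comp (continuous_apply 0)
    have g1 : Continuous fun q : ℕ → core θ × (Fin m → ℝ) => f (q 0).1.1 e :=
      (hfc e).comp_continuous (continuous_subtype_val.comp hq) fun q => core_subset θ (q 0).1.2
    refine g1.mul (F.continuous.comp (continuous_id.prodMk ?_))
    exact ((continuous_coreStep θ).comp (hq.prodMk continuous_const)).prodMk continuous_const

/-- The first summand bounds the state and the second the innovation; since the core is closed in a
Euclidean space, closed and bounded is enough. -/
theorem isCompact_lyap_le (hp : 1 ≤ p) {w : (Fin p → Idx m r s k l) → ℝ} (hw : ∀ I, 1 ≤ w I)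
    (c : ℝ) : IsCompact {y : core θ × (Fin m → ℝ) | lyap w y.1.1 + ∑ a, y.2 a ^ 2 ≤ c} := by
  have hemb : IsClosedEmbedding fun y : core θ × (Fin m → ℝ) => (y.1.1, y.2) :=
    (isClosed_core θ).isClosedEmbedding_subtypeVal.prodMap IsClosedEmbedding.id
  have hK := hemb.isCompact_preimage ((isCompact_closedBall (0 : State m r s k l) (1 + |c|)).prod
    (isCompact_closedBall (0 : Fin m → ℝ) (1 + |c|)))
  refine hK.of_isClosed_subset ?_ ?_
  · refine isClosed_le ?_ continuous_const
    exact ((continuous_lyap w).comp (by fun_prop)).add (by fun_prop)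
  · rintro ⟨x, e⟩ hy
    have hy : lyap w x.1 + ∑ a, e a ^ 2 ≤ c := hy
    have h1 := lyap_nonneg hw x.1
    have h2 : 0 ≤ ∑ a, e a ^ 2 := Finset.sum_nonneg fun a _ => sq_nonneg _
    have h3 := norm_pow_le_lyap hp hw x.1
    have hroot : ∀ (t : ℝ) (n : ℕ), 1 ≤ n → 0 ≤ t → t ^ n ≤ c → t ≤ 1 + |c| := by
      intro t n hn ht htn
      rcases le_total t 1 with h | h
      · linarith [abs_nonneg c]
      · have := le_self_pow₀ h (by lia : n ≠ 0)
        linarith [le_abs_self c]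
    simp only [Set.mem_preimage, Set.mem_prod, mem_closedBall_zero_iff]
    refine ⟨hroot _ p hp (norm_nonneg _) (by linarith),
      (pi_norm_le_iff_of_nonneg (by positivity)).2 fun a => ?_⟩
    refine hroot _ 2 (by norm_num) (norm_nonneg _) ?_
    have := Finset.single_le_sum (f := fun a => e a ^ 2) (fun a _ => sq_nonneg _)
      (Finset.mem_univ a)
    simp only [Real.norm_eq_abs, sq_abs]
    linarith

theorem exists_stationary_chain (hκ : IsStandardized κ) (hp : 1 ≤ p)
    (hE1 : AssumptionE1 θ κ p) (hE2 : AssumptionE2 κ p) :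
    ∃ μ : Measure (ℤ → core θ × (Fin m → ℝ)), IsProbabilityMeasure μ ∧
      (∀ a : ℤ, μ.map (fun ω t => ω (t + a)) = μ) ∧
      μ.map (fun ω => (StationaryChain.past ω, ω 1))
        = (μ.map StationaryChain.past) ⊗ₘ StationaryChain.pastKernel (coreKernel θ κ) ∧
      ∃ B : NNReal, ∀ t i, ∫⁻ ω, ENNReal.ofReal (|(ω t).1.1 i| ^ p) ∂μ ≤ B := by
  obtain ⟨w, hw, δ, C, hδ0, hδ1, hC, hdrift⟩ := exists_drift hκ hp hE1 hE2
  let V : core θ × (Fin m → ℝ) → NNReal := fun y => (lyap w y.1.1 + ∑ a, y.2 a ^ 2).toNNReal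
  have hVc : Continuous V :=
    continuous_real_toNNReal.comp (((continuous_lyap w).comp (by fun_prop)).add (by fun_prop))
  have hVk : ∀ c, IsCompact {y | V y ≤ c} := by
    intro c
    simpa [V, Real.toNNReal_le_iff_le_coe] using isCompact_lyap_le hp hw (c : ℝ)
  have hV : ∀ y, ∫⁻ y', V y' ∂(coreKernel θ κ y) ≤ δ.toNNReal * V y + C.toNNReal := by
    intro y
    rw [coreKernel_apply, lintegral_map hVc.measurable.coe_nnreal_ennreal
      (measurable_coreStep_right θ _)]
    refine (hdrift y.1.1 (core_subset θ y.1.2)).trans ?_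
    rw [ENNReal.ofReal_add (mul_nonneg hδ0 (lyap_nonneg hw _)) hC, ENNReal.ofReal_mul hδ0]
    refine add_le_add (mul_le_mul_right (ENNReal.ofReal_le_ofReal ?_) _) le_rfl
    exact le_add_of_nonneg_right (Finset.sum_nonneg fun a _ => sq_nonneg _)
  let y₀ : core θ × (Fin m → ℝ) := (⟨basePoint θ, basePoint_mem θ⟩, 0)
  have hδ1' : 0 < 1 - δ := by linarith
  -- The fixed point of `b ↦ δ b + C`, raised so as to dominate the initial value as well.
  let B : NNReal := V y₀ + (C / (1 - δ)).toNNReal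
  have hB : δ.toNNReal * B + C.toNNReal ≤ B := by
    rw [← NNReal.coe_le_coe]
    simp only [B, NNReal.coe_add, NNReal.coe_mul, Real.coe_toNNReal _ hδ0, Real.coe_toNNReal _ hC,
      Real.coe_toNNReal _ (div_nonneg hC hδ1'.le)]
    have h1 : δ * (C / (1 - δ)) + C = C / (1 - δ) := by field_simp; ring
    nlinarith [NNReal.coe_nonneg (V y₀)]
  obtain ⟨μ, h1, h2, h3, h4⟩ := StationaryChain.exists_stationary (coreKernel θ κ) y₀ hVc hVk hV
    (le_add_of_nonneg_right zero_le) hB (coreKernel_feller hE2)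
  refine ⟨μ, h1, h2, h3, B, fun t i => le_trans (lintegral_mono fun ω => ?_) (h4 t)⟩
  refine ENNReal.ofReal_le_ofReal ((abs_pow_le_lyap hw _ i).trans ?_)
  exact le_add_of_nonneg_right (Finset.sum_nonneg fun a _ => sq_nonneg _)

end Chain

end DCC

end

noncomputable section

/-! ### Stable linear recursions as functionals of their inputs -/

namespace LinearRecursion

variable {ι : Type} [Fintype ι] [DecidableEq ι]

/-- The value at time zero of the stationary solution of a linear recursion, as a function of the
inputs, listed backwards in time. -/
def limitValue (S : Matrix ι ι ℝ) (b : ℕ → ι → ℝ) : ι → ℝ := fun i =>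
  limsup (fun n => (∑ j ∈ Finset.range n, S ^ j *ᵥ b j) i) atTop

/-- The reason for using a limsup: it is measurable on all inputs, with no convergence required. -/
theorem measurable_limitValue {Ω : Type*} [MeasurableSpace Ω] (S : Matrix ι ι ℝ)
    {b : Ω → ℕ → ι → ℝ} (hb : ∀ n, Measurable fun ω => b ω n) :
    Measurable fun ω => limitValue S (b ω) := by
  refine measurable_pi_lambda _ fun i => Measurable.limsup fun n => ?_
  simp only [Finset.sum_apply]
  refine Finset.measurable_sum _ fun j _ => Finset.measurable_sum _ fun a _ => ?_
  exact ((measurable_pi_apply a).comp (hb j)).const_mul _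

theorem iterate_eq {S : Matrix ι ι ℝ} {Y b : ℤ → ι → ℝ} (h : ∀ t, Y t = S *ᵥ Y (t - 1) + b t)
    (t : ℤ) (n : ℕ) :
    Y t = S ^ n *ᵥ Y (t - n) + ∑ j ∈ Finset.range n, S ^ j *ᵥ b (t - j) := by
  induction n with
  | zero => simp
  | succ n ih =>
    rw [Finset.sum_range_succ]
    conv_lhs => rw [ih, h (t - n)]
    rw [Matrix.mulVec_add, Matrix.mulVec_mulVec, ← pow_succ]
    have : t - (n : ℤ) - 1 = t - ((n + 1 : ℕ) : ℤ) := by push_cast; ring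
    rw [this]
    abel

/-- Iterating the recursion `n` times leaves `S ^ n` applied to the remote value as the only error,
so the partial sums converge and the limsup is a limit. -/
theorem limitValue_eq {S : Matrix ι ι ℝ} {Y b : ℤ → ι → ℝ} (h : ∀ t, Y t = S *ᵥ Y (t - 1) + b t)
    (t : ℤ) (h0 : ∀ i, Tendsto (fun n : ℕ => (S ^ n *ᵥ Y (t - n)) i) atTop (𝓝 0)) :
    limitValue S (fun n => b (t - n)) = Y t := by
  funext i
  refine Tendsto.limsup_eq ?_
  have h1 : ∀ n : ℕ, (∑ j ∈ Finset.range n, S ^ j *ᵥ b (t - j)) i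
      = Y t i - (S ^ n *ᵥ Y (t - n)) i := by
    intro n
    have := congrFun (iterate_eq h t n) i
    rw [Pi.add_apply] at this
    linarith
  simp only [h1]
  simpa using (h0 i).const_sub (Y t i)

/-- The series over `n` of the `p`-th powers of the products has finite expectation, by the uniform
moment bound and summability of the entries. It is therefore almost surely finite and its terms tend
to zero. No independence or ergodicity is involved. -/
theorem ae_tendsto_pow_mulVec {Ω : Type*} [MeasurableSpace Ω] {P : Measure Ω} {S : Matrix ι ι ℝ}
    {p : ℕ} (hp : 1 ≤ p) (hS : ∀ i j, Summable fun n : ℕ => |(S ^ n) i j| ^ p)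
    {Y : ℤ → Ω → ι → ℝ} (hY : ∀ t, Measurable (Y t)) {B : NNReal}
    (hB : ∀ t i, ∫⁻ ω, ENNReal.ofReal (|Y t ω i| ^ p) ∂P ≤ B) :
    ∀ᵐ ω ∂P, ∀ t i, Tendsto (fun n : ℕ => (S ^ n *ᵥ Y (t - n) ω) i) atTop (𝓝 0) := by
  have key : ∀ t i j, ∀ᵐ ω ∂P,
      Tendsto (fun n : ℕ => (S ^ n) i j * Y (t - n) ω j) atTop (𝓝 0) := by
    intro t i j
    have hm : ∀ n : ℕ, Measurable fun ω => ENNReal.ofReal (|(S ^ n) i j * Y (t - n) ω j| ^ p) := by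
      intro n
      have : Measurable fun ω => Y (t - n) ω j := (measurable_pi_apply j).comp (hY _)
      fun_prop
    have hfin : ∫⁻ ω, ∑' n : ℕ, ENNReal.ofReal (|(S ^ n) i j * Y (t - n) ω j| ^ p) ∂P ≠ ⊤ := by
      rw [lintegral_tsum fun n => (hm n).aemeasurable]
      refine ne_top_of_le_ne_top (b := ∑' n : ℕ, ENNReal.ofReal (|(S ^ n) i j| ^ p) * B) ?_
        (ENNReal.tsum_le_tsum fun n => ?_)
      · rw [ENNReal.tsum_mul_right]
        refine ENNReal.mul_ne_top ?_ ENNReal.coe_ne_top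
        rw [← ENNReal.ofReal_tsum_of_nonneg (fun n => by positivity) (hS i j)]
        exact ENNReal.ofReal_ne_top
      · simp only [abs_mul, mul_pow]
        simp only [ENNReal.ofReal_mul (pow_nonneg (abs_nonneg ((S ^ n) i j)) p)]
        rw [lintegral_const_mul' _ _ ENNReal.ofReal_ne_top]
        gcongr
        exact hB _ _
    have hae := ae_lt_top (Measurable.tsum hm) hfin
    filter_upwards [hae] with ω hω
    have h1 := ENNReal.tendsto_atTop_zero_of_tsum_ne_top hω.ne
    have h2 : Tendsto (fun n : ℕ => |(S ^ n) i j * Y (t - n) ω j| ^ p) atTop (𝓝 0) := by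
      have := (ENNReal.tendsto_toReal ENNReal.zero_ne_top).comp h1
      refine this.congr fun n => ?_
      simp only [Function.comp]
      exact ENNReal.toReal_ofReal (by positivity)
    rw [tendsto_zero_iff_abs_tendsto_zero]
    have h3 := h2.rpow_const (p := (p : ℝ)⁻¹) (Or.inr (by positivity))
    rw [Real.zero_rpow (by positivity)] at h3
    refine h3.congr fun n => ?_
    exact Real.pow_rpow_inv_natCast (abs_nonneg _) (by lia)
  filter_upwards [ae_all_iff.2 fun t => ae_all_iff.2 fun i => ae_all_iff.2 fun j => key t i j]
    with ω hω t i
  simpa [Matrix.mulVec, dotProduct] using tendsto_finsetSum Finset.univ fun j _ => hω t i j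

end LinearRecursion

namespace DCC

/-- Along a path indexed by all of `ℤ`, block `i` is the value inserted `i` steps earlier, by
induction on `i` with the time left free. This identifies abstract state blocks with lagged
variables. -/
theorem shiftIn_eq_lag {n : ℕ} {ι : Type} {v : ℤ → ι → ℝ} {Y : ℤ → Fin n × ι → ℝ}
    (h : ∀ t, Y t = shiftIn (v t) (Y (t - 1))) (t : ℤ) (u : Fin n × ι) :
    Y t u = v (t - u.1.val) u.2 := by
  obtain ⟨⟨i, hi⟩, a⟩ := u
  induction i generalizing t with
  | zero => rw [h]; simp [shiftIn]
  | succ i ih =>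
    rw [h]
    have := ih (t - 1) (by lia)
    simp only [shiftIn] at this ⊢
    rw [if_neg (by simp)]
    simp only [Nat.add_sub_cancel]
    rw [this]
    congr 1
    push_cast; ring

/-! ### Volatilities and correlations as measurable functionals of past observations. -/

section Functionals

variable {m r s k l : ℕ} (θ : Params m r s k l)

/-- `Vecd(D_t)` as a function of the observations `z_{t-1}, z_{t-2}, …`. -/
def volOf (hr : 0 < r) (u : ℕ → Fin m → ℝ) : Fin m → ℝ := fun a =>
  LinearRecursion.limitValue (companion θ.A)
    (fun n => shiftIn (θ.V₀ + ∑ j : Fin s, θ.B j *ᵥ fun b => u (n + j) b ^ 2) 0) (⟨0, hr⟩, a)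

/-- The standardized residual `ε_{t-1-n}` as a function of the observations
`z_{t-1}, z_{t-2}, …`. -/
def pastResid (hr : 0 < r) (u : ℕ → Fin m → ℝ) (n : ℕ) : Fin m → ℝ := fun a =>
  (√(volOf θ hr (fun i => u (n + 1 + i)) a))⁻¹ * u n a

/-- `vech(Q_t)` as a function of the observations `z_{t-1}, z_{t-2}, …`. -/
def vechQOf (hr : 0 < r) (hk : 0 < k) (u : ℕ → Fin m → ℝ) : VechIdx m → ℝ := fun q =>
  LinearRecursion.limitValue (companion fun i => vechConj (θ.M i))
    (fun n => shiftIn (vech θ.W₀ + ∑ j : Fin l, vechConj (θ.N j) *ᵥ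
      vech (Matrix.vecMulVec (pastResid θ hr u (n + j)) (pastResid θ hr u (n + j)))) 0)
    (⟨0, hk⟩, q)

theorem measurable_shiftIn_zero {Ω : Type*} [MeasurableSpace Ω] {n : ℕ} {ι : Type}
    {v : Ω → ι → ℝ} (hv : Measurable v) : Measurable fun ω => shiftIn (n := n) (v ω) 0 := by
  refine measurable_pi_lambda _ fun u => ?_
  by_cases h : u.1.val = 0
  · simp only [shiftIn, h, if_true]; exact (measurable_pi_apply _).comp hv
  · simp only [shiftIn, h, if_false]; exact measurable_const

theorem measurable_mulVec {Ω : Type*} [MeasurableSpace Ω] {ι : Type} [Fintype ι]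
    (M : Matrix ι ι ℝ) {v : Ω → ι → ℝ} (hv : Measurable v) : Measurable fun ω => M *ᵥ v ω :=
  measurable_pi_lambda _ fun _ => Finset.measurable_sum _ fun a _ =>
    ((measurable_pi_apply a).comp hv).const_mul _

theorem measurable_volOf (hr : 0 < r) : Measurable (volOf θ hr) := by
  have h := LinearRecursion.measurable_limitValue (companion θ.A)
    (b := fun (u : ℕ → Fin m → ℝ) n =>
      shiftIn (θ.V₀ + ∑ j : Fin s, θ.B j *ᵥ fun b => u (n + j) b ^ 2) 0) fun n => by
    refine measurable_shiftIn_zero (measurable_const.add (Finset.measurable_sum _ fun j _ => ?_))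
    exact measurable_mulVec _ (by fun_prop)
  exact measurable_pi_lambda _ fun a => measurable_pi_iff.1 h _

theorem measurable_pastResid (hr : 0 < r) (n : ℕ) :
    Measurable fun u : ℕ → Fin m → ℝ => pastResid θ hr u n := by
  refine measurable_pi_lambda _ fun a => ?_
  have hs : Measurable fun (u : ℕ → Fin m → ℝ) (i : ℕ) => u (n + 1 + i) :=
    measurable_pi_lambda _ fun i => measurable_pi_apply (n + 1 + i)
  have h1 : Measurable fun u : ℕ → Fin m → ℝ => volOf θ hr (fun i => u (n + 1 + i)) a :=
    measurable_pi_iff.1 ((measurable_volOf θ hr).comp hs) a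
  exact h1.sqrt.inv.mul (by fun_prop)

theorem measurable_vechQOf (hr : 0 < r) (hk : 0 < k) : Measurable (vechQOf θ hr hk) := by
  have h := LinearRecursion.measurable_limitValue (companion fun i => vechConj (θ.M i))
    (b := fun (u : ℕ → Fin m → ℝ) n =>
      shiftIn (vech θ.W₀ + ∑ j : Fin l, vechConj (θ.N j) *ᵥ
        vech (Matrix.vecMulVec (pastResid θ hr u (n + j)) (pastResid θ hr u (n + j)))) 0)
    fun n => by
      refine measurable_shiftIn_zero (measurable_const.add (Finset.measurable_sum _ fun j _ => ?_))
      refine measurable_mulVec _ (measurable_pi_lambda _ fun q => ?_)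
      have h1 : ∀ a, Measurable fun u : ℕ → Fin m → ℝ => pastResid θ hr u (n + j) a := fun a =>
        measurable_pi_iff.1 (measurable_pastResid θ hr (n + j)) a
      exact (h1 q.1.1).mul (h1 q.1.2)
  exact measurable_pi_lambda _ fun a => measurable_pi_iff.1 h _

theorem measurable_unvech : Measurable (unvech (m := m)) := by
  refine measurable_pi_lambda _ fun i => measurable_pi_lambda _ fun j => ?_
  by_cases h : j ≤ i
  · simp only [unvech, Matrix.of_apply, h, dite_true]; fun_prop
  · simp only [unvech, Matrix.of_apply, h, dite_false]; fun_prop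

end Functionals

/-! ### Stability of the blocks of the transition matrix free of residuals. -/

section Stability

variable {m r s k l : ℕ} {θ : Params m r s k l} {κ : Kernel (State m r s k l) (Fin m → ℝ)}
  [IsMarkovKernel κ] {p : ℕ}

/-- Powers of a diagonal block of `T_t` that does not depend on `ε_t` are summable. -/
theorem summable_block_pow (hE1 : AssumptionE1 θ κ p) {ι : Type} [Fintype ι] [DecidableEq ι]
    {S : Matrix ι ι ℝ} {f : ι → Idx m r s k l} (hf : Function.Injective f)
    (hS : ∀ ε i j, transMat θ ε (f i) (f j) = S i j) (i j : ι) :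
    Summable fun n : ℕ => |(S ^ n) i j| ^ p := by
  refine summable_abs_pow_entry Tstar_nonneg
    (summable_pow_of_specRadius_lt_one hE1.spectral) hf (fun I J => ?_) i j
  have hx : basePoint θ ∈ stateSpace m r s k l := core_subset θ (basePoint_mem θ)
  -- On this block the integrand is constant and `κ` has mass one, so evaluation at a single state
  -- already bounds the entry by that of `T*`.
  refine le_trans (le_of_eq ?_) (le_ciSup (hE1.bdd (f ∘ I) (f ∘ J)) ⟨basePoint θ, hx⟩)
  simp only [condAbsKron, kronPow, Matrix.of_apply, Function.comp, hS]
  simp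

end Stability

end DCC

end

noncomputable section

namespace DCC

/-! ### The solution as a functional of the stationary chain -/

section Solution

variable {m r s k l : ℕ} (θ : Params m r s k l) (hr : 0 < r) (hk : 0 < k)

/-- The observation as a function of the current state and innovation. -/
def obs (y : core θ × (Fin m → ℝ)) : Fin m → ℝ := fun a =>
  √(y.1.1 (.inl (.inl (⟨0, hr⟩, a)))) *
    (msqrt (corr (unvech fun q => y.1.1 (.inr (.inl (⟨0, hk⟩, q))))) *ᵥ y.2) a

theorem continuous_obs : Continuous (obs θ hr hk) := by
  have hc : ∀ i, Continuous fun x : core θ => x.1 i := fun i =>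
    (continuous_apply i).comp continuous_subtype_val
  have hQ : Continuous fun x : core θ => unvech fun q => x.1 (.inr (.inl (⟨0, hk⟩, q))) :=
    continuous_unvech.comp (continuous_pi fun q => hc _)
  have hpd : ∀ x : core θ, (unvech fun q => x.1 (.inr (.inl (⟨0, hk⟩, q)))).PosDef := fun x =>
    (core_subset θ x.2).2.2.1 ⟨0, hk⟩
  have hR := continuousOn_corr.comp_continuous hQ hpd
  have hS := continuousOn_msqrt.comp_continuous hR fun x => (corr_posDef (hpd x)).posSemidef
  have hv := (hS.comp continuous_fst).matrix_mulVec
    (continuous_snd (X := core θ) (Y := Fin m → ℝ))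
  refine continuous_pi fun a => Continuous.mul ?_ ((continuous_apply a).comp hv)
  exact Real.continuous_sqrt.comp ((hc _).comp continuous_fst)

/-- `obs` reads `D_t` and `Q_t` from the lag-zero blocks of the new state; these blocks equal
`nextD` and `nextQ` of the old state, so `z_t = D_t^{1/2} ε_t`. -/
theorem obs_coreStep (x : core θ) (e : Fin m → ℝ) (a : Fin m) :
    obs θ hr hk (coreStep θ (x, e), e) a = √(nextD θ x.1 a) * residOf θ x.1 e a := by
  have h1 : (coreStep θ (x, e)).1 (.inl (.inl (⟨0, hr⟩, a))) = nextD θ x.1 a :=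
    shiftIn_zero hr (nextD θ x.1) (fun u => x.1 (.inl (.inl u))) a
  have h2 : (fun q => (coreStep θ (x, e)).1 (.inr (.inl (⟨0, hk⟩, q)))) = vech (nextQ θ x.1) :=
    funext fun q => shiftIn_zero hk (vech (nextQ θ x.1)) (fun u => x.1 (.inr (.inl u))) q
  simp only [obs, h1, h2, unvech_vech_nextQ]
  rfl

/-- The observations. -/
def solZ (t : ℤ) (ω : ℤ → core θ × (Fin m → ℝ)) : Fin m → ℝ := obs θ hr hk (ω t)

/-- The observations before time `t`, listed backwards. -/
def solPast (t : ℤ) (ω : ℤ → core θ × (Fin m → ℝ)) (n : ℕ) : Fin m → ℝ :=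
  solZ θ hr hk (t - 1 - n) ω

/-- The volatilities. -/
def solD (t : ℤ) (ω : ℤ → core θ × (Fin m → ℝ)) : Matrix (Fin m) (Fin m) ℝ :=
  Matrix.diagonal (volOf θ hr (solPast θ hr hk t ω))

/-- The matrices whose normalizations are the conditional correlations. -/
def solQ (t : ℤ) (ω : ℤ → core θ × (Fin m → ℝ)) : Matrix (Fin m) (Fin m) ℝ :=
  unvech (vechQOf θ hr hk (solPast θ hr hk t ω))

/-- The conditional correlations. -/
def solR (t : ℤ) (ω : ℤ → core θ × (Fin m → ℝ)) : Matrix (Fin m) (Fin m) ℝ :=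
  corr (solQ θ hr hk t ω)

/-- Paths of the chain that follow the recursion and along which the influence of the remote past
vanishes. -/
structure IsRegularPath (ω : ℤ → core θ × (Fin m → ℝ)) : Prop where
  step_eq : ∀ t, (ω t).1 = coreStep θ ((ω (t - 1)).1, (ω t).2)
  tendsto_vol : ∀ t i, Tendsto (fun n : ℕ =>
    (companion θ.A ^ n *ᵥ fun u => (ω (t - n)).1.1 (.inl (.inl u))) i) atTop (𝓝 0)
  tendsto_Q : ∀ t i, Tendsto (fun n : ℕ =>
    ((companion fun i => vechConj (θ.M i)) ^ n *ᵥ fun u => (ω (t - n)).1.1 (.inr (.inl u))) i)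
      atTop (𝓝 0)

/-- The standardized residuals of the chain. -/
def chainResid (ω : ℤ → core θ × (Fin m → ℝ)) (t : ℤ) : Fin m → ℝ :=
  residOf θ (ω (t - 1)).1.1 (ω t).2

variable {θ}

namespace IsRegularPath

variable {ω : ℤ → core θ × (Fin m → ℝ)} (h : IsRegularPath θ ω)

include h

theorem state_eq (t : ℤ) : (ω t).1.1 = step θ (ω (t - 1)).1.1 (chainResid θ ω t) :=
  congrArg Subtype.val (h.step_eq t)

theorem solZ_eq (t : ℤ) (a : Fin m) :
    solZ θ hr hk t ω a = √(nextD θ (ω (t - 1)).1.1 a) * chainResid θ ω t a := by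
  have : ω t = (coreStep θ ((ω (t - 1)).1, (ω t).2), (ω t).2) := Prod.ext (h.step_eq t) rfl
  rw [solZ, this, obs_coreStep]
  rfl

theorem lag_vol (t : ℤ) (u : Fin r × Fin m) :
    (ω t).1.1 (.inl (.inl u)) = nextD θ (ω (t - u.1.val - 1)).1.1 u.2 :=
  shiftIn_eq_lag (v := fun t => nextD θ (ω (t - 1)).1.1)
    (Y := fun t u => (ω t).1.1 (.inl (.inl u))) (fun t => by
      funext u; exact congrFun (h.state_eq t) _) t u

theorem lag_sq (t : ℤ) (u : Fin s × Fin m) :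
    (ω t).1.1 (.inl (.inr u)) = solZ θ hr hk (t - u.1.val) ω u.2 ^ 2 :=
  shiftIn_eq_lag (v := fun t a => solZ θ hr hk t ω a ^ 2)
    (Y := fun t u => (ω t).1.1 (.inl (.inr u))) (fun t => by
      have : (fun a => solZ θ hr hk t ω a ^ 2)
          = fun a => nextD θ (ω (t - 1)).1.1 a * chainResid θ ω t a ^ 2 := by
        funext a
        rw [h.solZ_eq, mul_pow, Real.sq_sqrt (nextD_pos θ (ω _).1.2 a).le]
      rw [this]
      funext u; exact congrFun (h.state_eq t) _) t u

theorem lag_Q (t : ℤ) (u : Fin k × VechIdx m) :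
    (ω t).1.1 (.inr (.inl u)) = vech (nextQ θ (ω (t - u.1.val - 1)).1.1) u.2 :=
  shiftIn_eq_lag (v := fun t => vech (nextQ θ (ω (t - 1)).1.1))
    (Y := fun t u => (ω t).1.1 (.inr (.inl u))) (fun t => by
      funext u; exact congrFun (h.state_eq t) _) t u

theorem lag_resid (t : ℤ) (u : Fin l × VechIdx m) :
    (ω t).1.1 (.inr (.inr u)) = vech (Matrix.vecMulVec (chainResid θ ω (t - u.1.val))
      (chainResid θ ω (t - u.1.val))) u.2 :=
  shiftIn_eq_lag (v := fun t => vech (Matrix.vecMulVec (chainResid θ ω t) (chainResid θ ω t)))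
    (Y := fun t u => (ω t).1.1 (.inr (.inr u))) (fun t => by
      funext u; exact congrFun (h.state_eq t) _) t u

/-- The volatility lags satisfy a companion recursion whose inputs are past squared observations. On
a regular path its backward series converges to the true volatility. -/
theorem volOf_solPast (t : ℤ) :
    volOf θ hr (solPast θ hr hk t ω) = nextD θ (ω (t - 1)).1.1 := by
  have hrec : ∀ t, (fun u => (ω t).1.1 (.inl (.inl u)))
      = companion θ.A *ᵥ (fun u => (ω (t - 1)).1.1 (.inl (.inl u)))
        + shiftIn (θ.V₀ + ∑ j : Fin s, θ.B j *ᵥ fun b => solZ θ hr hk (t - 1 - j) ω b ^ 2) 0 := by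
    intro t
    rw [companion_mulVec, shiftIn_add, add_zero]
    have e1 : ∀ j : Fin s, (fun b => solZ θ hr hk (t - 1 - j) ω b ^ 2)
        = fun b => (ω (t - 1)).1.1 (.inl (.inr (j, b))) := fun j => by
      funext b; exact (h.lag_sq hr hk (t - 1) (j, b)).symm
    simp only [e1]
    have e2 : ∑ i, θ.A i *ᵥ (fun b => (ω (t - 1)).1.1 (.inl (.inl (i, b))))
        + (θ.V₀ + ∑ j, θ.B j *ᵥ fun b => (ω (t - 1)).1.1 (.inl (.inr (j, b))))
        = nextD θ (ω (t - 1)).1.1 := by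
      unfold nextD; abel
    rw [e2]
    funext u; exact congrFun (h.state_eq t) _
  have hlim := LinearRecursion.limitValue_eq hrec t (h.tendsto_vol t)
  funext a
  have e3 := congrFun hlim (⟨0, hr⟩, a)
  rw [h.lag_vol] at e3
  simp only [Nat.cast_zero, sub_zero] at e3
  rw [← e3, volOf]
  congr 1
  funext n
  congr 1
  congr 1
  refine Finset.sum_congr rfl fun j _ => ?_
  congr 1
  funext b
  have : t - 1 - ((n + (j : ℕ) : ℕ) : ℤ) = t - n - 1 - j := by push_cast; ring
  rw [solPast, this]

/-- Dropping the first `n + 1` entries of the past of `t` gives the past of `t - 1 - n`; the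
volatility at that earlier time is thus recovered, and dividing it out yields the residual. -/
theorem pastResid_solPast (t : ℤ) (n : ℕ) :
    pastResid θ hr (solPast θ hr hk t ω) n = chainResid θ ω (t - 1 - n) := by
  have e1 : (fun i => solPast θ hr hk t ω (n + 1 + i)) = solPast θ hr hk (t - 1 - n) ω := by
    funext i
    simp only [solPast]
    congr 1
    push_cast; ring
  funext a
  rw [pastResid, e1, h.volOf_solPast, solPast, h.solZ_eq, ← mul_assoc,
    inv_mul_cancel₀ (Real.sqrt_pos.2 (nextD_pos θ (ω _).1.2 a)).ne', one_mul]

/-- The same backward solution as for the volatilities, with inputs built from the residuals that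
`pastResid_solPast` has already recovered from the observations. -/
theorem vechQOf_solPast (t : ℤ) :
    vechQOf θ hr hk (solPast θ hr hk t ω) = vech (nextQ θ (ω (t - 1)).1.1) := by
  have hrec : ∀ t, (fun u => (ω t).1.1 (.inr (.inl u)))
      = (companion fun i => vechConj (θ.M i)) *ᵥ (fun u => (ω (t - 1)).1.1 (.inr (.inl u)))
        + shiftIn (vech θ.W₀ + ∑ j : Fin l, vechConj (θ.N j) *ᵥ
          vech (Matrix.vecMulVec (chainResid θ ω (t - 1 - j)) (chainResid θ ω (t - 1 - j)))) 0 := by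
    intro t
    rw [companion_mulVec, shiftIn_add, add_zero]
    have e1 : ∀ j : Fin l,
        vech (Matrix.vecMulVec (chainResid θ ω (t - 1 - j)) (chainResid θ ω (t - 1 - j)))
        = fun q => (ω (t - 1)).1.1 (.inr (.inr (j, q))) := fun j => by
      funext q; exact (h.lag_resid (t - 1) (j, q)).symm
    simp only [e1]
    have e2 : ∑ i, vechConj (θ.M i) *ᵥ (fun q => (ω (t - 1)).1.1 (.inr (.inl (i, q))))
        + (vech θ.W₀ + ∑ j, vechConj (θ.N j) *ᵥ fun q => (ω (t - 1)).1.1 (.inr (.inr (j, q))))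
        = vech (nextQ θ (ω (t - 1)).1.1) := by
      rw [vech_nextQ]; abel
    rw [e2]
    funext u; exact congrFun (h.state_eq t) _
  have hlim := LinearRecursion.limitValue_eq hrec t (h.tendsto_Q t)
  funext q
  have e3 := congrFun hlim (⟨0, hk⟩, q)
  rw [h.lag_Q] at e3
  simp only [Nat.cast_zero, sub_zero] at e3
  rw [← e3, vechQOf]
  congr 1
  funext n
  congr 1
  congr 1
  refine Finset.sum_congr rfl fun j _ => ?_
  rw [h.pastResid_solPast]
  have : t - 1 - ((n + (j : ℕ) : ℕ) : ℤ) = t - n - 1 - j := by push_cast; ring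
  rw [this]

theorem solD_eq (t : ℤ) : solD θ hr hk t ω = Matrix.diagonal (nextD θ (ω (t - 1)).1.1) := by
  rw [solD, h.volOf_solPast]

theorem solQ_eq (t : ℤ) : solQ θ hr hk t ω = nextQ θ (ω (t - 1)).1.1 := by
  rw [solQ, h.vechQOf_solPast, unvech_vech_nextQ]

theorem solR_eq (t : ℤ) : solR θ hr hk t ω = nextR θ (ω (t - 1)).1.1 := by
  rw [solR, h.solQ_eq]; rfl

theorem resid_eq (t : ℤ) : resid (solZ θ hr hk) (solD θ hr hk) t ω = chainResid θ ω t := by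
  funext a
  rw [resid, h.solD_eq, Matrix.diagonal_apply_eq, h.solZ_eq, ← mul_assoc,
    inv_mul_cancel₀ (Real.sqrt_pos.2 (nextD_pos θ (ω _).1.2 a)).ne', one_mul]

theorem innov_eq (t : ℤ) :
    innov (solZ θ hr hk) (solD θ hr hk) (solR θ hr hk) t ω = (ω t).2 := by
  have hu := isUnit_msqrt (nextR_posDef θ (core_subset θ (ω (t - 1)).1.2))
  rw [innov, h.resid_eq, h.solR_eq, chainResid, residOf, Matrix.mulVec_mulVec,
    Matrix.nonsing_inv_mul _ ((Matrix.isUnit_iff_isUnit_det _).1 hu), Matrix.one_mulVec]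

theorem stateAt_eq (t : ℤ) :
    stateAt r s k l (solZ θ hr hk) (solD θ hr hk) (solQ θ hr hk) t ω = (ω t).1.1 := by
  funext u
  rcases u with (u | u) | (u | u)
  · rw [h.lag_vol]
    simp only [stateAt, Sum.elim_inl, h.solD_eq, Matrix.diagonal_apply_eq]
  · rw [h.lag_sq hr hk]
    rfl
  · rw [h.lag_Q]
    simp only [stateAt, Sum.elim_inl, Sum.elim_inr, h.solQ_eq]
  · rw [h.lag_resid]
    simp only [stateAt, Sum.elim_inr, h.resid_eq]

end IsRegularPath

end Solution

end DCC

end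

noncomputable section

/-! ### The Markov property at an arbitrary time. -/

namespace StationaryChain

variable {E : Type*} [MeasurableSpace E]

/-- The past up to a given time, listed backwards. -/
def pastAt (t : ℤ) (ω : ℤ → E) : ℕ → E := fun n => ω (t - n)

theorem measurable_pastAt (t : ℤ) : Measurable (pastAt (E := E) t) :=
  measurable_pi_lambda _ fun _ => measurable_pi_apply _

theorem markov_at {K : Kernel E E} {μ : Measure (ℤ → E)}
    (hshift : ∀ a : ℤ, μ.map (fun ω t => ω (t + a)) = μ)
    (hmarkov : μ.map (fun ω => (past ω, ω 1)) = (μ.map past) ⊗ₘ pastKernel K) (t : ℤ) :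
    μ.map (fun ω => (pastAt (t - 1) ω, ω t)) = (μ.map (pastAt (t - 1))) ⊗ₘ pastKernel K := by
  have hS : Measurable fun (ω : ℤ → E) (u : ℤ) => ω (u + (t - 1)) :=
    measurable_pi_lambda _ fun _ => measurable_pi_apply _
  have hp : Measurable fun ω : ℤ → E => (past ω, ω 1) :=
    measurable_past.prodMk (measurable_pi_apply _)
  have e1 : past ∘ (fun (ω : ℤ → E) (u : ℤ) => ω (u + (t - 1))) = pastAt (t - 1) := by
    funext ω n
    simp only [past, pastAt, Function.comp]
    congr 1; ring
  have e2 : (fun ω : ℤ → E => (past ω, ω 1)) ∘ (fun (ω : ℤ → E) (u : ℤ) => ω (u + (t - 1)))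
      = fun ω => (pastAt (t - 1) ω, ω t) := by
    funext ω
    have := congrFun e1 ω
    simp only [Function.comp] at this ⊢
    rw [this]
    congr 2; ring
  rw [← hshift (t - 1), Measure.map_map hp hS, Measure.map_map measurable_past hS, e1, e2]
    at hmarkov
  exact hmarkov

end StationaryChain

namespace DCC

open StationaryChain

/-! ### Regularity of paths, measurability and conditional expectations. -/

section Verification

variable {m r s k l : ℕ} {θ : Params m r s k l} {κ : Kernel (State m r s k l) (Fin m → ℝ)}
  [IsMarkovKernel κ] {p : ℕ} {μ : Measure (ℤ → core θ × (Fin m → ℝ))} [IsProbabilityMeasure μ]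

/-- The transition kernel is carried by the graph of `coreStep`, so the recursion holds almost
surely at each of countably many times. The two decay conditions concern blocks of `T` free of `ε`,
where `summable_block_pow` applies. -/
theorem ae_isRegularPath (hp : 1 ≤ p) (hE1 : AssumptionE1 θ κ p)
    (hshift : ∀ a : ℤ, μ.map (fun ω t => ω (t + a)) = μ)
    (hmarkov : μ.map (fun ω => (past ω, ω 1)) = (μ.map past) ⊗ₘ pastKernel (coreKernel θ κ))
    {B : NNReal} (hB : ∀ t i, ∫⁻ ω, ENNReal.ofReal (|(ω t).1.1 i| ^ p) ∂μ ≤ B) :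
    ∀ᵐ ω ∂μ, IsRegularPath θ ω := by
  have h1 : ∀ t : ℤ, ∀ᵐ ω ∂μ, (ω t).1 = coreStep θ ((ω (t - 1)).1, (ω t).2) := by
    intro t
    have hset : MeasurableSet {x : (ℕ → core θ × (Fin m → ℝ)) × (core θ × (Fin m → ℝ)) |
        x.2.1 = coreStep θ ((x.1 0).1, x.2.2)} := by
      refine measurableSet_eq_fun (measurable_fst.comp measurable_snd) ?_
      refine (continuous_coreStep θ).measurable.comp (Measurable.prodMk ?_ ?_)
      · exact measurable_fst.comp ((measurable_pi_apply 0).comp measurable_fst)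
      · exact measurable_snd.comp measurable_snd
    have : IsProbabilityMeasure (μ.map (pastAt (t - 1))) :=
      Measure.isProbabilityMeasure_map (measurable_pastAt _).aemeasurable
    have h := (Measure.ae_compProd_iff (μ := μ.map (pastAt (t - 1)))
      (κ := pastKernel (coreKernel θ κ)) hset).2 (ae_of_all _ fun q => by
        rw [pastKernel, Kernel.comap_apply, coreKernel_apply]
        exact (ae_map_iff (p := fun b => b.1 = coreStep θ ((q 0).1, b.2))
          (measurable_coreStep_right θ _).aemeasurable (measurable_prodMk_left hset)).2
          (ae_of_all _ fun e => rfl))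
    rw [← markov_at hshift hmarkov t] at h
    have h' := ae_of_ae_map
      ((measurable_pastAt (t - 1)).prodMk (measurable_pi_apply t)).aemeasurable h
    filter_upwards [h'] with ω hω
    simpa [pastAt] using hω
  have hm : ∀ t i, Measurable fun ω : ℤ → core θ × (Fin m → ℝ) => (ω t).1.1 i := fun t i =>
    (measurable_pi_apply i).comp (measurable_subtype_coe.comp
      (measurable_fst.comp (measurable_pi_apply t)))
  have h2 := LinearRecursion.ae_tendsto_pow_mulVec (P := μ) (S := companion θ.A) hp
    (summable_block_pow hE1 (f := fun u => .inl (.inl u))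
      (Sum.inl_injective.comp Sum.inl_injective) fun _ _ _ => rfl)
    (Y := fun t ω u => (ω t).1.1 (.inl (.inl u)))
    (fun t => measurable_pi_lambda _ fun i => hm t _) fun t i => hB t _
  have h3 := LinearRecursion.ae_tendsto_pow_mulVec (P := μ)
    (S := companion fun i => vechConj (θ.M i)) hp
    (summable_block_pow hE1 (f := fun u => .inr (.inl u))
      (Sum.inr_injective.comp Sum.inl_injective) fun _ _ _ => rfl)
    (Y := fun t ω u => (ω t).1.1 (.inr (.inl u)))
    (fun t => measurable_pi_lambda _ fun i => hm t _) fun t i => hB t _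
  filter_upwards [ae_all_iff.2 h1, h2, h3] with ω g1 g2 g3
  exact ⟨g1, g2, g3⟩

variable (hr : 0 < r) (hk : 0 < k)

theorem measurable_solZ (t : ℤ) : Measurable (solZ θ hr hk t) :=
  (continuous_obs θ hr hk).measurable.comp (measurable_pi_apply t)

theorem obsSigma_le (t : ℤ) :
    obsSigma (solZ θ hr hk) t ≤ (inferInstance : MeasurableSpace (ℤ → core θ × (Fin m → ℝ))) :=
  iSup_le fun u => iSup_le fun _ => (measurable_solZ hr hk u).comap_le

theorem obsSigma_le_comap_pastAt (t : ℤ) :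
    obsSigma (solZ θ hr hk) t ≤ MeasurableSpace.comap (pastAt t) inferInstance := by
  refine iSup_le fun u => iSup_le fun hu => Measurable.comap_le ?_
  have : solZ θ hr hk u = (fun q => obs θ hr hk (q (t - u).toNat)) ∘ pastAt t := by
    funext ω
    simp only [solZ, Function.comp, pastAt]
    congr 2; lia
  rw [this]
  exact ((continuous_obs θ hr hk).measurable.comp (measurable_pi_apply _)).comp
    (comap_measurable _)

theorem measurable_solZ_obsSigma {t u : ℤ} (h : u ≤ t) :
    Measurable[obsSigma (solZ θ hr hk) t] (solZ θ hr hk u) :=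
  (comap_measurable (solZ θ hr hk u)).mono (le_iSup₂_of_le u h le_rfl) le_rfl

theorem measurable_solPast {t u : ℤ} (h : u ≤ t) :
    Measurable[obsSigma (solZ θ hr hk) (t - 1)] (solPast θ hr hk u) :=
  @measurable_pi_lambda _ _ _ (obsSigma (solZ θ hr hk) (t - 1)) _ _ fun n =>
    measurable_solZ_obsSigma hr hk (by lia)

theorem measurable_diagonal : Measurable (Matrix.diagonal : (Fin m → ℝ) → Matrix (Fin m) (Fin m) ℝ) := by
  refine measurable_pi_lambda _ fun i => measurable_pi_lambda _ fun j => ?_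
  by_cases h : i = j
  · subst h; simpa using measurable_pi_apply i
  · simp [h]

theorem measurable_solD {t u : ℤ} (h : u ≤ t) :
    Measurable[obsSigma (solZ θ hr hk) (t - 1)] (solD θ hr hk u) :=
  measurable_diagonal.comp ((measurable_volOf θ hr).comp (measurable_solPast hr hk h))

theorem measurable_solQ {t u : ℤ} (h : u ≤ t) :
    Measurable[obsSigma (solZ θ hr hk) (t - 1)] (solQ θ hr hk u) :=
  measurable_unvech.comp ((measurable_vechQOf θ hr hk).comp (measurable_solPast hr hk h))

theorem measurable_solR {t u : ℤ} (h : u ≤ t) :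
    Measurable[obsSigma (solZ θ hr hk) (t - 1)] (solR θ hr hk u) :=
  measurable_corr.comp (measurable_solQ hr hk h)

theorem measurable_stateAt {Ω : Type} {mΩ : MeasurableSpace Ω} {z : ℤ → Ω → Fin m → ℝ}
    {D Q : ℤ → Ω → Matrix (Fin m) (Fin m) ℝ} {t : ℤ} (hz : ∀ u ≤ t, Measurable (z u))
    (hD : ∀ u ≤ t, Measurable (D u)) (hQ : ∀ u ≤ t, Measurable (Q u)) :
    Measurable (stateAt r s k l z D Q t) := by
  have hle : ∀ n : ℕ, t - (n : ℤ) ≤ t := fun n => by lia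
  have hij : ∀ {M : Ω → Matrix (Fin m) (Fin m) ℝ}, Measurable M → ∀ i j,
      Measurable fun ω => M ω i j := fun hM i j =>
    measurable_pi_iff.1 (measurable_pi_iff.1 hM i) j
  have hres : ∀ u ≤ t, ∀ a, Measurable fun ω => resid z D u ω a := fun u hu a =>
    (hij (hD u hu) a a).sqrt.inv.mul (measurable_pi_iff.1 (hz u hu) a)
  refine measurable_pi_lambda _ fun i => ?_
  rcases i with (u | u) | (u | u)
  · exact hij (hD _ (hle _)) _ _
  · exact (measurable_pi_iff.1 (hz _ (hle _)) _).pow_const 2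
  · exact hij (hQ _ (hle _)) _ _
  · exact (hres _ (hle _) _).mul (hres _ (hle _) _)

/-- Given the full past of the chain, the conditional expectation of `G (ω t)` is the kernel
integral. The observations generate a smaller σ-algebra; if the integral has a version `c`
measurable for it, then `c` is the conditional expectation there too. The proof compares integrals
over events of the smaller σ-algebra, written as preimages under `pastAt`. -/
theorem condExp_chain (hshift : ∀ a : ℤ, μ.map (fun ω t => ω (t + a)) = μ)
    (hmarkov : μ.map (fun ω => (past ω, ω 1)) = (μ.map past) ⊗ₘ pastKernel (coreKernel θ κ))
    (t : ℤ) {G : core θ × (Fin m → ℝ) → ℝ} (hG : Measurable G)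
    (hint : Integrable (fun ω => G (ω t)) μ) {c : (ℤ → core θ × (Fin m → ℝ)) → ℝ}
    (hc : Measurable[obsSigma (solZ θ hr hk) (t - 1)] c)
    (hcG : c =ᵐ[μ] fun ω =>
      ∫ e, G (coreStep θ ((ω (t - 1)).1, e), e) ∂(κ (ω (t - 1)).1.1)) :
    μ[fun ω => G (ω t) | obsSigma (solZ θ hr hk) (t - 1)] =ᵐ[μ] c := by
  have hpm := measurable_pastAt (E := core θ × (Fin m → ℝ)) (t - 1)
  have hpair : Measurable fun ω : ℤ → core θ × (Fin m → ℝ) => (pastAt (t - 1) ω, ω t) :=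
    hpm.prodMk (measurable_pi_apply t)
  set ν := μ.map (pastAt (t - 1)) with hν
  have : IsProbabilityMeasure ν := Measure.isProbabilityMeasure_map hpm.aemeasurable
  have hG2 : Measurable fun x : (ℕ → core θ × (Fin m → ℝ)) × (core θ × (Fin m → ℝ)) => G x.2 :=
    hG.comp measurable_snd
  have hGint : Integrable (fun x : (ℕ → core θ × (Fin m → ℝ)) × (core θ × (Fin m → ℝ)) => G x.2)
      (ν ⊗ₘ pastKernel (coreKernel θ κ)) := by
    rw [hν, ← markov_at hshift hmarkov t]
    exact (integrable_map_measure hG2.aestronglyMeasurable hpair.aemeasurable).2 hint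
  have hker : ∀ q : ℕ → core θ × (Fin m → ℝ), ∫ y, G y ∂(pastKernel (coreKernel θ κ) q)
      = ∫ e, G (coreStep θ ((q 0).1, e), e) ∂(κ (q 0).1.1) := by
    intro q
    rw [pastKernel, Kernel.comap_apply, coreKernel_apply,
      integral_map (measurable_coreStep_right θ _).aemeasurable hG.aestronglyMeasurable]
  have hcG' : c =ᵐ[μ] fun ω => ∫ y, G y ∂(pastKernel (coreKernel θ κ) (pastAt (t - 1) ω)) := by
    filter_upwards [hcG] with ω hω
    rw [hω, hker]
    simp [pastAt]
  have hI : Integrable (fun q => ∫ y, G y ∂(pastKernel (coreKernel θ κ) q)) ν :=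
    -- The measure is viewed as a kernel from the one-point space, since the integrability statement
    -- used concerns composition-products of kernels.
    Integrable.integral_compProd (κ := Kernel.const Unit ν)
      (η := Kernel.prodMkLeft Unit (pastKernel (coreKernel θ κ))) (a := ()) hGint
  have hIc : Integrable c μ := ((integrable_map_measure hI.1 hpm.aemeasurable).1 hI).congr hcG'.symm
  refine (ae_eq_condExp_of_forall_setIntegral_eq (obsSigma_le hr hk (t - 1)) hint
    (fun A _ _ => hIc.integrableOn) (fun A hA _ => ?_) hc.aestronglyMeasurable).symm
  obtain ⟨A', hA', rfl⟩ := obsSigma_le_comap_pastAt hr hk (t - 1) A hA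
  rw [setIntegral_congr_ae (hpm hA') (hcG'.mono fun ω h _ => h),
    ← setIntegral_map hA' hI.1 hpm.aemeasurable]
  have h1 := Measure.setIntegral_compProd hA' MeasurableSet.univ (hGint.integrableOn (s := A' ×ˢ Set.univ))
  simp only [Measure.restrict_univ] at h1
  rw [← hν, ← h1, hν, ← markov_at hshift hmarkov t,
    setIntegral_map (hA'.prod MeasurableSet.univ) hG2.aestronglyMeasurable
      hpair.aemeasurable]
  congr 2
  ext ω; simp

end Verification

end DCC

end

noncomputable section

namespace DCC

open StationaryChain

/-! ### First and second conditional moments of the residuals. -/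

section Residuals

variable {m r s k l : ℕ} {θ : Params m r s k l} {κ : Kernel (State m r s k l) (Fin m → ℝ)}

theorem integral_residOf (hκ : IsStandardized κ) {x : State m r s k l}
    (hx : x ∈ stateSpace m r s k l) (a : Fin m) : ∫ e, residOf θ x e a ∂(κ x) = 0 := by
  have h := (hκ x hx).1
  simp only [residOf, Matrix.mulVec, dotProduct]
  rw [integral_finsetSum _ fun b _ => (h b).1.const_mul _]
  simp [integral_const_mul, (h _).2]

/-- The covariance of `R^{1/2} η` is `R^{1/2} I R^{1/2} = R`, written entrywise. -/
theorem integral_residOf_mul (hκ : IsStandardized κ) {x : State m r s k l}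
    (hx : x ∈ stateSpace m r s k l) (a b : Fin m) :
    ∫ e, residOf θ x e a * residOf θ x e b ∂(κ x) = nextR θ x a b := by
  have h := (hκ x hx).2
  have e1 : ∀ e : Fin m → ℝ, residOf θ x e a * residOf θ x e b
      = ∑ c, ∑ d, msqrt (nextR θ x) a c * msqrt (nextR θ x) b d * (e c * e d) := by
    intro e
    simp only [residOf, Matrix.mulVec, dotProduct, Finset.sum_mul_sum]
    exact Finset.sum_congr rfl fun c _ => Finset.sum_congr rfl fun d _ => by ring
  simp only [e1]
  rw [integral_finsetSum _ fun c _ => integrable_finsetSum _ fun d _ => (h c d).1.const_mul _,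
    ← msqrt_sq_sum (nextR_posDef θ hx).posSemidef]
  refine Finset.sum_congr rfl fun c _ => ?_
  rw [integral_finsetSum _ fun d _ => (h c d).1.const_mul _]
  simp [integral_const_mul, (h c _).2, Matrix.one_apply]

end Residuals

theorem strictlyStationary_of_equivariant {E F : Type} [MeasurableSpace E] [MeasurableSpace F]
    {μ : Measure (ℤ → E)} (hshift : ∀ a : ℤ, μ.map (fun ω t => ω (t + a)) = μ)
    {Y : ℤ → (ℤ → E) → F} (hY : ∀ t, Measurable (Y t))
    (hYs : ∀ t a ω, Y (t + a) ω = Y t fun u => ω (u + a)) : StrictlyStationary μ Y := by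
  refine ⟨hY, fun a => ?_⟩
  have hT : Measurable fun (ω : ℤ → E) (u : ℤ) => ω (u + a) :=
    measurable_pi_lambda _ fun _ => measurable_pi_apply _
  conv_rhs => rw [← hshift a, Measure.map_map (measurable_pi_lambda _ hY) hT]
  simp only [hYs]
  rfl

/-! ### Verification of the model equations, moments and stationarity. -/

section Main

variable {m r s k l : ℕ} {θ : Params m r s k l} {κ : Kernel (State m r s k l) (Fin m → ℝ)}
  {p : ℕ} {μ : Measure (ℤ → core θ × (Fin m → ℝ))} (hr : 0 < r) (hk : 0 < k)

/-- The square of each observation is a coordinate of the state, present because `s > 0`; the `p`-th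
moment of that coordinate is the `2p`-th moment of the observation. -/
theorem memLp_solZ (hs : 0 < s) (hp : 1 ≤ p) (hreg : ∀ᵐ ω ∂μ, IsRegularPath θ ω)
    {B : NNReal} (hB : ∀ t i, ∫⁻ ω, ENNReal.ofReal (|(ω t).1.1 i| ^ p) ∂μ ≤ B) (t : ℤ) :
    MemLp (solZ θ hr hk t) (2 * p : ℕ) μ := by
  refine memLp_pi_iff.2 fun a => ?_
  have hz : Measurable fun ω => solZ θ hr hk t ω a := measurable_pi_iff.1 (measurable_solZ hr hk t) a
  rw [← integrable_norm_rpow_iff hz.aestronglyMeasurable (by simp; lia)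
    (ENNReal.natCast_ne_top _), ENNReal.toReal_natCast]
  simp only [Real.rpow_natCast]
  have hX : Measurable fun ω : ℤ → core θ × (Fin m → ℝ) => (ω t).1.1 (.inl (.inr (⟨0, hs⟩, a))) :=
    (measurable_pi_apply _).comp (measurable_subtype_coe.comp
      (measurable_fst.comp (measurable_pi_apply t)))
  have hI : Integrable
      (fun ω : ℤ → core θ × (Fin m → ℝ) => |(ω t).1.1 (.inl (.inr (⟨0, hs⟩, a)))| ^ p) μ := by
    refine ⟨(hX.abs.pow_const p).aestronglyMeasurable, ?_⟩
    rw [hasFiniteIntegral_iff_ofReal (ae_of_all _ fun ω => by positivity)]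
    exact (hB t _).trans_lt ENNReal.coe_lt_top
  refine hI.congr ?_
  filter_upwards [hreg] with ω h
  rw [h.lag_sq hr hk]
  rw [abs_pow, pow_mul, Real.norm_eq_abs]
  simp

theorem innov_law_solution [IsMarkovKernel κ] [IsProbabilityMeasure μ]
    (hreg : ∀ᵐ ω ∂μ, IsRegularPath θ ω)
    (hshift : ∀ a : ℤ, μ.map (fun ω t => ω (t + a)) = μ)
    (hmarkov : μ.map (fun ω => (past ω, ω 1)) = (μ.map past) ⊗ₘ pastKernel (coreKernel θ κ))
    (t : ℤ) {S : Set (Fin m → ℝ)} (hS : MeasurableSet S) :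
    μ⟦innov (solZ θ hr hk) (solD θ hr hk) (solR θ hr hk) t ⁻¹' S | obsSigma (solZ θ hr hk) (t - 1)⟧
      =ᵐ[μ] fun ω =>
        (κ (stateAt r s k l (solZ θ hr hk) (solD θ hr hk) (solQ θ hr hk) (t - 1) ω)).real S := by
  have hG : Measurable fun y : core θ × (Fin m → ℝ) => S.indicator (fun _ => (1 : ℝ)) y.2 :=
    (measurable_const.indicator hS).comp measurable_snd
  -- Without this, `κ` at the state would only be known to be measurable for the chain's past; it
  -- holds because all blocks are rebuilt from observations.
  have hst : Measurable[obsSigma (solZ θ hr hk) (t - 1)]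
      (stateAt r s k l (solZ θ hr hk) (solD θ hr hk) (solQ θ hr hk) (t - 1)) :=
    @measurable_stateAt m r s k l _ (obsSigma (solZ θ hr hk) (t - 1)) _ _ _ _
      (fun u hu => measurable_solZ_obsSigma hr hk hu)
      (fun u hu => measurable_solD hr hk (by lia)) (fun u hu => measurable_solQ hr hk (by lia))
  have hc : Measurable[obsSigma (solZ θ hr hk) (t - 1)] fun ω =>
      (κ (stateAt r s k l (solZ θ hr hk) (solD θ hr hk) (solQ θ hr hk) (t - 1) ω)).real S :=
    ((κ.measurable_coe hS).ennreal_toReal).comp hst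
  have hint : Integrable (fun ω : ℤ → core θ × (Fin m → ℝ) =>
      S.indicator (fun _ => (1 : ℝ)) (ω t).2) μ := by
    refine Integrable.of_bound (C := 1) (hG.comp (measurable_pi_apply t)).aestronglyMeasurable
      (ae_of_all _ fun ω => ?_)
    by_cases h : (ω t).2 ∈ S <;> simp [h]
  refine (condExp_congr_ae ?_).trans (condExp_chain hr hk hshift hmarkov t hG hint hc ?_)
  · filter_upwards [hreg] with ω h
    have e : ω ∈ innov (solZ θ hr hk) (solD θ hr hk) (solR θ hr hk) t ⁻¹' S ↔ (ω t).2 ∈ S := by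
      rw [Set.mem_preimage, h.innov_eq hr hk]
    by_cases hω : (ω t).2 ∈ S
    · rw [Set.indicator_of_mem hω, Set.indicator_of_mem (e.2 hω)]
    · rw [Set.indicator_of_notMem hω, Set.indicator_of_notMem (mt e.1 hω)]
  · filter_upwards [hreg] with ω h
    simp only [h.stateAt_eq hr hk]
    rw [integral_indicator hS]
    simp

theorem condExp_solZ [IsMarkovKernel κ] [IsProbabilityMeasure μ] (hκ : IsStandardized κ)
    (hshift : ∀ a : ℤ, μ.map (fun ω t => ω (t + a)) = μ)
    (hmarkov : μ.map (fun ω => (past ω, ω 1)) = (μ.map past) ⊗ₘ pastKernel (coreKernel θ κ))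
    (t : ℤ) (a : Fin m) (hint : Integrable (fun ω => solZ θ hr hk t ω a) μ) :
    μ[fun ω => solZ θ hr hk t ω a | obsSigma (solZ θ hr hk) (t - 1)] =ᵐ[μ] 0 := by
  refine condExp_chain hr hk hshift hmarkov t (G := fun y => obs θ hr hk y a)
    (measurable_pi_iff.1 (continuous_obs θ hr hk).measurable a) hint measurable_const
    (ae_of_all _ fun ω => ?_)
  simp only [obs_coreStep, integral_const_mul]
  rw [integral_residOf hκ (core_subset θ (ω (t - 1)).1.2), mul_zero]
  rfl

theorem condExp_solZ_mul [IsMarkovKernel κ] [IsProbabilityMeasure μ] (hκ : IsStandardized κ)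
    (hreg : ∀ᵐ ω ∂μ, IsRegularPath θ ω)
    (hshift : ∀ a : ℤ, μ.map (fun ω t => ω (t + a)) = μ)
    (hmarkov : μ.map (fun ω => (past ω, ω 1)) = (μ.map past) ⊗ₘ pastKernel (coreKernel θ κ))
    (t : ℤ) (a b : Fin m)
    (hint : Integrable (fun ω => solZ θ hr hk t ω a * solZ θ hr hk t ω b) μ) :
    μ[fun ω => solZ θ hr hk t ω a * solZ θ hr hk t ω b | obsSigma (solZ θ hr hk) (t - 1)]
      =ᵐ[μ] fun ω => condCov (solD θ hr hk t ω) (solR θ hr hk t ω) a b := by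
  have hobs := measurable_pi_iff.1 (continuous_obs θ hr hk).measurable
  have hij : ∀ {M : (ℤ → core θ × (Fin m → ℝ)) → Matrix (Fin m) (Fin m) ℝ},
      Measurable[obsSigma (solZ θ hr hk) (t - 1)] M → ∀ i j,
      Measurable[obsSigma (solZ θ hr hk) (t - 1)] fun ω => M ω i j := fun hM i j =>
    (measurable_pi_apply j).comp ((measurable_pi_apply i).comp hM)
  have hval : ∀ D R : Matrix (Fin m) (Fin m) ℝ,
      condCov D R a b = √(D a a) * R a b * √(D b b) := fun D R => by
    simp [condCov, Matrix.mul_diagonal, Matrix.diagonal_mul]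
  simp only [hval]
  have hD : ∀ i, Measurable[obsSigma (solZ θ hr hk) (t - 1)] fun ω => √(solD θ hr hk t ω i i) :=
    fun i => (hij (measurable_solD hr hk (le_refl t)) i i).sqrt
  have hR := hij (measurable_solR (θ := θ) hr hk (le_refl t))
  refine condExp_chain hr hk hshift hmarkov t (G := fun y => obs θ hr hk y a * obs θ hr hk y b)
    ((hobs a).mul (hobs b)) hint
    (((hD a).mul (hR a b)).mul (hD b)) ?_
  filter_upwards [hreg] with ω h
  have e1 : ∀ e : Fin m → ℝ, √(nextD θ (ω (t - 1)).1.1 a) * residOf θ (ω (t - 1)).1.1 e a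
        * (√(nextD θ (ω (t - 1)).1.1 b) * residOf θ (ω (t - 1)).1.1 e b)
      = √(nextD θ (ω (t - 1)).1.1 a) * √(nextD θ (ω (t - 1)).1.1 b)
        * (residOf θ (ω (t - 1)).1.1 e a * residOf θ (ω (t - 1)).1.1 e b) := fun e => by ring
  simp only [obs_coreStep, e1, integral_const_mul]
  rw [integral_residOf_mul hκ (core_subset θ (ω (t - 1)).1.2), h.solD_eq, h.solR_eq,
    Matrix.diagonal_apply_eq, Matrix.diagonal_apply_eq]
  ring

theorem isSolution_of_isRegularPath [IsMarkovKernel κ] [IsProbabilityMeasure μ]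
    (hκ : IsStandardized κ) (hs : 0 < s) (hp : 1 ≤ p) (hreg : ∀ᵐ ω ∂μ, IsRegularPath θ ω)
    (hshift : ∀ a : ℤ, μ.map (fun ω t => ω (t + a)) = μ)
    (hmarkov : μ.map (fun ω => (past ω, ω 1)) = (μ.map past) ⊗ₘ pastKernel (coreKernel θ κ))
    {B : NNReal} (hB : ∀ t i, ∫⁻ ω, ENNReal.ofReal (|(ω t).1.1 i| ^ p) ∂μ ≤ B) :
    IsSolution θ κ μ (solZ θ hr hk) (solD θ hr hk) (solR θ hr hk) (solQ θ hr hk) := by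
  -- Since `p ≥ 1`, the `2p`-th moment gives square integrability, which covers both conditional
  -- moments of the model.
  have hL2 : ∀ t a, MemLp (fun ω => solZ θ hr hk t ω a) 2 μ := fun t a =>
    (memLp_pi_iff.1 (memLp_solZ hr hk hs hp hreg hB t) a).mono_exponent
      (by exact_mod_cast (by lia : 2 ≤ 2 * p))
  have hlag : ∀ (t : ℤ) (n : ℕ), t - 1 - (n : ℤ) = t - ((n : ℤ) + 1) := fun t n => by ring
  refine
    { z_meas := measurable_solZ hr hk
      D_meas := fun t => (measurable_solD hr hk (le_refl t)).mono (obsSigma_le hr hk _) le_rfl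
      R_meas := fun t => (measurable_solR hr hk (le_refl t)).mono (obsSigma_le hr hk _) le_rfl
      Q_meas := fun t => (measurable_solQ hr hk (le_refl t)).mono (obsSigma_le hr hk _) le_rfl
      D_diag := ?_
      D_eq := ?_
      Q_posDef := ?_
      Q_eq := ?_
      R_eq := ae_of_all _ fun ω t => rfl
      innov_law := fun t S hS => innov_law_solution hr hk hreg hshift hmarkov t hS
      cond_mean := fun t a => ?_
      cond_cov := fun t a b => ?_ }
  · filter_upwards [hreg] with ω h t
    rw [h.solD_eq]
    exact ⟨Matrix.isDiag_diagonal _, fun a => by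
      simpa using nextD_pos θ (ω (t - 1)).1.2 a⟩
  · filter_upwards [hreg] with ω h t
    simp only [h.solD_eq, Matrix.diag_diagonal]
    rw [nextD]
    simp only [h.lag_vol, h.lag_sq hr hk, hlag]
  · filter_upwards [hreg] with ω h t
    rw [h.solQ_eq]
    exact nextQ_posDef θ (core_subset θ (ω (t - 1)).1.2)
  · filter_upwards [hreg] with ω h t
    simp only [h.solQ_eq, h.resid_eq]
    rw [nextQ]
    have e1 : ∀ j : Fin l, (unvech fun q => (ω (t - 1)).1.1 (.inr (.inr (j, q))))
        = Matrix.vecMulVec (chainResid θ ω (t - ((j : ℤ) + 1)))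
          (chainResid θ ω (t - ((j : ℤ) + 1))) := fun j =>
      unvech_eq_vecMulVec fun q => by
        rw [h.lag_resid, hlag, vech, Matrix.vecMulVec_apply]
    have e2 : ∀ i : Fin k, (unvech fun q => (ω (t - 1)).1.1 (.inr (.inl (i, q))))
        = nextQ θ (ω (t - ((i : ℤ) + 1) - 1)).1.1 := fun i => by
      simp only [h.lag_Q, hlag]
      exact unvech_vech_nextQ θ _
    simp only [e1, e2]
  · have hint := (hL2 t a).integrable one_le_two
    exact ⟨hint, condExp_solZ hr hk hκ hshift hmarkov t a hint⟩
  · have hint : Integrable (fun ω => solZ θ hr hk t ω a * solZ θ hr hk t ω b) μ :=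
      (hL2 t a).integrable_mul (hL2 t b)
    exact ⟨hint, condExp_solZ_mul hr hk hκ hreg hshift hmarkov t a b hint⟩

theorem strictlyStationary_solution (hshift : ∀ a : ℤ, μ.map (fun ω t => ω (t + a)) = μ) :
    StrictlyStationary μ (fun t ω =>
      (solZ θ hr hk t ω, solD θ hr hk t ω, solR θ hr hk t ω, solQ θ hr hk t ω)) := by
  refine strictlyStationary_of_equivariant hshift (fun t => ?_) fun t a ω => ?_
  · exact (measurable_solZ hr hk t).prodMk
      (((measurable_solD hr hk (le_refl t)).mono (obsSigma_le hr hk _) le_rfl).prodMk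
      (((measurable_solR hr hk (le_refl t)).mono (obsSigma_le hr hk _) le_rfl).prodMk
      ((measurable_solQ hr hk (le_refl t)).mono (obsSigma_le hr hk _) le_rfl)))
  · have e1 : ∀ u, solZ θ hr hk (u + a) ω = solZ θ hr hk u fun u => ω (u + a) := fun u => by
      rw [solZ, solZ]
    have e2 : solPast θ hr hk (t + a) ω = solPast θ hr hk t fun u => ω (u + a) := by
      funext n
      rw [solPast, solPast, ← e1]
      congr 1; ring
    simp only [solR, solD, solQ, e2, e1]

end Main

end DCC

end

theorem theorem1 {m r s k l : ℕ} (hr : 0 < r) (hs : 0 < s) (hk : 0 < k) (hl : 0 < l)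
    (θ : DCC.Params m r s k l) (κ : Kernel (DCC.State m r s k l) (Fin m → ℝ)) [IsMarkovKernel κ]
    (hκ : DCC.IsStandardized κ) (p : ℕ) (hp : 1 ≤ p)
    (hE1 : DCC.AssumptionE1 θ κ p) (hE2 : DCC.AssumptionE2 κ p) :
    ∃ (Ω : Type) (_ : MeasurableSpace Ω) (P : Measure Ω) (_ : IsProbabilityMeasure P)
      (z : ℤ → Ω → Fin m → ℝ) (D R Q : ℤ → Ω → Matrix (Fin m) (Fin m) ℝ),
      DCC.IsSolution θ κ P z D R Q ∧
      DCC.StrictlyStationary P (fun t ω => (z t ω, D t ω, R t ω, Q t ω)) ∧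
      (∀ t, Measurable[DCC.obsSigma z (t - 1)] (D t) ∧
        Measurable[DCC.obsSigma z (t - 1)] (R t) ∧
        Measurable[DCC.obsSigma z (t - 1)] (Q t)) ∧
      ∀ t, MemLp (z t) (2 * p : ℕ) P := by
  obtain ⟨μ, hμ, hshift, hmarkov, B, hB⟩ := DCC.exists_stationary_chain (θ := θ) hκ hp hE1 hE2
  have hreg := DCC.ae_isRegularPath hp hE1 hshift hmarkov hB
  exact ⟨_, inferInstance, μ, hμ, DCC.solZ θ hr hk, DCC.solD θ hr hk, DCC.solR θ hr hk,
    DCC.solQ θ hr hk, DCC.isSolution_of_isRegularPath hr hk hκ hs hp hreg hshift hmarkov hB,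
    DCC.strictlyStationary_solution hr hk hshift,
    fun t => ⟨DCC.measurable_solD hr hk (le_refl t), DCC.measurable_solR hr hk (le_refl t),
      DCC.measurable_solQ hr hk (le_refl t)⟩,
    DCC.memLp_solZ hr hk hs hp hreg hB⟩
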